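/- Let $L,\rho_1,\rho_2,k_1,k_2,k_3>0$ with $\frac{\rho_1}{k_1}\neq\frac{\rho_2}{k_2}$ and $k_1=k_3$. Assume: (A1) $g:[0,\infty)\to[0,\infty)$ is non-increasing and differentiable, $g(0)>0$, and $k_2-\int_0^\infty g(s)\,ds>0$ (in particular $g$ is integrable); (A2) $\xi:[0,\infty)\to(0,\infty)$ is non-increasing and differentiable, $1\le p<\frac32$, and $g'(t)\le-\xi(t)g^p(t)$ for all $t\ge0$. Let $L^2_*(0,L)=\{v\in L^2(0,L):\int_0^Lv\,dx=0\}$, $H^1_*(0,L)=H^1(0,L)\cap L^2_*(0,L)$ and $H^2_*(0,L)=\{v\in H^2(0,L):v_x(0)=v_x(L)=0\}$. For $l>0$ consider the finite-memory Bresse system $$\begin{cases}\rho_1\varphi_{tt}-k_1(\varphi_x+\psi+lw)_x-lk_3(w_x-l\varphi)=0,\\ \rho_2\psi_{tt}-k_2\psi_{xx}+k_1(\varphi_x+\psi+lw)+\int_0^tg(t-s)\psi_{xx}(s)\,ds=0,\\ \rho_1w_{tt}-k_3(w_x-l\varphi)_x+lk_1(\varphi_x+\psi+lw)=0\end{cases}\qquad(P)$$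 in $(0,L)\times(0,\infty)$, with boundary conditions $\varphi=\psi_x=w_x=0$ at $x=0$ and $x=L$ for $t\ge0$, and initial data $(\varphi,\varphi_t)(0)=(\varphi_0,\varphi_1)$, $(\psi,\psi_t)(0)=(\psi_0,\psi_1)$, $(w,w_t)(0)=(w_0,w_1)$. A strong solution is a triple $(\varphi,\psi,w)$ satisfying $(P)$ (the equations holding in $L^2(0,L)$ for each $t>0$) and the initial conditions, with $$\varphi\in C([0,\infty);H^2\cap H^1_0)\cap C^1([0,\infty);H^1_0)\cap C^2([0,\infty);L^2),$$ $$\psi,w\in C([0,\infty);H^2_*\cap H^1_*)\cap C^1([0,\infty);H^1_*)\cap C^2([0,\infty);L^2).$$ Its energy is $$E(t)=\tfrac12\int_0^L\Big[\rho_1\varphi_t^2+\rho_2\psi_t^2+\rho_1w_t^2+\Big(k_2-\int_0^tg(s)\,ds\Big)\psi_x^2+k_3(w_x-l\varphi)^2+k_1(\varphi_x+\psi+lw)^2\Big]dx+\tfrac12\int_0^tg(t-s)\,\|\psi_x(t)-\psi_x(s)\|_{L^2(0,L)}^2\,ds.$$ Then there is $l_0>0$, depending only on $L,\rho_1,\rho_2,k_1,k_2,k_3$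 and $g$, such that for every $0<l<l_0$, all $\xi,p$ as in (A2), all initial data $(\varphi_0,\varphi_1)\in(H^2(0,L)\cap H^1_0(0,L))\times H^1_0(0,L)$ and $(\psi_0,\psi_1),(w_0,w_1)\in(H^2_*(0,L)\cap H^1_*(0,L))\times H^1_*(0,L)$, and every $t_0>0$, there is a constant $C>0$, which may depend on the initial data but not on $t$, such that the strong solution of $(P)$ with these data satisfies $$E(t)\le C\left(\frac{1}{\int_{t_0}^t\xi^{2p-1}(s)\,ds}\right)^{\frac1{2p-1}}\qquad\text{for all }t>t_0.$$ -/

import Mathlib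

open MeasureTheory Set
open scoped ContDiff

noncomputable section

namespace Bresse

/-- The Hilbert space `L²(0, L)`. -/
abbrev L2 (L : ℝ) : Type := Lp ℝ 2 (volume.restrict (Ioo (0 : ℝ) L))

/-- `v` is the weak derivative of `u` on `(0, L)`: `∫ u η' = - ∫ v η` for all `η ∈ C_c^∞(0, L)`. -/
def IsWeakDeriv {L : ℝ} (u v : L2 L) : Prop :=
  ∀ η : ℝ → ℝ, ContDiff ℝ ∞ η → HasCompactSupport η → tsupport η ⊆ Ioo 0 L →
    ∫ x in Ioo (0 : ℝ) L, u x * deriv η x = -∫ x in Ioo (0 : ℝ) L, v x * η x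

/-- `u ∈ H¹(0, L)`. -/
def MemH1 {L : ℝ} (u : L2 L) : Prop := ∃ v : L2 L, IsWeakDeriv u v

open Classical in
/-- The weak derivative `u_x` of `u ∈ H¹(0, L)` (and `0` if `u` is not in `H¹(0, L)`). -/
def dx {L : ℝ} (u : L2 L) : L2 L := if h : MemH1 u then h.choose else 0

theorem isWeakDeriv_dx {L : ℝ} {u : L2 L} (h : MemH1 u) : IsWeakDeriv u (dx u) := by
  unfold dx
  rw [dif_pos h]
  exact h.choose_spec

theorem locallyIntegrableOn_L2 {L : ℝ} (u : L2 L) :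
    LocallyIntegrableOn (u : ℝ → ℝ) (Ioo 0 L) volume := by
  have h : Integrable (u : ℝ → ℝ) (volume.restrict (Ioo (0 : ℝ) L)) :=
    (Lp.memLp u).integrable (by norm_num)
  exact IntegrableOn.locallyIntegrableOn h

/-- Weak derivatives are unique. -/
theorem IsWeakDeriv.unique {L : ℝ} {u v v' : L2 L} (h : IsWeakDeriv u v)
    (h' : IsWeakDeriv u v') : v = v' := by
  have key : ∀ᵐ x ∂(volume : Measure ℝ), x ∈ Ioo 0 L → (v x - v' x) = 0 := by
    refine IsOpen.ae_eq_zero_of_integral_contDiff_smul_eq_zero (f := fun x => v x - v' x)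
      isOpen_Ioo ((locallyIntegrableOn_L2 v).sub (locallyIntegrableOn_L2 v')) ?_
    intro η h1 h2 h3
    have hη : MemLp η 2 (volume.restrict (Ioo (0 : ℝ) L)) :=
      (h1.continuous.memLp_of_hasCompactSupport h2).restrict _
    have i1 : Integrable (fun x => v x * η x) (volume.restrict (Ioo (0 : ℝ) L)) :=
      (Lp.memLp v).integrable_mul hη
    have i2 : Integrable (fun x => v' x * η x) (volume.restrict (Ioo (0 : ℝ) L)) :=
      (Lp.memLp v').integrable_mul hη
    have e := h η h1 h2 h3
    rw [h' η h1 h2 h3, neg_inj] at e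
    have e2 : ∫ x in Ioo (0 : ℝ) L, η x • (v x - v' x) = 0 := by
      have : (fun x => η x • (v x - v' x)) = fun x => v x * η x - v' x * η x := by
        funext x; simp only [smul_eq_mul]; ring
      rw [this, integral_sub i1 i2, e, sub_self]
    refine Eq.trans ?_ e2
    refine (setIntegral_eq_integral_of_forall_compl_eq_zero ?_).symm
    intro x hx
    have : η x = 0 := by
      by_contra hne
      exact hx (h3 (subset_tsupport η hne))
    simp [this]
  apply Lp.ext
  rw [Filter.EventuallyEq, ae_restrict_iff' measurableSet_Ioo]
  filter_upwards [key] with x hx hmem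
  exact sub_eq_zero.mp (hx hmem)

theorem IsWeakDeriv.dx_eq {L : ℝ} {u v : L2 L} (h : IsWeakDeriv u v) : dx u = v :=
  (isWeakDeriv_dx ⟨v, h⟩).unique h

/-- `u ∈ H²(0, L)`. -/
def MemH2 {L : ℝ} (u : L2 L) : Prop := MemH1 u ∧ MemH1 (dx u)

/-- `u ∈ H¹₀(0, L)`: `u ∈ H¹(0, L)` and its continuous representative vanishes at `0` and `L`. -/
def MemH10 {L : ℝ} (u : L2 L) : Prop :=
  MemH1 u ∧ ∃ f : ℝ → ℝ, ContinuousOn f (Icc 0 L) ∧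
    (u : ℝ → ℝ) =ᵐ[volume.restrict (Ioo (0 : ℝ) L)] f ∧ f 0 = 0 ∧ f L = 0

/-- `u ∈ L²_*(0, L)`: `u` has zero mean. -/
def MemL2s {L : ℝ} (u : L2 L) : Prop := ∫ x in Ioo (0 : ℝ) L, u x = 0

/-- `u ∈ H¹_*(0, L) = H¹(0, L) ∩ L²_*(0, L)`. -/
def MemH1s {L : ℝ} (u : L2 L) : Prop := MemH1 u ∧ MemL2s u

/-- `u ∈ H²_*(0, L)`: `u ∈ H²(0, L)` and `u_x(0) = u_x(L) = 0`. -/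
def MemH2s {L : ℝ} (u : L2 L) : Prop := MemH2 u ∧ MemH10 (dx u)

/-- `(u, u_x)`. For `u ∈ H¹(0, L)` its norm in `L² × L²` is equivalent to the `H¹` norm of `u`. -/
def jet1 {L : ℝ} (u : L2 L) : L2 L × L2 L := (u, dx u)

/-- `(u, u_x, u_xx)`. For `u ∈ H²(0, L)` its norm is equivalent to the `H²` norm of `u`. -/
def jet2 {L : ℝ} (u : L2 L) : L2 L × L2 L × L2 L := (u, dx u, dx (dx u))

/-- The time derivative on `[0, ∞)` (one-sided at `0`) of an `L²(0, L)`-valued function. -/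
def dt {L : ℝ} (u : ℝ → L2 L) (t : ℝ) : L2 L := derivWithin u (Ici 0) t

/-- `u ∈ C([0,∞); X₂) ∩ C¹([0,∞); X₁) ∩ C²([0,∞); L²(0, L))`, where `X₂` and `X₁` are the closed
subspaces of `H²(0, L)` and `H¹(0, L)` cut out by the predicates `P₂` and `P₁`. -/
structure StrongRegularity {L : ℝ} (P₂ P₁ : L2 L → Prop) (u : ℝ → L2 L) : Prop where
  mem_two : ∀ t, 0 ≤ t → P₂ (u t)
  cont_two : ContinuousOn (fun t => jet2 (u t)) (Ici 0)
  mem_one : ∀ t, 0 ≤ t → P₁ (u t)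
  contDiff_one : ContDiffOn ℝ 1 (fun t => jet1 (u t)) (Ici 0)
  contDiff_zero : ContDiffOn ℝ 2 u (Ici 0)

/-- `H²(0, L) ∩ H¹₀(0, L)`. -/
def MemH2H10 {L : ℝ} (u : L2 L) : Prop := MemH2 u ∧ MemH10 u

/-- `H²_*(0, L) ∩ H¹_*(0, L)`. -/
def MemH2sH1s {L : ℝ} (u : L2 L) : Prop := MemH2s u ∧ MemH1s u

/-- `(φ, ψ, w)` is a strong solution of the finite-memory Bresse system with initial data
`(φ₀, φ₁)`, `(ψ₀, ψ₁)`, `(w₀, w₁)`. The equations hold in `L²(0, L)` at every time `t > 0`; the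
memory term is an `L²(0, L)`-valued integral. The boundary conditions
`φ = ψ_x = w_x = 0` at `x = 0, L` are part of the membership in `H¹₀` and `H²_*`. -/
structure IsStrongSolution {L : ℝ} (ρ₁ ρ₂ k₁ k₂ k₃ l : ℝ) (g : ℝ → ℝ)
    (φ₀ φ₁ ψ₀ ψ₁ w₀ w₁ : L2 L) (φ ψ w : ℝ → L2 L) : Prop where
  reg_φ : StrongRegularity MemH2H10 MemH10 φ
  reg_ψ : StrongRegularity MemH2sH1s MemH1s ψ
  reg_w : StrongRegularity MemH2sH1s MemH1s w
  eq_φ : ∀ t, 0 < t →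
    ρ₁ • dt (dt φ) t - k₁ • dx (dx (φ t) + ψ t + l • w t)
      - (l * k₃) • (dx (w t) - l • φ t) = 0
  eq_ψ : ∀ t, 0 < t →
    ρ₂ • dt (dt ψ) t - k₂ • dx (dx (ψ t)) + k₁ • (dx (φ t) + ψ t + l • w t)
      + ∫ s in (0 : ℝ)..t, g (t - s) • dx (dx (ψ s)) = 0
  eq_w : ∀ t, 0 < t →
    ρ₁ • dt (dt w) t - k₃ • dx (dx (w t) - l • φ t)
      + (l * k₁) • (dx (φ t) + ψ t + l • w t) = 0
  init_φ : φ 0 = φ₀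
  init_φt : dt φ 0 = φ₁
  init_ψ : ψ 0 = ψ₀
  init_ψt : dt ψ 0 = ψ₁
  init_w : w 0 = w₀
  init_wt : dt w 0 = w₁

/-- `(g ∘ v)(t) = ∫₀ᵗ g(t - s) ‖v(t) - v(s)‖² ds`, with the norm of `L²(0, L)`. -/
def memoryForm {L : ℝ} (g : ℝ → ℝ) (v : ℝ → L2 L) (t : ℝ) : ℝ :=
  ∫ s in (0 : ℝ)..t, g (t - s) * ‖v t - v s‖ ^ 2

/-- The energy `E(t)`; all norms are those of `L²(0, L)`. -/
def energy {L : ℝ} (ρ₁ ρ₂ k₁ k₂ k₃ l : ℝ) (g : ℝ → ℝ) (φ ψ w : ℝ → L2 L) (t : ℝ) : ℝ :=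
  (1 / 2) * (ρ₁ * ‖dt φ t‖ ^ 2 + ρ₂ * ‖dt ψ t‖ ^ 2 + ρ₁ * ‖dt w t‖ ^ 2
      + (k₂ - ∫ s in (0 : ℝ)..t, g s) * ‖dx (ψ t)‖ ^ 2
      + k₃ * ‖dx (w t) - l • φ t‖ ^ 2
      + k₁ * ‖dx (φ t) + ψ t + l • w t‖ ^ 2)
    + (1 / 2) * memoryForm g (fun s => dx (ψ s)) t

/-- Assumption (A1) on the relaxation function. -/
structure AssumptionA1 (k₂ : ℝ) (g : ℝ → ℝ) : Prop where
  nonneg : ∀ t, 0 ≤ t → 0 ≤ g t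
  antitone : AntitoneOn g (Ici 0)
  differentiable : DifferentiableOn ℝ g (Ici 0)
  pos_zero : 0 < g 0
  integrable : IntegrableOn g (Ioi 0)
  integral_lt : 0 < k₂ - ∫ s in Ioi (0 : ℝ), g s

/-- Assumption (A2) on the relaxation function, with the function `ξ` and the exponent `p`. -/
structure AssumptionA2 (g ξ : ℝ → ℝ) (p : ℝ) : Prop where
  pos : ∀ t, 0 ≤ t → 0 < ξ t
  antitone : AntitoneOn ξ (Ici 0)
  differentiable : DifferentiableOn ℝ ξ (Ici 0)
  one_le : 1 ≤ p
  lt_three_halves : p < 3 / 2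
  deriv_le : ∀ t, 0 ≤ t → derivWithin g (Ici 0) t ≤ -ξ t * g t ^ p

end Bresse

end

/-!
The proof is an energy argument in a Hilbert space `H`, in which the derivative in space enters only
through its graphs on `H¹`, `H¹₀` and `H¹_*`, integration by parts and Poincaré's inequalities
(`DerivSystem`, `IsSolution`); `sobolevSystem` and `IsStrongSolution.isSolution` put `L²(0, L)` and
the strong solutions into this frame. With `k = -g'`, the energy satisfies
`E' = -½ ∫₀ᵗ k(t-s) ‖ψ_x(t) - ψ_x(s)‖² ds - ½ g(t) ‖ψ_x‖²` (`IsSolution.hasDerivAt_E`), so the only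
damping comes from the memory in `ψ`. In the code `quad k ψ_x` denotes the integral.

*Lyapunov functional.* Five multipliers transfer the damping to the other components. Since
`k₃ = k₁`, the cross terms between the shear `A = φ_x + ψ + l w` and the axial strain
`B = w_x - l φ` cancel in the multiplier `I₄`, and for small `l` the combination `V` of `E` with the
multipliers satisfies `V' ≤ -c E + C (quad g ψ_x + ‖ψ_xt‖²)` (`IsSolution.exists_lyapunov`). The term
`‖ψ_xt‖²` enters because the wave speeds differ: it comes from `⟪ψ_xt, φ_t⟫` in the derivative of the
multiplier `I₃`, and `E` does not control it.

*Second-order energy.* Strong solutions need not be differentiable in time once more, but their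
difference quotients solve the system with a forcing bounded by a multiple of `g`, which is
integrable. The energy estimate for the quotients passes to the limit and bounds `‖ψ_xt‖` and
`∫₀^∞ quad k ψ_xt` by the initial data (`IsSolution.exists_second_order_bound`). Moreover the memory
controls `‖ψ_xt‖²` by `quad g ψ_xt + quad k ψ_x + g` (`IsSolution.exists_norm_uxt_sq_le`).

*Decay.* Let `r = 2p - 1`, and let `e = E(T)`, which is at most `E(t)` for `t ≤ T`. The Lyapunov
inequality is multiplied by `e^(r-1) ξ(t)^r`. Young's inequality, the monotonicity of `ξ`, the
inequality `ξ g^p ≤ k` and the finiteness of `∫ ξ √g`, which is where `p < 3/2` is needed, give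
`e^(r-1) ξ^r quad g v ≤ ε (e ξ)^r + C_ε quad k v` for `v = ψ_x` and `v = ψ_xt`
(`IsRate.rpow_mul_quad_le`). The first term is absorbed, the second is integrable in time, and so
`E(T)^r ∫ ξ^r` over `(t₀, T)` is bounded (`IsSolution.exists_decay`). All constants depend on the
solution only through the initial values of `E`, of the second-order energy and of `ψ_xx`, and these
are determined by the initial data (`IsStrongSolution.initial_eq`).
-/

noncomputable section

namespace Bresse

open Filter Topology
open scoped RealInnerProductSpace

/-! ### Sobolev functions on an interval -/

/-- Integration by parts for primitives of integrable functions, which are absolutely continuous. -/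
theorem integral_primitive_mul {u v : ℝ → ℝ} {a b : ℝ} (A B : ℝ)
    (hu : IntervalIntegrable u volume a b) (hv : IntervalIntegrable v volume a b) :
    ∫ x in a..b, (A + ∫ y in a..x, u y) * v x =
      (A + ∫ y in a..b, u y) * (B + ∫ y in a..b, v y) - A * B
        - ∫ x in a..b, u x * (B + ∫ y in a..x, v y) := by
  have key : ∀ (w : ℝ → ℝ) (W : ℝ), IntervalIntegrable w volume a b →
      AbsolutelyContinuousOnInterval (fun x => W + ∫ y in a..x, w y) a b ∧
      ∀ᵐ x, x ∈ uIoc a b → deriv (fun x => W + ∫ y in a..x, w y) x = w x := by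
    intro w W hw
    refine ⟨?_, ?_⟩
    · exact ((LipschitzWith.const W).lipschitzOnWith (s := uIcc a b)).absolutelyContinuousOnInterval.add
        (hw.absolutelyContinuousOnInterval_intervalIntegral (by simp))
    · filter_upwards [hw.ae_hasDerivAt_integral] with x hx hxm
      exact ((hx (uIoc_subset_uIcc hxm) a (by simp)).const_add W).deriv
  obtain ⟨hF, hF'⟩ := key u A hu
  obtain ⟨hG, hG'⟩ := key v B hv
  have h := AbsolutelyContinuousOnInterval.integral_mul_deriv_eq_deriv_mul hF hG
  simp only [intervalIntegral.integral_same, add_zero] at h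
  rw [intervalIntegral.integral_congr_ae (g := fun x => (A + ∫ y in a..x, u y) * v x)
      (f := fun x => (A + ∫ y in a..x, u y) * deriv (fun x => B + ∫ y in a..x, v y) x)
      (by filter_upwards [hG'] with x hx hxm; rw [hx hxm]),
    intervalIntegral.integral_congr_ae (g := fun x => u x * (B + ∫ y in a..x, v y))
      (f := fun x => deriv (fun x => A + ∫ y in a..x, u y) x * (B + ∫ y in a..x, v y))
      (by filter_upwards [hF'] with x hx hxm; rw [hx hxm])] at h
  exact h

theorem intervalIntegrable_L2 {L : ℝ} (hL : 0 < L) (u : L2 L) :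
    IntervalIntegrable (u : ℝ → ℝ) volume 0 L := by
  rw [intervalIntegrable_iff_integrableOn_Ioo_of_le hL.le]
  exact (Lp.memLp u).integrable (by norm_num)

theorem inner_L2 {L : ℝ} (hL : 0 < L) (u v : L2 L) : ⟪u, v⟫ = ∫ x in (0 : ℝ)..L, u x * v x := by
  rw [L2.inner_def, intervalIntegral.integral_of_le hL.le, integral_Ioc_eq_integral_Ioo]
  refine integral_congr_ae (Eventually.of_forall fun x => ?_)
  simp [mul_comm]

theorem ae_Ioo_imp_uIoc {L : ℝ} (hL : 0 < L) {P : ℝ → Prop}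
    (h : ∀ᵐ x ∂(volume.restrict (Ioo (0 : ℝ) L)), P x) : ∀ᵐ x, x ∈ uIoc 0 L → P x := by
  rw [uIoc_of_le hL.le, ← ae_restrict_iff' measurableSet_Ioc, restrict_Ioo_eq_restrict_Ioc.symm]
  exact h

/-- A smooth function of mean zero with compact support in `(0, L)` has a primitive with compact
support in `(0, L)`. -/
theorem exists_primitive_test {L : ℝ} {η : ℝ → ℝ} (h1 : ContDiff ℝ ∞ η)
    (h2 : HasCompactSupport η) (h3 : tsupport η ⊆ Ioo 0 L) (h0 : ∫ x, η x = 0) :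
    ∃ θ : ℝ → ℝ, ContDiff ℝ ∞ θ ∧ HasCompactSupport θ ∧ tsupport θ ⊆ Ioo 0 L ∧ deriv θ = η := by
  by_cases hne : (tsupport η).Nonempty
  swap
  · refine ⟨0, contDiff_const, HasCompactSupport.zero, by simp [tsupport], ?_⟩
    have : η = 0 := by
      rw [not_nonempty_iff_eq_empty, tsupport_eq_empty_iff] at hne
      exact hne
    rw [this]; ext x; simp
  obtain ⟨a, ha, hamin⟩ := h2.isCompact.exists_isLeast hne
  obtain ⟨b, hb, hbmax⟩ := h2.isCompact.exists_isGreatest hne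
  have hsub : ∀ x, x ∉ Icc a b → η x = 0 := by
    intro x hx
    by_contra hc
    have := subset_tsupport η hc
    exact hx ⟨hamin this, hbmax this⟩
  have hint : ∀ x y, IntervalIntegrable η volume x y := fun x y =>
    h1.continuous.intervalIntegrable _ _
  set θ : ℝ → ℝ := fun x => ∫ y in a..x, η y with hθ
  have hd : ∀ x, HasDerivAt θ (η x) x := fun x =>
    intervalIntegral.integral_hasDerivAt_right (hint _ _)
      (h1.continuous.stronglyMeasurableAtFilter _ _) h1.continuous.continuousAt
  have hderiv : deriv θ = η := funext fun x => (hd x).deriv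
  have hsm : ContDiff ℝ ∞ θ := by
    rw [contDiff_infty_iff_deriv, hderiv]
    exact ⟨fun x => (hd x).differentiableAt, h1⟩
  have hzero : ∀ x, x ∉ Icc a b → θ x = 0 := by
    intro x hx
    by_cases hxa : x < a
    · rw [hθ]
      simp only
      rw [intervalIntegral.integral_symm, intervalIntegral.integral_of_le hxa.le,
        integral_Ioc_eq_integral_Ioo, setIntegral_eq_zero_of_forall_eq_zero, neg_zero]
      intro y hy
      exact hsub y (fun h => absurd h.1 (not_le.2 hy.2))
    · have hxb : b < x := by
        by_contra hc
        exact hx ⟨not_lt.1 hxa, not_lt.1 hc⟩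
      rw [← h0, hθ]
      simp only
      rw [intervalIntegral.integral_of_le (not_lt.1 hxa), ← integral_Icc_eq_integral_Ioc]
      refine setIntegral_eq_integral_of_forall_compl_eq_zero ?_
      intro y hy
      exact hsub y (fun h => hy ⟨h.1, h.2.trans hxb.le⟩)
  have hts : tsupport θ ⊆ Icc a b := by
    refine closure_minimal ?_ isClosed_Icc
    intro x hx
    by_contra hc
    exact hx (hzero x hc)
  refine ⟨θ, hsm, ?_, ?_, hderiv⟩
  · exact isCompact_Icc.of_isClosed_subset (isClosed_tsupport θ) hts
  · intro x hx
    have := hts hx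
    exact ⟨(h3 ha).1.trans_le this.1, this.2.trans_lt (h3 hb).2⟩

/-- The lemma of du Bois-Reymond. -/
theorem ae_eq_const_of_weakDeriv_zero {L : ℝ} (hL : 0 < L) {u : L2 L}
    (h : ∀ η : ℝ → ℝ, ContDiff ℝ ∞ η → HasCompactSupport η → tsupport η ⊆ Ioo 0 L →
      ∫ x in Ioo (0 : ℝ) L, u x * deriv η x = 0) :
    ∃ c : ℝ, (u : ℝ → ℝ) =ᵐ[volume.restrict (Ioo (0 : ℝ) L)] fun _ => c := by
  -- a fixed bump of integral one is used to correct the mean of the test functions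
  let χ : ContDiffBump (L / 2 : ℝ) := ⟨L / 8, L / 4, by positivity, by linarith⟩
  set ζ : ℝ → ℝ := χ.normed volume with hζ
  have z1 : ContDiff ℝ ∞ ζ := χ.contDiff_normed
  have z2 : HasCompactSupport ζ := χ.hasCompactSupport_normed
  have z3 : tsupport ζ ⊆ Ioo 0 L := by
    rw [hζ, χ.tsupport_normed_eq, Real.closedBall_eq_Icc]
    intro x hx
    have h1 : L / 2 - L / 4 ≤ x := hx.1
    have h2 : x ≤ L / 2 + L / 4 := hx.2
    constructor <;> linarith
  have z4 : ∫ x, ζ x = 1 := χ.integral_normed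
  refine ⟨∫ x in Ioo (0 : ℝ) L, u x * ζ x, ?_⟩
  set c := ∫ x in Ioo (0 : ℝ) L, u x * ζ x with hc
  have hmul : ∀ η : ℝ → ℝ, ContDiff ℝ ∞ η → HasCompactSupport η →
      Integrable (fun x => u x * η x) (volume.restrict (Ioo (0 : ℝ) L)) := by
    intro η h1 h2
    have h3 : MemLp η 2 (volume.restrict (Ioo (0 : ℝ) L)) :=
      (h1.continuous.memLp_of_hasCompactSupport h2).restrict _
    exact (Lp.memLp u).integrable_mul h3
  have hset : ∀ η : ℝ → ℝ, tsupport η ⊆ Ioo 0 L → ∀ f : ℝ → ℝ,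
      ∫ x in Ioo (0 : ℝ) L, f x * η x = ∫ x, f x * η x := by
    intro η h3 f
    refine setIntegral_eq_integral_of_forall_compl_eq_zero ?_
    intro x hx
    have : η x = 0 := by
      by_contra hne
      exact hx (h3 (subset_tsupport η hne))
    simp [this]
  have key : ∀ᵐ x ∂(volume : Measure ℝ), x ∈ Ioo 0 L → (u x - c) = 0 := by
    refine IsOpen.ae_eq_zero_of_integral_contDiff_smul_eq_zero (f := fun x => u x - c)
      isOpen_Ioo ((locallyIntegrableOn_L2 u).sub
        (locallyIntegrableOn_const c)) ?_
    intro η h1 h2 h3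
    set m := ∫ x, η x with hm
    have d1 : ContDiff ℝ ∞ (fun x => η x - m * ζ x) := h1.sub (contDiff_const.mul z1)
    have d2 : HasCompactSupport (fun x => η x - m * ζ x) := by
      have : HasCompactSupport (fun x => m * ζ x) := z2.mul_left
      exact h2.sub this
    have d3 : tsupport (fun x => η x - m * ζ x) ⊆ Ioo 0 L := by
      have e : tsupport (fun x => η x - m * ζ x) ⊆ tsupport η ∪ tsupport ζ := by
        refine closure_minimal ?_ ((isClosed_tsupport η).union (isClosed_tsupport ζ))
        intro x hx
        by_contra hcon
        rw [mem_union, not_or] at hcon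
        apply hx
        simp [image_eq_zero_of_notMem_tsupport hcon.1, image_eq_zero_of_notMem_tsupport hcon.2]
      exact e.trans (union_subset h3 z3)
    have i1 : Integrable η := h1.continuous.integrable_of_hasCompactSupport h2
    have i2 : Integrable ζ := z1.continuous.integrable_of_hasCompactSupport z2
    have d4 : ∫ x, (η x - m * ζ x) = 0 := by
      rw [integral_sub i1 (i2.const_mul m), integral_const_mul, z4]; simp [hm]
    obtain ⟨θ, t1, t2, t3, t4⟩ := exists_primitive_test d1 d2 d3 d4
    have e := h θ t1 t2 t3
    rw [t4] at e
    have e2 : (fun x => u x * (η x - m * ζ x)) = fun x => u x * η x - m * (u x * ζ x) := by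
      funext x; ring
    rw [e2, integral_sub (hmul η h1 h2) ((hmul ζ z1 z2).const_mul m), integral_const_mul,
      ← hc] at e
    have e3 : (fun x => η x • (u x - c)) = fun x => (u x - c) * η x := by
      funext x; simp [mul_comm]
    rw [e3, ← hset η h3 (fun x => u x - c)]
    have e4 : (fun x => (u x - c) * η x) = fun x => u x * η x - c * η x := by funext x; ring
    rw [e4, integral_sub (hmul η h1 h2) (i1.restrict.const_mul c), integral_const_mul]
    have e5 := hset η h3 (fun _ => 1)
    simp only [one_mul] at e5
    rw [e5, ← hm]; linarith
  rw [Filter.EventuallyEq, ae_restrict_iff' measurableSet_Ioo]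
  filter_upwards [key] with x hx hmem
  exact sub_eq_zero.mp (hx hmem)

theorem continuousOn_primitive_L2 {L : ℝ} (hL : 0 < L) (v : L2 L) :
    ContinuousOn (fun x => ∫ y in (0 : ℝ)..x, v y) (Icc 0 L) := by
  have := intervalIntegral.continuousOn_primitive_interval (f := (v : ℝ → ℝ)) (μ := volume)
    (a := 0) (b := L) (by
      rw [uIcc_of_le hL.le, integrableOn_Icc_iff_integrableOn_Ioo]
      exact (Lp.memLp v).integrable (by norm_num))
  rwa [uIcc_of_le hL.le] at this

theorem continuousOn_const_add_primitive {L : ℝ} (hL : 0 < L) (c : ℝ) (v : L2 L) :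
    ContinuousOn (fun x => c + ∫ y in (0 : ℝ)..x, v y) (Icc 0 L) :=
  continuousOn_const.add (continuousOn_primitive_L2 hL v)

/-- The element `x ↦ c + ∫₀ˣ v` of `L²(0, L)`. -/
def primitive {L : ℝ} (hL : 0 < L) (c : ℝ) (v : L2 L) : L2 L :=
  MemLp.toLp (fun x => c + ∫ y in (0 : ℝ)..x, v y) (by
    have h : ContinuousOn (fun x => c + ∫ y in (0 : ℝ)..x, v y) (Icc 0 L) :=
      continuousOn_const_add_primitive hL c v
    obtain ⟨C, hC⟩ := isCompact_Icc.exists_bound_of_continuousOn h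
    refine MemLp.of_bound ((h.mono Ioo_subset_Icc_self).aestronglyMeasurable measurableSet_Ioo) C ?_
    rw [ae_restrict_iff' measurableSet_Ioo]
    exact Eventually.of_forall fun x hx => hC x (Ioo_subset_Icc_self hx))

theorem coeFn_primitive {L : ℝ} (hL : 0 < L) (c : ℝ) (v : L2 L) :
    (primitive hL c v : ℝ → ℝ) =ᵐ[volume.restrict (Ioo (0 : ℝ) L)]
      fun x => c + ∫ y in (0 : ℝ)..x, v y := MemLp.coeFn_toLp _

theorem integral_Ioo_eq {L : ℝ} (hL : 0 < L) (f : ℝ → ℝ) :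
    ∫ x in Ioo (0 : ℝ) L, f x = ∫ x in (0 : ℝ)..L, f x := by
  rw [intervalIntegral.integral_of_le hL.le, integral_Ioc_eq_integral_Ioo]

theorem isWeakDeriv_primitive {L : ℝ} (hL : 0 < L) (c : ℝ) (v : L2 L) :
    IsWeakDeriv (primitive hL c v) v := by
  intro η h1 h2 h3
  have hv := intervalIntegrable_L2 hL v
  have hη' : Continuous (deriv η) := h1.continuous_deriv (by simp)
  have z0 : η 0 = 0 := image_eq_zero_of_notMem_tsupport fun h => absurd (h3 h).1 (lt_irrefl _)
  have zL : η L = 0 := image_eq_zero_of_notMem_tsupport fun h => absurd (h3 h).2 (lt_irrefl _)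
  have hFTC : ∀ x, ∫ y in (0 : ℝ)..x, deriv η y = η x := by
    intro x
    rw [intervalIntegral.integral_deriv_eq_sub (fun y _ => (h1.differentiable (by simp)) y)
      (hη'.intervalIntegrable _ _), z0, sub_zero]
  have h := integral_primitive_mul c 0 hv (hη'.intervalIntegrable 0 L)
  simp only [hFTC, zL, zero_add, mul_zero, sub_zero, zero_sub] at h
  rw [integral_Ioo_eq hL, integral_Ioo_eq hL, ← h]
  refine intervalIntegral.integral_congr_ae ?_
  filter_upwards [ae_Ioo_imp_uIoc hL (coeFn_primitive hL c v)] with x hx hxm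
  rw [hx hxm]

/-- A function in `H¹(0, L)` is a primitive of its weak derivative. -/
theorem IsWeakDeriv.exists_primitive {L : ℝ} (hL : 0 < L) {u v : L2 L} (h : IsWeakDeriv u v) :
    ∃ c, (u : ℝ → ℝ) =ᵐ[volume.restrict (Ioo (0 : ℝ) L)] fun x => c + ∫ y in (0 : ℝ)..x, v y := by
  have hP := isWeakDeriv_primitive hL 0 v
  obtain ⟨c, hc⟩ := ae_eq_const_of_weakDeriv_zero hL (u := u - primitive hL 0 v) (by
    intro η h1 h2 h3
    have h2' : HasCompactSupport (deriv η) := h2.deriv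
    have hc' : Continuous (deriv η) := h1.continuous_deriv (by simp)
    have hm : ∀ w : L2 L, Integrable (fun x => w x * deriv η x)
        (volume.restrict (Ioo (0 : ℝ) L)) := fun w => by
      have h3 : MemLp (deriv η) 2 (volume.restrict (Ioo (0 : ℝ) L)) :=
        (hc'.memLp_of_hasCompactSupport h2').restrict _
      exact (Lp.memLp w).integrable_mul h3
    have e : ∫ x in Ioo (0 : ℝ) L, (u - primitive hL 0 v : L2 L) x * deriv η x =
        ∫ x in Ioo (0 : ℝ) L, (u x * deriv η x - primitive hL 0 v x * deriv η x) := by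
      refine integral_congr_ae ?_
      filter_upwards [Lp.coeFn_sub u (primitive hL 0 v)] with x hx
      rw [hx, Pi.sub_apply, sub_mul]
    rw [e, integral_sub (hm _) (hm _), h η h1 h2 h3, hP η h1 h2 h3, sub_self])
  refine ⟨c, ?_⟩
  filter_upwards [hc, Lp.coeFn_sub u (primitive hL 0 v), coeFn_primitive hL 0 v] with x h1 h2 h3
  rw [h1, Pi.sub_apply, h3] at h2
  linarith

theorem eqOn_Icc_of_ae_eq {L : ℝ} (hL : 0 < L) {f g : ℝ → ℝ} (hf : ContinuousOn f (Icc 0 L))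
    (hg : ContinuousOn g (Icc 0 L)) (h : f =ᵐ[volume.restrict (Ioo (0 : ℝ) L)] g) :
    EqOn f g (Icc 0 L) := by
  have h1 : EqOn f g (Ioo 0 L) := Measure.eqOn_open_of_ae_eq h isOpen_Ioo
    (hf.mono Ioo_subset_Icc_self) (hg.mono Ioo_subset_Icc_self)
  refine h1.of_subset_closure hf hg Ioo_subset_Icc_self ?_
  rw [closure_Ioo hL.ne]

/-- Integration by parts against a function of `H¹₀(0, L)`. -/
theorem MemH10.inner_add_inner {L : ℝ} (hL : 0 < L) {u u' v : L2 L} (hu : IsWeakDeriv u u')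
    (hv : MemH10 v) : ⟪u', v⟫ + ⟪u, dx v⟫ = 0 := by
  obtain ⟨hv1, f, hf, hvf, hf0, hfL⟩ := hv
  obtain ⟨c, hc⟩ := (isWeakDeriv_dx hv1).exists_primitive hL
  obtain ⟨d, hd⟩ := hu.exists_primitive hL
  have heq := eqOn_Icc_of_ae_eq hL hf
    (continuousOn_const_add_primitive hL c (dx v)) (hvf.symm.trans hc)
  have e0 := heq (left_mem_Icc.2 hL.le)
  have eL := heq (right_mem_Icc.2 hL.le)
  simp only [intervalIntegral.integral_same, add_zero, hf0, hfL] at e0 eL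
  subst e0
  have h := integral_primitive_mul d 0 (intervalIntegrable_L2 hL u')
    (intervalIntegrable_L2 hL (dx v))
  rw [← eL] at h
  rw [inner_L2 hL, inner_L2 hL]
  rw [intervalIntegral.integral_congr_ae (g := fun x => (d + ∫ y in (0 : ℝ)..x, u' y) * dx v x)
      (f := fun x => u x * dx v x)
      (by filter_upwards [ae_Ioo_imp_uIoc hL hd] with x hx hxm; rw [hx hxm]),
    intervalIntegral.integral_congr_ae (g := fun x => u' x * (0 + ∫ y in (0 : ℝ)..x, dx v y))
      (f := fun x => u' x * v x)
      (by filter_upwards [ae_Ioo_imp_uIoc hL hc] with x hx hxm; rw [hx hxm]), h]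
  ring

theorem memH10_primitive {L : ℝ} (hL : 0 < L) {v : L2 L} (hv : MemL2s v) :
    MemH10 (primitive hL 0 v) := by
  refine ⟨⟨v, isWeakDeriv_primitive hL 0 v⟩, _,
    continuousOn_const_add_primitive hL 0 v, coeFn_primitive hL 0 v, by simp, ?_⟩
  rw [MemL2s, integral_Ioo_eq hL] at hv
  rw [hv, add_zero]

theorem norm_primitive_le {L : ℝ} (hL : 0 < L) (v : L2 L) : ‖primitive hL 0 v‖ ≤ L * ‖v‖ := by
  have hb : ∀ x ∈ Ioo 0 L, |∫ y in (0 : ℝ)..x, v y| ≤ Real.sqrt L * ‖v‖ := by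
    intro x hx
    have hone : MemLp (fun _ : ℝ => (1 : ℝ)) 2 (volume.restrict (Ioo (0 : ℝ) L)) := memLp_const 1
    have habs : MemLp (fun y => |v y|) 2 (volume.restrict (Ioo (0 : ℝ) L)) := (Lp.memLp v).abs
    have i1 : Integrable (fun y => |v y|) (volume.restrict (Ioo (0 : ℝ) L)) :=
      habs.integrable (by norm_num)
    calc |∫ y in (0 : ℝ)..x, v y| ≤ ∫ y in (0 : ℝ)..x, |v y| :=
          intervalIntegral.abs_integral_le_integral_abs hx.1.le
      _ = ∫ y in Ioc 0 x, |v y| := intervalIntegral.integral_of_le hx.1.le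
      _ ≤ ∫ y in Ioo 0 L, |v y| := setIntegral_mono_set i1
          (Eventually.of_forall fun y => abs_nonneg _)
          (Eventually.of_forall fun y hy => ⟨hy.1, hy.2.trans_lt hx.2⟩)
      _ = ⟪hone.toLp _, habs.toLp _⟫ := by
          rw [L2.inner_def]
          refine integral_congr_ae ?_
          filter_upwards [hone.coeFn_toLp, habs.coeFn_toLp] with y h1 h2
          rw [h1, h2]; simp
      _ ≤ ‖hone.toLp _‖ * ‖habs.toLp _‖ := real_inner_le_norm _ _
      _ = Real.sqrt L * ‖v‖ := by
          congr 1
          · rw [Lp.norm_toLp, eLpNorm_const _ (by norm_num) (by simp; exact hL)]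
            simp [Real.sqrt_eq_rpow, ← ENNReal.toReal_rpow, hL.le]
          · refine le_antisymm ?_ ?_ <;>
            refine Lp.norm_le_norm_of_ae_le ?_ <;>
            filter_upwards [habs.coeFn_toLp] with y h2 <;> rw [h2] <;> simp
  have hS : 0 ≤ Real.sqrt L * ‖v‖ := by positivity
  have h2 : ‖primitive hL 0 v‖ ^ 2 ≤ (L * ‖v‖) ^ 2 := by
    rw [← real_inner_self_eq_norm_sq, inner_L2 hL]
    calc ∫ x in (0 : ℝ)..L, primitive hL 0 v x * primitive hL 0 v x
        = ∫ x in (0 : ℝ)..L, (∫ y in (0 : ℝ)..x, v y) ^ 2 := by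
          refine intervalIntegral.integral_congr_ae ?_
          filter_upwards [ae_Ioo_imp_uIoc hL (coeFn_primitive hL 0 v)] with x hx hxm
          rw [hx hxm]; ring
      _ ≤ ∫ x in (0 : ℝ)..L, (Real.sqrt L * ‖v‖) ^ 2 := by
          rw [← integral_Ioo_eq hL, ← integral_Ioo_eq hL]
          refine setIntegral_mono_on ?_ (integrableOn_const (by simp)) measurableSet_Ioo ?_
          · exact ((continuousOn_primitive_L2 hL v).pow 2).integrableOn_Icc.mono_set
              Ioo_subset_Icc_self
          · intro x hx
            exact sq_le_sq' (by have := neg_abs_le (∫ y in (0 : ℝ)..x, v y); linarith [hb x hx])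
              ((le_abs_self _).trans (hb x hx))
      _ = (L * ‖v‖) ^ 2 := by
          rw [intervalIntegral.integral_const, smul_eq_mul, mul_pow, Real.sq_sqrt hL.le]; ring
  exact le_of_sq_le_sq h2 (by positivity)

/-- Poincaré's inequality in `H¹₀(0, L)`, for a pair `(v, v')` that satisfies the integration by
parts formula against all of `H¹(0, L)`. -/
theorem norm_le_of_inner_add_inner {L : ℝ} (hL : 0 < L) {v v' : L2 L}
    (hv : ∀ u u', IsWeakDeriv u u' → ⟪u', v⟫ + ⟪u, v'⟫ = 0) : ‖v‖ ≤ L * ‖v'‖ := by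
  have h := hv _ _ (isWeakDeriv_primitive hL 0 v)
  have h2 : ‖v‖ ^ 2 ≤ (L * ‖v‖) * ‖v'‖ := by
    rw [← real_inner_self_eq_norm_sq]
    calc ⟪v, v⟫ = -⟪primitive hL 0 v, v'⟫ := by linarith
      _ ≤ ‖primitive hL 0 v‖ * ‖v'‖ := (neg_le_abs _).trans (abs_real_inner_le_norm _ _)
      _ ≤ _ := by gcongr; exact norm_primitive_le hL v
  rcases (norm_nonneg v).eq_or_lt with h0 | h0
  · rw [← h0]; positivity
  · nlinarith

/-- Poincaré's inequality for functions of mean zero. -/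
theorem MemL2s.norm_le {L : ℝ} (hL : 0 < L) {v v' : L2 L} (hv : MemL2s v)
    (h : IsWeakDeriv v v') : ‖v‖ ≤ L * ‖v'‖ := by
  have h := (memH10_primitive hL hv).inner_add_inner hL h
  rw [(isWeakDeriv_primitive hL 0 v).dx_eq] at h
  have h2 : ‖v‖ ^ 2 ≤ (L * ‖v‖) * ‖v'‖ := by
    rw [← real_inner_self_eq_norm_sq]
    calc ⟪v, v⟫ = -⟪v', primitive hL 0 v⟫ := by linarith
      _ ≤ ‖v'‖ * ‖primitive hL 0 v‖ := (neg_le_abs _).trans (abs_real_inner_le_norm _ _)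
      _ ≤ ‖v'‖ * (L * ‖v‖) := by gcongr; exact norm_primitive_le hL v
      _ = _ := by ring
  rcases (norm_nonneg v).eq_or_lt with h0 | h0
  · rw [← h0]; positivity
  · nlinarith

/-! ### Memory integrals -/

/-- A nonnegative weight on `(0, ∞)` that is integrable near `0`. -/
structure IsWeight (k : ℝ → ℝ) : Prop where
  intervalIntegrable : ∀ T, 0 ≤ T → IntervalIntegrable k volume 0 T
  nonneg : ∀ t, 0 < t → 0 ≤ k t

/-- A relaxation function `g`, extended to a continuous antitone function on `ℝ`, together with
`k = -g'`. -/
structure IsRelaxation (g k : ℝ → ℝ) : Prop where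
  continuous : Continuous g
  antitone : Antitone g
  nonneg : ∀ t, 0 ≤ g t
  pos_zero : 0 < g 0
  hasDerivAt : ∀ t, 0 < t → HasDerivAt g (-k t) t
  integrable : IntegrableOn g (Ioi 0)

section Normed

variable {E : Type*} [NormedAddCommGroup E] [NormedSpace ℝ E]

/-- The convolution `(g * v)(t) = ∫₀ᵗ g(t - s) v(s) ds`. -/
def conv (g : ℝ → ℝ) (v : ℝ → E) (t : ℝ) : E := ∫ s in (0 : ℝ)..t, g (t - s) • v s

/-- The memory integral `∫₀ᵗ g(t - s) (v(t) - v(s)) ds`. -/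
def relax (g : ℝ → ℝ) (v : ℝ → E) (t : ℝ) : E := ∫ s in (0 : ℝ)..t, g (t - s) • (v t - v s)

/-- The quadratic memory integral `∫₀ᵗ g(t - s) ‖v(t) - v(s)‖² ds`. -/
def quad (g : ℝ → ℝ) (v : ℝ → E) (t : ℝ) : ℝ := ∫ s in (0 : ℝ)..t, g (t - s) * ‖v t - v s‖ ^ 2

namespace IsWeight

variable {k : ℝ → ℝ} (hk : IsWeight k)
include hk

theorem reflect {t : ℝ} (ht : 0 ≤ t) : IntervalIntegrable (fun s => k (t - s)) volume 0 t := by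
  have := ((hk.intervalIntegrable t ht).comp_sub_left t).symm
  simpa using this

theorem reflect_smul {t : ℝ} (ht : 0 ≤ t) {y : ℝ → E} (hy : Continuous y) :
    IntervalIntegrable (fun s => k (t - s) • y s) volume 0 t :=
  (hk.reflect ht).smul_continuousOn hy.continuousOn

theorem reflect_mul {t : ℝ} (ht : 0 ≤ t) {y : ℝ → ℝ} (hy : Continuous y) :
    IntervalIntegrable (fun s => k (t - s) * y s) volume 0 t :=
  (hk.reflect ht).mul_continuousOn hy.continuousOn

omit hk in
theorem integral_reflect (t : ℝ) : ∫ s in (0 : ℝ)..t, k (t - s) = ∫ s in (0 : ℝ)..t, k s := by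
  rw [intervalIntegral.integral_comp_sub_left k t]; simp

theorem integral_nonneg {t : ℝ} (ht : 0 ≤ t) : 0 ≤ ∫ s in (0 : ℝ)..t, k s := by
  rw [intervalIntegral.integral_of_le ht]
  exact setIntegral_nonneg measurableSet_Ioc fun s hs => hk.nonneg s hs.1

theorem integral_reflect_mono {t : ℝ} (ht : 0 ≤ t) {y z : ℝ → ℝ} (hy : Continuous y)
    (hz : Continuous z) (h : ∀ s, 0 ≤ s → s ≤ t → y s ≤ z s) :
    ∫ s in (0 : ℝ)..t, k (t - s) * y s ≤ ∫ s in (0 : ℝ)..t, k (t - s) * z s := by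
  refine intervalIntegral.integral_mono_on_of_le_Ioo ht (hk.reflect_mul ht hy)
    (hk.reflect_mul ht hz) ?_
  intro s hs
  exact mul_le_mul_of_nonneg_left (h s hs.1.le hs.2.le) (hk.nonneg _ (sub_pos.2 hs.2))

theorem integral_reflect_nonneg {t : ℝ} (ht : 0 ≤ t) {y : ℝ → ℝ}
    (h : ∀ s, 0 ≤ s → s ≤ t → 0 ≤ y s) : 0 ≤ ∫ s in (0 : ℝ)..t, k (t - s) * y s := by
  rw [intervalIntegral.integral_of_le ht, integral_Ioc_eq_integral_Ioo]
  exact setIntegral_nonneg measurableSet_Ioo fun s hs =>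
    mul_nonneg (hk.nonneg _ (sub_pos.2 hs.2)) (h s hs.1.le hs.2.le)

omit [NormedSpace ℝ E] in
theorem quad_nonneg {t : ℝ} (ht : 0 ≤ t) (v : ℝ → E) : 0 ≤ quad k v t :=
  hk.integral_reflect_nonneg ht fun _ _ _ => by positivity

omit [NormedSpace ℝ E] in
theorem quad_le_of_norm_le {t : ℝ} (ht : 0 ≤ t) {F : Type*} [NormedAddCommGroup F]
    {v : ℝ → E} {w : ℝ → F} (hv : Continuous v) (hw : Continuous w) {c : ℝ}
    (h : ∀ s, 0 ≤ s → s ≤ t → ‖v t - v s‖ ≤ c * ‖w t - w s‖) :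
    quad k v t ≤ c ^ 2 * quad k w t := by
  have e : c ^ 2 * quad k w t = ∫ s in (0 : ℝ)..t, k (t - s) * (c ^ 2 * ‖w t - w s‖ ^ 2) := by
    rw [quad, ← intervalIntegral.integral_const_mul]
    congr 1; funext s; ring
  rw [e]
  refine hk.integral_reflect_mono ht (by fun_prop) (by fun_prop) fun s h0 h1 => ?_
  rw [← mul_pow]
  exact pow_le_pow_left₀ (norm_nonneg _) (h s h0 h1) 2

omit [NormedSpace ℝ E] in
theorem quad_le_of_bound {t : ℝ} (ht : 0 ≤ t) {v : ℝ → E} (hv : Continuous v) {M : ℝ}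
    (h : ∀ s, 0 ≤ s → s ≤ t → ‖v s‖ ^ 2 ≤ M) :
    quad k v t ≤ (∫ s in (0 : ℝ)..t, k s) * (4 * M) := by
  have e : (∫ s in (0 : ℝ)..t, k s) * (4 * M) = ∫ s in (0 : ℝ)..t, k (t - s) * (4 * M) := by
    rw [intervalIntegral.integral_mul_const, integral_reflect]
  rw [e]
  refine hk.integral_reflect_mono ht (by fun_prop) (by fun_prop) fun s h0 h1 => ?_
  have a1 := h s h0 h1
  have a2 := h t ht le_rfl
  have a3 := norm_sub_le (v t) (v s)
  nlinarith [norm_nonneg (v t - v s), norm_nonneg (v t), norm_nonneg (v s),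
    sq_nonneg (‖v t‖ - ‖v s‖)]

omit [NormedSpace ℝ E] in
theorem quad_le_two_mul_add {t : ℝ} (ht : 0 ≤ t) {v w : ℝ → E} (hv : Continuous v)
    (hw : Continuous w) :
    quad k v t ≤ 2 * quad k w t + 2 * quad k (fun s => v s - w s) t := by
  have e : 2 * quad k w t + 2 * quad k (fun s => v s - w s) t =
      ∫ s in (0 : ℝ)..t, k (t - s) *
        (2 * ‖w t - w s‖ ^ 2 + 2 * ‖(v t - w t) - (v s - w s)‖ ^ 2) := by
    rw [quad, quad, ← intervalIntegral.integral_const_mul, ← intervalIntegral.integral_const_mul,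
      ← intervalIntegral.integral_add]
    · congr 1; funext s; ring
    · exact (hk.reflect_mul ht (by fun_prop)).const_mul 2
    · exact (hk.reflect_mul ht (by fun_prop)).const_mul 2
  rw [e]
  refine hk.integral_reflect_mono ht (by fun_prop) (by fun_prop) fun s h0 h1 => ?_
  have a1 : v t - v s = (w t - w s) + ((v t - w t) - (v s - w s)) := by abel
  have a3 := norm_add_le (w t - w s) ((v t - w t) - (v s - w s))
  rw [← a1] at a3
  nlinarith [norm_nonneg (v t - v s), norm_nonneg (w t - w s),
    norm_nonneg ((v t - w t) - (v s - w s)),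
    sq_nonneg (‖w t - w s‖ - ‖(v t - w t) - (v s - w s)‖)]

/-- The Cauchy–Schwarz inequality for memory integrals. -/
theorem norm_relax_sq_le {t : ℝ} (ht : 0 ≤ t) {v : ℝ → E} (hv : Continuous v) :
    ‖relax k v t‖ ^ 2 ≤ (∫ s in (0 : ℝ)..t, k s) * quad k v t := by
  set m := ∫ s in (0 : ℝ)..t, k (t - s) * ‖v t - v s‖ with hm
  have h1 : ‖relax k v t‖ ≤ m := by
    refine intervalIntegral.norm_integral_le_of_norm_le ht ?_ (hk.reflect_mul ht (by fun_prop))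
    have : ∀ᵐ s : ℝ, s ≠ t := by simp [ae_iff]
    filter_upwards [this] with s hs hst
    rw [norm_smul, Real.norm_of_nonneg (hk.nonneg _ (sub_pos.2 (lt_of_le_of_ne hst.2 hs)))]
  have h2 : ∀ x : ℝ, 0 ≤ (∫ s in (0 : ℝ)..t, k s) * (x * x) + (-2 * m) * x + quad k v t := by
    intro x
    have e : (∫ s in (0 : ℝ)..t, k s) * (x * x) + (-2 * m) * x + quad k v t =
        ∫ s in (0 : ℝ)..t, k (t - s) * (‖v t - v s‖ - x) ^ 2 := by
      rw [hm, quad, ← integral_reflect (k := k), ← intervalIntegral.integral_mul_const,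
        ← intervalIntegral.integral_const_mul, ← intervalIntegral.integral_mul_const,
        ← intervalIntegral.integral_add, ← intervalIntegral.integral_add]
      · congr 1; funext s; ring
      · exact ((hk.reflect ht).mul_const _).add
          (((hk.reflect_mul ht (by fun_prop)).const_mul _).mul_const _)
      · exact hk.reflect_mul ht (by fun_prop)
      · exact (hk.reflect ht).mul_const _
      · exact ((hk.reflect_mul ht (by fun_prop)).const_mul _).mul_const _
    rw [e]
    exact hk.integral_reflect_nonneg ht fun _ _ _ => by positivity
  have h3 := discrim_le_zero h2
  rw [discrim] at h3
  nlinarith [norm_nonneg (relax k v t)]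

omit [NormedSpace ℝ E] in
/-- The quadratic memory integral of a continuous function depends continuously on time. -/
theorem continuousOn_quad {v : ℝ → E} (hv : Continuous v) : ContinuousOn (quad k v) (Ici 0) := by
  -- the weight is extended by zero to negative times
  set κ : ℝ → ℝ := (Ioi 0).indicator k with hκ
  have hκk : ∀ s, 0 < s → κ s = k s := fun s hs => indicator_of_mem (mem_Ioi.2 hs) k
  have hκint : ∀ T, 0 ≤ T → IntervalIntegrable κ volume (-T) T := by
    intro T hT
    have hz : IntervalIntegrable κ volume (-T) 0 := by
      rw [intervalIntegrable_iff_integrableOn_Ioc_of_le (by linarith)]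
      refine integrableOn_zero.congr_fun ?_ measurableSet_Ioc
      intro s hs
      exact (indicator_of_notMem (fun h => absurd hs.2 (not_le.2 h)) k).symm
    refine hz.trans ?_
    have := hk.intervalIntegrable T hT
    rw [intervalIntegrable_iff_integrableOn_Ioc_of_le hT] at this ⊢
    exact this.congr_fun (fun s hs => (hκk s hs.1).symm) measurableSet_Ioc
  have heq : ∀ t, 0 ≤ t → quad k v t = ∫ s in (0 : ℝ)..t, κ s * ‖v t - v (t - s)‖ ^ 2 := by
    intro t ht
    have := intervalIntegral.integral_comp_sub_left
      (a := 0) (b := t) (fun s => k s * ‖v t - v (t - s)‖ ^ 2) t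
    simp only [sub_sub_cancel, sub_self, sub_zero] at this
    rw [quad, this]
    refine intervalIntegral.integral_congr_ae (Eventually.of_forall fun s hs => ?_)
    rw [uIoc_of_le ht] at hs
    rw [hκk s hs.1]
  intro t₀ ht₀
  refine ContinuousWithinAt.congr ?_ heq (heq t₀ ht₀)
  refine ContinuousAt.continuousWithinAt ?_
  have hT : (0 : ℝ) ≤ t₀ + 1 := by have := mem_Ici.1 ht₀; linarith
  obtain ⟨M, hM⟩ := (isCompact_Icc.prod isCompact_Icc :
      IsCompact (Icc (t₀ - 1) (t₀ + 1) ×ˢ Icc (-(t₀ + 1)) (t₀ + 1))).exists_bound_of_continuousOn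
    (f := fun q : ℝ × ℝ => ‖v q.1 - v (q.1 - q.2)‖ ^ 2) (by fun_prop)
  have hmem : t₀ ∈ Ioo (-(t₀ + 1)) (t₀ + 1) := by
    have := mem_Ici.1 ht₀
    constructor <;> linarith
  have h0mem : (0 : ℝ) ∈ Ioo (-(t₀ + 1)) (t₀ + 1) := by
    have := mem_Ici.1 ht₀
    constructor <;> linarith
  have main : ContinuousAt (fun p : ℝ × ℝ => ∫ s in (0 : ℝ)..p.2, κ s * ‖v p.1 - v (p.1 - s)‖ ^ 2)
      (t₀, t₀) := by
    refine intervalIntegral.continuousAt_parametric_primitive_of_dominated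
      (F := fun t s => κ s * ‖v t - v (t - s)‖ ^ 2)
      (fun s => |κ s| * M) (-(t₀ + 1)) (t₀ + 1) ?_ ?_ ?_ ?_ h0mem hmem (by simp)
    · intro t
      exact ((hκint _ hT).mul_continuousOn (g := fun s => ‖v t - v (t - s)‖ ^ 2)
        (by fun_prop)).aestronglyMeasurable_restrict_uIoc
    · filter_upwards [Icc_mem_nhds (sub_one_lt t₀) (lt_add_one t₀)] with t ht
      rw [ae_restrict_iff' measurableSet_uIoc]
      refine Eventually.of_forall fun s hs => ?_
      rw [uIoc_of_le (by linarith)] at hs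
      rw [norm_mul, Real.norm_eq_abs]
      exact mul_le_mul_of_nonneg_left (hM (t, s) ⟨ht, ⟨hs.1.le, hs.2⟩⟩) (abs_nonneg _)
    · exact (hκint _ hT).abs.mul_const M
    · refine Eventually.of_forall fun s => ?_
      exact Continuous.continuousAt (by fun_prop)
  exact main.comp (f := fun t : ℝ => (t, t)) (by fun_prop)

end IsWeight

namespace IsRelaxation

variable {g k : ℝ → ℝ} (hg : IsRelaxation g k)
include hg

theorem weight : IsWeight g :=
  ⟨fun _ _ => hg.continuous.intervalIntegrable _ _, fun t _ => hg.nonneg t⟩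

theorem dissipation_nonneg {t : ℝ} (ht : 0 < t) : 0 ≤ k t := by
  have h := (hg.hasDerivAt t ht).deriv
  have h2 : deriv g t ≤ 0 := hg.antitone.deriv_nonpos
  linarith

theorem weight_dissipation : IsWeight k := by
  refine ⟨fun T hT => ?_, fun t ht => hg.dissipation_nonneg ht⟩
  refine intervalIntegral.intervalIntegrable_deriv_of_nonneg (g := fun t => -g t)
    hg.continuous.neg.continuousOn ?_ ?_
  · intro x hx
    rw [min_eq_left hT] at hx
    exact (hg.hasDerivAt x hx.1).neg.congr_deriv (neg_neg _)
  · intro x hx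
    rw [min_eq_left hT] at hx
    exact hg.dissipation_nonneg hx.1

theorem integral_dissipation {T : ℝ} (hT : 0 ≤ T) : ∫ s in (0 : ℝ)..T, k s = g 0 - g T := by
  have := intervalIntegral.integral_eq_sub_of_hasDerivAt_of_le hT
    (f := fun t => -g t) (f' := k) hg.continuous.neg.continuousOn
    (fun x hx => (hg.hasDerivAt x hx.1).neg.congr_deriv (neg_neg _))
    (hg.weight_dissipation.intervalIntegrable T hT)
  rw [this]; ring

theorem integral_dissipation_le {T : ℝ} (hT : 0 ≤ T) : ∫ s in (0 : ℝ)..T, k s ≤ g 0 := by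
  rw [hg.integral_dissipation hT]; linarith [hg.nonneg T]

theorem integral_le {T : ℝ} (hT : 0 ≤ T) : ∫ s in (0 : ℝ)..T, g s ≤ ∫ s in Ioi (0 : ℝ), g s := by
  rw [intervalIntegral.integral_of_le hT]
  exact setIntegral_mono_set hg.integrable (Eventually.of_forall hg.nonneg)
    (Eventually.of_forall fun _ h => h.1)

theorem hasDerivAt_integral (t : ℝ) : HasDerivAt (fun t => ∫ s in (0 : ℝ)..t, g s) (g t) t :=
  intervalIntegral.integral_hasDerivAt_right (hg.continuous.intervalIntegrable _ _)
    (hg.continuous.stronglyMeasurableAtFilter _ _) hg.continuous.continuousAt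

theorem integral_pos {t : ℝ} (ht : 0 < t) : 0 < ∫ s in (0 : ℝ)..t, g s :=
  intervalIntegral.integral_pos ht hg.continuous.continuousOn (fun x _ => hg.nonneg x)
    ⟨0, left_mem_Icc.2 ht.le, hg.pos_zero⟩

theorem integral_mono {s t : ℝ} (hst : s ≤ t) :
    ∫ x in (0 : ℝ)..s, g x ≤ ∫ x in (0 : ℝ)..t, g x := by
  have : Monotone (fun t => ∫ s in (0 : ℝ)..t, g s) :=
    monotone_of_deriv_nonneg (fun t => (hg.hasDerivAt_integral t).differentiableAt)
      fun t => by rw [(hg.hasDerivAt_integral t).deriv]; exact hg.nonneg t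
  exact this hst

omit hg in
theorem conv_eq_comp_sub (v : ℝ → E) (t : ℝ) : conv g v t = ∫ s in (0 : ℝ)..t, g s • v (t - s) := by
  have := intervalIntegral.integral_comp_sub_left (a := 0) (b := t) (fun s => g s • v (t - s)) t
  simp only [sub_sub_cancel, sub_self, sub_zero] at this
  rw [conv, this]

theorem continuous_conv {v : ℝ → E} (hv : Continuous v) : Continuous (conv g v) := by
  have e : conv g v = fun t => ∫ s in (0 : ℝ)..t, g s • v (t - s) :=
    funext fun t => conv_eq_comp_sub v t
  rw [e]
  have := hg.continuous
  exact intervalIntegral.continuous_parametric_intervalIntegral_of_continuous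
    (f := fun t s => g s • v (t - s)) (by fun_prop) continuous_id

theorem relax_eq [CompleteSpace E] {v : ℝ → E} (hv : Continuous v) (t : ℝ) :
    relax g v t = (∫ s in (0 : ℝ)..t, g s) • v t - conv g v t := by
  have hgc := hg.continuous
  rw [relax, conv, ← IsWeight.integral_reflect (k := g), ← intervalIntegral.integral_smul_const,
    ← intervalIntegral.integral_sub]
  · congr 1; funext s; rw [smul_sub]
  · exact Continuous.intervalIntegrable (by fun_prop) _ _
  · exact Continuous.intervalIntegrable (by fun_prop) _ _

variable [CompleteSpace E]

/-- Integration by parts moves the time derivative onto the relaxation function. -/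
theorem conv_deriv {v v' : ℝ → E} (hv : ∀ t, HasDerivAt v (v' t) t) (hv' : Continuous v') {t : ℝ}
    (ht : 0 ≤ t) : conv g v' t = g t • (v t - v 0) + relax k v t := by
  have hvc : Continuous v := continuous_iff_continuousAt.2 fun t => (hv t).continuousAt
  have hgc := hg.continuous
  have h := intervalIntegral.integral_smul_deriv_eq_deriv_smul_of_hasDerivAt (a := 0) (b := t)
    (u := fun s => g (t - s)) (v := fun s => v s - v t) (u' := fun s => k (t - s)) (v' := v')
    (by fun_prop) (by fun_prop) ?_ (fun x _ => (hv x).sub_const _)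
    (hg.weight_dissipation.reflect ht) (hv'.intervalIntegrable _ _)
  · rw [conv, h, relax]
    simp only [sub_self, smul_zero, sub_zero, zero_sub]
    rw [← smul_neg, neg_sub, sub_eq_add_neg, ← intervalIntegral.integral_neg]
    congr 2
    funext s
    rw [← smul_neg, neg_sub]
  · intro x hx
    rw [min_eq_left ht, max_eq_right ht] at hx
    have := (hg.hasDerivAt (t - x) (sub_pos.2 hx.2)).comp_const_sub t x
    simpa using this

/-- The derivative of a convolution, falling on the second factor. -/
theorem hasDerivAt_conv_aux {v v' : ℝ → E} (hv : ∀ t, HasDerivAt v (v' t) t)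
    (hv' : Continuous v') {t : ℝ} (ht : 0 < t) :
    HasDerivAt (conv g v) (g t • v 0 + conv g v' t) t := by
  have hvc : Continuous v := continuous_iff_continuousAt.2 fun t => (hv t).continuousAt
  have hgc := hg.continuous
  -- on `(0, t + 1)` the convolution is an integral over a fixed interval, of a function that is
  -- differentiable in the parameter off the diagonal and Lipschitz in it
  set w : ℝ → E := fun r => v (max r 0) - v 0 with hw
  have hwc : Continuous w := by fun_prop
  have hT : (0 : ℝ) ≤ t + 1 := by linarith
  obtain ⟨M, hM⟩ := isCompact_Icc.exists_bound_of_continuousOn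
    (s := Icc (0 : ℝ) (t + 1)) (f := v') hv'.continuousOn
  have hM0 : 0 ≤ M := (norm_nonneg _).trans (hM 0 (left_mem_Icc.2 hT))
  have hvlip : ∀ x ∈ Icc (0 : ℝ) (t + 1), ∀ y ∈ Icc (0 : ℝ) (t + 1), ‖v x - v y‖ ≤ M * ‖x - y‖ :=
    fun x hx y hy => (convex_Icc _ _).norm_image_sub_le_of_norm_hasDerivWithin_le
      (fun z _ => (hv z).hasDerivWithinAt) hM hy hx
  have hloc : conv g v =ᶠ[𝓝 t] fun r =>
      (∫ s in (0 : ℝ)..r, g s) • v 0 + ∫ s in (0 : ℝ)..(t + 1), g s • w (r - s) := by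
    filter_upwards [Ioo_mem_nhds ht (lt_add_one t)] with r hr
    have h2 : ∫ s in r..(t + 1), g s • w (r - s) = 0 := by
      rw [intervalIntegral.integral_congr (g := fun _ => (0 : E))]
      · simp
      · intro s hs
        rw [uIcc_of_le hr.2.le] at hs
        have : max (r - s) 0 = 0 := max_eq_right (by linarith [hs.1])
        simp [hw, this]
    rw [← intervalIntegral.integral_add_adjacent_intervals (b := r) (c := t + 1)
      (f := fun s => g s • w (r - s)) (Continuous.intervalIntegrable (by fun_prop) _ _)
      (Continuous.intervalIntegrable (by fun_prop) _ _), h2, add_zero,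
      ← intervalIntegral.integral_smul_const, ← intervalIntegral.integral_add
      (Continuous.intervalIntegrable (by fun_prop) _ _)
      (Continuous.intervalIntegrable (by fun_prop) _ _), conv_eq_comp_sub]
    refine intervalIntegral.integral_congr fun s hs => ?_
    rw [uIcc_of_le hr.1.le] at hs
    have : max (r - s) 0 = r - s := max_eq_left (by linarith [hs.2])
    simp only [hw, this]
    rw [← smul_add]; congr 1; abel
  have hne : ∀ᵐ s : ℝ, s ≠ t := by simp [ae_iff]
  obtain ⟨-, hD⟩ := intervalIntegral.hasDerivAt_integral_of_dominated_loc_of_lip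
    (μ := volume) (a := 0) (b := t + 1) (F := fun r s => g s • w (r - s))
    (F' := fun s => if s < t then g s • v' (t - s) else 0) (x₀ := t)
    (s := Ioo 0 (t + 1)) (bound := fun s => g s * M)
    (Ioo_mem_nhds ht (lt_add_one t))
    (Eventually.of_forall fun r => Continuous.aestronglyMeasurable (by fun_prop))
    (Continuous.intervalIntegrable (by fun_prop) _ _)
    (by
      refine (StronglyMeasurable.ite (measurableSet_lt measurable_id measurable_const) ?_
        stronglyMeasurable_const).aestronglyMeasurable
      exact Continuous.stronglyMeasurable (by fun_prop))
    (by
      refine Eventually.of_forall fun s hs => ?_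
      rw [uIoc_of_le hT] at hs
      refine LipschitzOnWith.of_dist_le_mul fun x hx y hy => ?_
      rw [dist_eq_norm, ← smul_sub, norm_smul, Real.norm_of_nonneg (hg.nonneg s), Real.coe_nnabs,
        abs_of_nonneg (mul_nonneg (hg.nonneg s) hM0), mul_assoc]
      refine mul_le_mul_of_nonneg_left ?_ (hg.nonneg s)
      have hm : ∀ z ∈ Ioo 0 (t + 1), max (z - s) 0 ∈ Icc (0 : ℝ) (t + 1) := fun z hz =>
        ⟨le_max_right _ _, max_le (by linarith [hz.2, hs.1]) hT⟩
      have := hvlip _ (hm x hx) _ (hm y hy)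
      simp only [hw, sub_sub_sub_cancel_right]
      refine this.trans (mul_le_mul_of_nonneg_left ?_ hM0)
      rw [Real.norm_eq_abs, Real.dist_eq]
      refine (abs_max_sub_max_le_abs _ _ _).trans ?_
      rw [sub_sub_sub_cancel_right])
    (Continuous.intervalIntegrable (by fun_prop) _ _)
    (by
      filter_upwards [hne] with s hs _
      rcases lt_or_gt_of_ne hs with h | h
      · rw [if_pos h]
        refine HasDerivAt.fun_const_smul (g s) ?_
        have h1 : HasDerivAt (fun r => v (r - s) - v 0) (v' (t - s)) t :=
          ((hv (t - s)).comp_sub_const t s).sub_const _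
        refine h1.congr_of_eventuallyEq ?_
        filter_upwards [lt_mem_nhds h] with r hr
        have : max (r - s) 0 = r - s := max_eq_left (by linarith)
        simp only [hw, this]
      · rw [if_neg (not_lt.2 h.le)]
        refine (hasDerivAt_const t (0 : E)).congr_of_eventuallyEq ?_
        filter_upwards [gt_mem_nhds h] with r hr
        have : max (r - s) 0 = 0 := max_eq_right (by linarith)
        simp only [hw, this, sub_self, smul_zero])
  have hF' : (∫ s in (0 : ℝ)..(t + 1), if s < t then g s • v' (t - s) else 0) = conv g v' t := by
    have i1 : IntervalIntegrable (fun s => if s < t then g s • v' (t - s) else 0) volume 0 t := by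
      refine (Continuous.intervalIntegrable (u := fun s => g s • v' (t - s))
        (by fun_prop) 0 t).congr_ae ?_
      rw [EventuallyEq, ae_restrict_iff' measurableSet_uIoc]
      filter_upwards [hne] with s hs hst
      rw [uIoc_of_le ht.le] at hst
      rw [if_pos (lt_of_le_of_ne hst.2 hs)]
    have i2 : IntervalIntegrable (fun s => if s < t then g s • v' (t - s) else 0)
        volume t (t + 1) := by
      refine (Continuous.intervalIntegrable (u := fun _ => (0 : E))
        (by fun_prop) t (t + 1)).congr ?_
      intro s hs
      rw [uIoc_of_le (by linarith)] at hs
      simp only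
      rw [if_neg (not_lt.2 hs.1.le)]
    rw [← intervalIntegral.integral_add_adjacent_intervals i1 i2, conv_eq_comp_sub]
    have e2 : (∫ s in t..(t + 1), if s < t then g s • v' (t - s) else 0) = 0 := by
      rw [intervalIntegral.integral_congr (g := fun _ => (0 : E))]
      · simp
      · intro s hs
        rw [uIcc_of_le (by linarith)] at hs
        simp only
        rw [if_neg (not_lt.2 hs.1)]
    rw [e2, add_zero]
    refine intervalIntegral.integral_congr_ae ?_
    filter_upwards [hne] with s hs hst
    rw [uIoc_of_le ht.le] at hst
    rw [if_pos (lt_of_le_of_ne hst.2 hs)]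
  rw [hF'] at hD
  exact (((hg.hasDerivAt_integral t).smul_const (v 0)).add hD).congr_of_eventuallyEq hloc

/-- The derivative of a convolution, falling on the relaxation function. -/
theorem hasDerivAt_conv {v v' : ℝ → E} (hv : ∀ t, HasDerivAt v (v' t) t)
    (hv' : Continuous v') {t : ℝ} (ht : 0 < t) :
    HasDerivAt (conv g v) (g t • v t + relax k v t) t := by
  have h := hg.hasDerivAt_conv_aux hv hv' ht
  rw [hg.conv_deriv hv hv' ht.le] at h
  exact h.congr_deriv (by rw [smul_sub]; abel)

theorem hasDerivAt_relax {v v' : ℝ → E} (hv : ∀ t, HasDerivAt v (v' t) t)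
    (hv' : Continuous v') {t : ℝ} (ht : 0 < t) :
    HasDerivAt (relax g v) ((∫ s in (0 : ℝ)..t, g s) • v' t - relax k v t) t := by
  have hvc : Continuous v := continuous_iff_continuousAt.2 fun t => (hv t).continuousAt
  have e : relax g v = fun t => (∫ s in (0 : ℝ)..t, g s) • v t - conv g v t :=
    funext fun t => hg.relax_eq hvc t
  rw [e]
  exact (((hg.hasDerivAt_integral t).smul (hv t)).sub (hg.hasDerivAt_conv hv hv' ht)).congr_deriv
    (by abel)

end IsRelaxation

end Normed

section Inner

variable {H : Type*} [NormedAddCommGroup H] [InnerProductSpace ℝ H] [CompleteSpace H]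

namespace IsRelaxation

variable {g k : ℝ → ℝ} (hg : IsRelaxation g k)
include hg

omit hg in
theorem inner_relax_eq {v : ℝ → H} {k : ℝ → ℝ} (hk : IsWeight k) (hv : Continuous v) {t : ℝ}
    (ht : 0 ≤ t) (z : H) :
    ⟪z, relax k v t⟫ = ∫ s in (0 : ℝ)..t, k (t - s) * ⟪z, v t - v s⟫ := by
  have h := (innerSL ℝ z).intervalIntegral_comp_comm
    (hk.reflect_smul ht (y := fun s => v t - v s) (by fun_prop))
  simp only [innerSL_apply_apply, inner_smul_right] at h
  rw [relax, ← h]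

theorem quad_eq {v : ℝ → H} (hv : Continuous v) (t : ℝ) :
    quad g v t = (∫ s in (0 : ℝ)..t, g s) * ‖v t‖ ^ 2 - 2 * ⟪v t, conv g v t⟫
      + conv g (fun s => ‖v s‖ ^ 2) t := by
  have hgc := hg.continuous
  have h := (innerSL ℝ (v t)).intervalIntegral_comp_comm (a := 0) (b := t) (μ := volume)
    (f := fun s => g (t - s) • v s) (Continuous.intervalIntegrable (by fun_prop) _ _)
  simp only [innerSL_apply_apply, inner_smul_right] at h
  rw [conv, ← h, quad, conv, ← IsWeight.integral_reflect (k := g), ← intervalIntegral.integral_mul_const,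
    ← intervalIntegral.integral_const_mul, ← intervalIntegral.integral_sub,
    ← intervalIntegral.integral_add]
  · congr 1; funext s; rw [norm_sub_sq_real, smul_eq_mul]; ring
  all_goals exact Continuous.intervalIntegrable (by fun_prop) _ _

theorem hasDerivAt_quad {v v' : ℝ → H} (hv : ∀ t, HasDerivAt v (v' t) t)
    (hv' : Continuous v') {t : ℝ} (ht : 0 < t) :
    HasDerivAt (quad g v) (2 * ⟪v' t, relax g v t⟫ - quad k v t) t := by
  have hvc : Continuous v := continuous_iff_continuousAt.2 fun t => (hv t).continuousAt
  have e : quad g v = fun t => (∫ s in (0 : ℝ)..t, g s) * ‖v t‖ ^ 2 - 2 * ⟪v t, conv g v t⟫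
      + conv g (fun s => ‖v s‖ ^ 2) t := funext fun t => hg.quad_eq hvc t
  rw [e]
  have hn : ∀ t, HasDerivAt (fun s => ‖v s‖ ^ 2) (2 * ⟪v t, v' t⟫) t := fun t => (hv t).norm_sq
  have hn' : Continuous (fun t => 2 * ⟪v t, v' t⟫) := by fun_prop
  have h := (((hg.hasDerivAt_integral t).mul (hn t)).sub
    (((hv t).inner ℝ (hg.hasDerivAt_conv hv hv' ht)).const_mul 2)).add
    (hg.hasDerivAt_conv hn hn' ht)
  refine h.congr_deriv ?_
  have hk := hg.weight_dissipation
  have e1 : relax k (fun s => ‖v s‖ ^ 2) t - 2 * ⟪v t, relax k v t⟫ = - quad k v t := by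
    rw [inner_relax_eq hk hvc ht.le, quad, relax, ← intervalIntegral.integral_const_mul,
      ← intervalIntegral.integral_sub, ← intervalIntegral.integral_neg]
    · congr 1; funext s
      rw [norm_sub_sq_real, smul_eq_mul, inner_sub_right, real_inner_self_eq_norm_sq]; ring
    · exact hk.reflect_smul ht.le (by fun_prop)
    · exact (hk.reflect_mul ht.le (by fun_prop)).const_mul 2
  rw [hg.relax_eq hvc, inner_sub_right, inner_smul_right, inner_add_right, inner_smul_right,
    real_inner_self_eq_norm_sq, smul_eq_mul, real_inner_comm (v t) (v' t)]
  linarith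

theorem continuous_quad {v : ℝ → H} (hv : Continuous v) : Continuous (quad g v) := by
  have e : quad g v = fun t => (∫ s in (0 : ℝ)..t, g s) * ‖v t‖ ^ 2 - 2 * ⟪v t, conv g v t⟫
      + conv g (fun s => ‖v s‖ ^ 2) t := funext fun t => hg.quad_eq hv t
  have h1 := hg.continuous_conv hv
  have h2 : Continuous fun t => ∫ s in (0 : ℝ)..t, g s :=
    continuous_iff_continuousAt.2 fun t => (hg.hasDerivAt_integral t).continuousAt
  have h3 := hg.continuous_conv (v := fun s => ‖v s‖ ^ 2) (by fun_prop)
  rw [e]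
  fun_prop

end IsRelaxation

end Inner

/-! ### The system in an abstract Hilbert space -/

variable {H : Type*} [NormedAddCommGroup H] [InnerProductSpace ℝ H] [CompleteSpace H]

/-- Graphs `H1`, `H10`, `H1s` of a derivative on the analogues of `H¹`, `H¹₀` and `H¹_*`, linked by
integration by parts and Poincaré's inequalities with constant `c`. -/
structure DerivSystem (H : Type*) [NormedAddCommGroup H] [InnerProductSpace ℝ H] where
  H1 : Submodule ℝ (H × H)
  H10 : Submodule ℝ (H × H)
  H1s : Submodule ℝ (H × H)
  c : ℝ
  c_pos : 0 < c
  H1s_le : H1s ≤ H1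
  parts : ∀ p ∈ H1, ∀ q ∈ H10, ⟪p.2, q.1⟫ + ⟪p.1, q.2⟫ = 0
  poincare10 : ∀ p ∈ H10, ‖p.1‖ ≤ c * ‖p.2‖
  poincares : ∀ p ∈ H1s, ‖p.1‖ ≤ c * ‖p.2‖

/-- A function `u` of time with values in `H` along with its derivatives `u_x`, `u_xx`, `u_t`,
`u_xt`, `u_tt`. -/
structure Motion (H : Type*) where
  (u ux uxx ut uxt utt : ℝ → H)

/-- The derivatives in time hold on all of `ℝ`, those in space at nonnegative times; `V` contains
`(u, u_x)` and `(u_t, u_xt)`, and `W` contains `(u_x, u_xx)`. -/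
structure IsMotion (V W : Submodule ℝ (H × H)) (m : Motion H) : Prop where
  hasDerivAt_u : ∀ t, HasDerivAt m.u (m.ut t) t
  hasDerivAt_ux : ∀ t, HasDerivAt m.ux (m.uxt t) t
  hasDerivAt_ut : ∀ t, HasDerivAt m.ut (m.utt t) t
  cont_uxx : Continuous m.uxx
  cont_uxt : Continuous m.uxt
  cont_utt : Continuous m.utt
  mem_u : ∀ t, 0 ≤ t → (m.u t, m.ux t) ∈ V
  mem_ut : ∀ t, 0 ≤ t → (m.ut t, m.uxt t) ∈ V
  mem_ux : ∀ t, 0 ≤ t → (m.ux t, m.uxx t) ∈ W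

namespace IsMotion

variable {V W : Submodule ℝ (H × H)} {m : Motion H} (hm : IsMotion V W m)
include hm

omit [CompleteSpace H] in
theorem cont_u : Continuous m.u := continuous_iff_continuousAt.2 fun t =>
  (hm.hasDerivAt_u t).continuousAt

omit [CompleteSpace H] in
theorem cont_ux : Continuous m.ux := continuous_iff_continuousAt.2 fun t =>
  (hm.hasDerivAt_ux t).continuousAt

omit [CompleteSpace H] in
theorem cont_ut : Continuous m.ut := continuous_iff_continuousAt.2 fun t =>
  (hm.hasDerivAt_ut t).continuousAt

end IsMotion

/-- Coefficients of the Bresse system with `k₃ = k₁`. -/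
structure Coeffs where
  (ρ₁ ρ₂ k₁ k₂ l : ℝ)
  ρ₁_pos : 0 < ρ₁
  ρ₂_pos : 0 < ρ₂
  k₁_pos : 0 < k₁
  k₂_pos : 0 < k₂
  l_pos : 0 < l

/-- The three unknowns of the system. -/
structure Triple (H : Type*) where
  (φ ψ w : Motion H)

namespace Triple

variable (a : Coeffs) (g : ℝ → ℝ) (X : Triple H) (t : ℝ)

/-- The shear `A = φ_x + ψ + l w`. -/
def A : H := X.φ.ux t + X.ψ.u t + a.l • X.w.u t

/-- `A_x`. -/
def Ax : H := X.φ.uxx t + X.ψ.ux t + a.l • X.w.ux t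

/-- `A_t`. -/
def At : H := X.φ.uxt t + X.ψ.ut t + a.l • X.w.ut t

/-- The axial strain `B = w_x - l φ`. -/
def B : H := X.w.ux t - a.l • X.φ.u t

/-- `B_x`. -/
def Bx : H := X.w.uxx t - a.l • X.φ.ux t

/-- `B_t`. -/
def Bt : H := X.w.uxt t - a.l • X.φ.ut t

/-- The bending moment `M = k₂ ψ_x - g * ψ_x`. -/
def M : H := a.k₂ • X.ψ.ux t - conv g X.ψ.ux t

/-- `M_x`. -/
def Mx : H := a.k₂ • X.ψ.uxx t - conv g X.ψ.uxx t

/-- The energy. -/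
def E : ℝ :=
  (1 / 2) * (a.ρ₁ * ‖X.φ.ut t‖ ^ 2 + a.ρ₂ * ‖X.ψ.ut t‖ ^ 2 + a.ρ₁ * ‖X.w.ut t‖ ^ 2
      + (a.k₂ - ∫ s in (0 : ℝ)..t, g s) * ‖X.ψ.ux t‖ ^ 2
      + a.k₁ * ‖X.B a t‖ ^ 2 + a.k₁ * ‖X.A a t‖ ^ 2)
    + (1 / 2) * quad g X.ψ.ux t

end Triple

/-- `X` solves the Bresse system with memory kernel `g` and a forcing `f` in the second equation. -/
structure IsSolution (S : DerivSystem H) (a : Coeffs) (g : ℝ → ℝ) (f : ℝ → H) (X : Triple H) :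
    Prop where
  φ : IsMotion S.H10 S.H1 X.φ
  ψ : IsMotion S.H1s S.H10 X.ψ
  w : IsMotion S.H1s S.H10 X.w
  eq_φ : ∀ t, 0 < t → a.ρ₁ • X.φ.utt t = a.k₁ • X.Ax a t + (a.l * a.k₁) • X.B a t
  eq_ψ : ∀ t, 0 < t → a.ρ₂ • X.ψ.utt t = X.Mx a g t - a.k₁ • X.A a t - f t
  eq_w : ∀ t, 0 < t → a.ρ₁ • X.w.utt t = a.k₁ • X.Bx a t - (a.l * a.k₁) • X.A a t

namespace IsSolution

variable {S : DerivSystem H} {a : Coeffs} {g k : ℝ → ℝ} {f : ℝ → H} {X : Triple H}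
variable (hX : IsSolution S a g f X) (hg : IsRelaxation g k)

section
include hX

omit [CompleteSpace H] in
theorem hasDerivAt_A (t : ℝ) : HasDerivAt (X.A a) (X.At a t) t :=
  ((hX.φ.hasDerivAt_ux t).add (hX.ψ.hasDerivAt_u t)).add ((hX.w.hasDerivAt_u t).const_smul a.l)

omit [CompleteSpace H] in
theorem hasDerivAt_B (t : ℝ) : HasDerivAt (X.B a) (X.Bt a t) t :=
  (hX.w.hasDerivAt_ux t).sub ((hX.φ.hasDerivAt_u t).const_smul a.l)

omit [CompleteSpace H] in
theorem mem_A {t : ℝ} (ht : 0 ≤ t) : (X.A a t, X.Ax a t) ∈ S.H1 :=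
  S.H1.add_mem (S.H1.add_mem (hX.φ.mem_ux t ht) (S.H1s_le (hX.ψ.mem_u t ht)))
    (S.H1.smul_mem a.l (S.H1s_le (hX.w.mem_u t ht)))

omit [CompleteSpace H] in
theorem mem_B {t : ℝ} (ht : 0 ≤ t) : (X.B a t, X.Bx a t) ∈ S.H10 :=
  S.H10.sub_mem (hX.w.mem_ux t ht) (S.H10.smul_mem a.l (hX.φ.mem_u t ht))

omit [CompleteSpace H] in
theorem inner_φ {t : ℝ} (ht : 0 < t) (z : H) :
    a.ρ₁ * ⟪X.φ.utt t, z⟫ = a.k₁ * ⟪X.Ax a t, z⟫ + a.l * a.k₁ * ⟪X.B a t, z⟫ := by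
  have h := congrArg (fun y => ⟪y, z⟫) (hX.eq_φ t ht)
  simpa only [inner_add_left, real_inner_smul_left] using h

omit [CompleteSpace H] in
theorem inner_w {t : ℝ} (ht : 0 < t) (z : H) :
    a.ρ₁ * ⟪X.w.utt t, z⟫ = a.k₁ * ⟪X.Bx a t, z⟫ - a.l * a.k₁ * ⟪X.A a t, z⟫ := by
  have h := congrArg (fun y => ⟪y, z⟫) (hX.eq_w t ht)
  simpa only [inner_sub_left, real_inner_smul_left] using h

omit [CompleteSpace H] in
theorem inner_ψ {t : ℝ} (ht : 0 < t) (z : H) :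
    a.ρ₂ * ⟪X.ψ.utt t, z⟫ = ⟪X.Mx a g t, z⟫ - a.k₁ * ⟪X.A a t, z⟫ - ⟪f t, z⟫ := by
  have h := congrArg (fun y => ⟪y, z⟫) (hX.eq_ψ t ht)
  simpa only [inner_sub_left, real_inner_smul_left] using h

end

include hX hg

/-- The memory preserves integration by parts. -/
theorem inner_relax_ux_add {t : ℝ} (ht : 0 ≤ t) {z z' : H} (hz : (z, z') ∈ S.H1) :
    ⟪z, relax g X.ψ.uxx t⟫ + ⟪z', relax g X.ψ.ux t⟫ = 0 := by
  rw [IsRelaxation.inner_relax_eq hg.weight hX.ψ.cont_uxx ht,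
    IsRelaxation.inner_relax_eq hg.weight hX.ψ.cont_ux ht, ← intervalIntegral.integral_add]
  · rw [intervalIntegral.integral_congr (g := fun _ => (0 : ℝ))]
    · simp
    · intro s hs
      rw [uIcc_of_le ht] at hs
      have h := S.parts _ hz _ (S.H10.sub_mem (hX.ψ.mem_ux t ht) (hX.ψ.mem_ux s hs.1))
      simp only [Prod.mk_sub_mk] at h
      simp only
      rw [← mul_add, add_comm, h, mul_zero]
  · exact hg.weight.reflect_mul ht (by have := hX.ψ.cont_uxx; fun_prop)
  · exact hg.weight.reflect_mul ht (by have := hX.ψ.cont_ux; fun_prop)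

theorem inner_Mx_add {t : ℝ} (ht : 0 ≤ t) {z z' : H} (hz : (z, z') ∈ S.H1) :
    ⟪X.Mx a g t, z⟫ + ⟪X.M a g t, z'⟫ = 0 := by
  have h1 := hX.inner_relax_ux_add hg ht hz
  have h2 := S.parts _ hz _ (hX.ψ.mem_ux t ht)
  rw [hg.relax_eq hX.ψ.cont_uxx, hg.relax_eq hX.ψ.cont_ux] at h1
  simp only [inner_sub_right, real_inner_smul_right] at h1
  simp only [Triple.Mx, Triple.M, inner_sub_left, real_inner_smul_left]
  simp only at h2
  rw [real_inner_comm z, real_inner_comm z, real_inner_comm z', real_inner_comm z']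
  linear_combination (a.k₂ - ∫ s in (0 : ℝ)..t, g s) * h2 + h1

/-- Integration by parts against `relax g ψ` without its own derivative in space: it is carried out
under the memory integral. -/
theorem inner_Mx_relax {t : ℝ} (ht : 0 ≤ t) :
    ⟪X.Mx a g t, relax g X.ψ.u t⟫ = -⟪X.M a g t, relax g X.ψ.ux t⟫ := by
  rw [IsRelaxation.inner_relax_eq hg.weight hX.ψ.cont_u ht,
    IsRelaxation.inner_relax_eq hg.weight hX.ψ.cont_ux ht, ← intervalIntegral.integral_neg]
  refine intervalIntegral.integral_congr fun s hs => ?_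
  rw [uIcc_of_le ht] at hs
  have h := hX.inner_Mx_add hg ht (S.H1s_le
    (S.H1s.sub_mem (hX.ψ.mem_u t ht) (hX.ψ.mem_u s hs.1)))
  rw [eq_neg_of_add_eq_zero_left h, mul_neg]

theorem M_eq (t : ℝ) :
    X.M a g t = (a.k₂ - ∫ s in (0 : ℝ)..t, g s) • X.ψ.ux t + relax g X.ψ.ux t := by
  rw [hg.relax_eq hX.ψ.cont_ux, Triple.M, sub_smul]; abel

theorem hasDerivAt_M {t : ℝ} (ht : 0 < t) :
    HasDerivAt (X.M a g) (a.k₂ • X.ψ.uxt t - g t • X.ψ.ux t - relax k X.ψ.ux t) t :=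
  (((hX.ψ.hasDerivAt_ux t).const_smul a.k₂).sub
    (hg.hasDerivAt_conv hX.ψ.hasDerivAt_ux hX.ψ.cont_uxt ht)).congr_deriv (by abel)

/-- The energy identity. -/
theorem hasDerivAt_E {t : ℝ} (ht : 0 < t) :
    HasDerivAt (X.E a g) (-(1 / 2) * quad k X.ψ.ux t - (1 / 2) * (g t * ‖X.ψ.ux t‖ ^ 2)
      - ⟪f t, X.ψ.ut t⟫) t := by
  have h := (((((((hX.φ.hasDerivAt_ut t).norm_sq.const_mul a.ρ₁).add
    ((hX.ψ.hasDerivAt_ut t).norm_sq.const_mul a.ρ₂)).add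
    ((hX.w.hasDerivAt_ut t).norm_sq.const_mul a.ρ₁)).add
    (((hg.hasDerivAt_integral t).const_sub a.k₂).mul (hX.ψ.hasDerivAt_ux t).norm_sq)).add
    ((hX.hasDerivAt_B t).norm_sq.const_mul a.k₁)).add
    ((hX.hasDerivAt_A t).norm_sq.const_mul a.k₁)).const_mul (1 / 2)
  have h2 := h.add ((hg.hasDerivAt_quad hX.ψ.hasDerivAt_ux hX.ψ.cont_uxt ht).const_mul (1 / 2))
  refine h2.congr_deriv ?_
  have e1 := hX.inner_φ ht (X.φ.ut t)
  have e2 := hX.inner_ψ ht (X.ψ.ut t)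
  have e3 := hX.inner_w ht (X.w.ut t)
  have p1 := S.parts _ (hX.mem_A ht.le) _ (hX.φ.mem_ut t ht.le)
  have p2 := hX.inner_Mx_add hg ht.le (S.H1s_le (hX.ψ.mem_ut t ht.le))
  have p3 := S.parts _ (S.H1s_le (hX.w.mem_ut t ht.le)) _ (hX.mem_B ht.le)
  have eA : ⟪X.A a t, X.At a t⟫ = ⟪X.A a t, X.φ.uxt t⟫ + ⟪X.A a t, X.ψ.ut t⟫
      + a.l * ⟪X.A a t, X.w.ut t⟫ := by
    simp only [Triple.At, inner_add_right, real_inner_smul_right]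
  have eB : ⟪X.B a t, X.Bt a t⟫ = ⟪X.B a t, X.w.uxt t⟫ - a.l * ⟪X.B a t, X.φ.ut t⟫ := by
    simp only [Triple.Bt, inner_sub_right, real_inner_smul_right]
  have eM : ⟪X.M a g t, X.ψ.uxt t⟫ = (a.k₂ - ∫ s in (0 : ℝ)..t, g s) * ⟪X.ψ.ux t, X.ψ.uxt t⟫
      + ⟪X.ψ.uxt t, relax g X.ψ.ux t⟫ := by
    rw [hX.M_eq hg, inner_add_left, real_inner_smul_left,
      real_inner_comm (X.ψ.uxt t) (relax g X.ψ.ux t)]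
  simp only at p1 p2 p3
  rw [eA, eB]
  rw [real_inner_comm] at e1 e2 e3
  rw [real_inner_comm (X.B a t), real_inner_comm (X.Bx a t)] at p3
  linear_combination e1 + e2 + e3 + a.k₁ * p1 + p2 + a.k₁ * p3 - eM

theorem continuous_E : Continuous (X.E a g) := by
  have h1 := hX.φ.cont_ut
  have h2 := hX.ψ.cont_ut
  have h3 := hX.w.cont_ut
  have h4 := hX.ψ.cont_ux
  have h5 : Continuous (X.A a) :=
    continuous_iff_continuousAt.2 fun t => (hX.hasDerivAt_A t).continuousAt
  have h6 : Continuous (X.B a) :=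
    continuous_iff_continuousAt.2 fun t => (hX.hasDerivAt_B t).continuousAt
  have h7 := hg.continuous_quad h4
  have h8 : Continuous fun t => ∫ s in (0 : ℝ)..t, g s :=
    continuous_iff_continuousAt.2 fun t => (hg.hasDerivAt_integral t).continuousAt
  unfold Triple.E
  fun_prop

end IsSolution

/-! ### The multipliers -/

namespace Triple

variable (a : Coeffs) (g : ℝ → ℝ) (X : Triple H) (t : ℝ)

/-- The multiplier that dissipates `ψ_t` through the memory. -/
def I₁ : ℝ := -a.ρ₂ * ⟪X.ψ.ut t, relax g X.ψ.u t⟫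

/-- The multiplier that dissipates `ψ_x`. -/
def I₂ : ℝ := a.ρ₂ * ⟪X.ψ.ut t, X.ψ.u t⟫

/-- The multiplier that dissipates the shear `A`. -/
def I₃ : ℝ := a.ρ₂ * ⟪X.ψ.ut t, X.A a t⟫ + a.ρ₁ / a.k₁ * ⟪X.M a g t, X.φ.ut t⟫

/-- The multiplier that dissipates the axial strain `B` and `w_t`, at the cost of `φ_t`. -/
def I₄ : ℝ := -a.ρ₁ * (⟪X.φ.ut t, X.B a t⟫ + ⟪X.w.ut t, X.A a t⟫)

/-- The multiplier that dissipates `φ_t`. -/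
def I₅ : ℝ := -a.ρ₁ * ⟪X.φ.ut t, X.φ.u t⟫

end Triple

namespace IsSolution

variable {S : DerivSystem H} {a : Coeffs} {g k : ℝ → ℝ} {X : Triple H}
variable (hX : IsSolution S a g 0 X) (hg : IsRelaxation g k)
include hX

omit [CompleteSpace H] in
theorem inner_ψ' {t : ℝ} (ht : 0 < t) (z : H) :
    a.ρ₂ * ⟪X.ψ.utt t, z⟫ = ⟪X.Mx a g t, z⟫ - a.k₁ * ⟪X.A a t, z⟫ := by
  simpa using hX.inner_ψ ht z

include hg in
/-- The derivative of `relax g ψ` contains `(∫₀ᵗ g) ψ_t`, which produces the term in `‖ψ_t‖²`. -/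
theorem hasDerivAt_I₁ {t : ℝ} (ht : 0 < t) :
    HasDerivAt (X.I₁ a g) (⟪X.M a g t, relax g X.ψ.ux t⟫ + a.k₁ * ⟪X.A a t, relax g X.ψ.u t⟫
      - a.ρ₂ * (∫ s in (0 : ℝ)..t, g s) * ‖X.ψ.ut t‖ ^ 2
      + a.ρ₂ * ⟪X.ψ.ut t, relax k X.ψ.u t⟫) t := by
  have h := ((hX.ψ.hasDerivAt_ut t).inner ℝ
    (hg.hasDerivAt_relax hX.ψ.hasDerivAt_u hX.ψ.cont_ut ht)).const_mul (-a.ρ₂)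
  refine h.congr_deriv ?_
  have e := hX.inner_ψ' ht (relax g X.ψ.u t)
  rw [hX.inner_Mx_relax hg ht.le] at e
  rw [inner_sub_right, real_inner_smul_right, real_inner_self_eq_norm_sq]
  linear_combination -e

include hg in
theorem hasDerivAt_I₂ {t : ℝ} (ht : 0 < t) :
    HasDerivAt (X.I₂ a) (a.ρ₂ * ‖X.ψ.ut t‖ ^ 2 - ⟪X.M a g t, X.ψ.ux t⟫
      - a.k₁ * ⟪X.A a t, X.ψ.u t⟫) t := by
  have h := ((hX.ψ.hasDerivAt_ut t).inner ℝ (hX.ψ.hasDerivAt_u t)).const_mul a.ρ₂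
  refine h.congr_deriv ?_
  have e := hX.inner_ψ' ht (X.ψ.u t)
  have p := hX.inner_Mx_add hg ht.le (S.H1s_le (hX.ψ.mem_u t ht.le))
  rw [real_inner_self_eq_norm_sq]
  linear_combination e + p

include hg in
/-- The derivative of `I₃` holds the only term, `⟪ψ_xt, φ_t⟫`, that the first order energy does not
control; its coefficient vanishes when the wave speeds agree. -/
theorem hasDerivAt_I₃ {t : ℝ} (ht : 0 < t) :
    HasDerivAt (X.I₃ a g) (-a.k₁ * ‖X.A a t‖ ^ 2
      + (a.ρ₁ / a.k₁ * a.k₂ - a.ρ₂) * ⟪X.ψ.uxt t, X.φ.ut t⟫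
      - a.ρ₁ / a.k₁ * ⟪g t • X.ψ.ux t + relax k X.ψ.ux t, X.φ.ut t⟫
      + a.l * ⟪X.M a g t, X.B a t⟫ + a.ρ₂ * ‖X.ψ.ut t‖ ^ 2
      + a.l * a.ρ₂ * ⟪X.ψ.ut t, X.w.ut t⟫) t := by
  have h := (((hX.ψ.hasDerivAt_ut t).inner ℝ (hX.hasDerivAt_A t)).const_mul a.ρ₂).add
    (((hX.hasDerivAt_M hg ht).inner ℝ (hX.φ.hasDerivAt_ut t)).const_mul (a.ρ₁ / a.k₁))
  refine h.congr_deriv ?_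
  have e := hX.inner_ψ' ht (X.A a t)
  have p := hX.inner_Mx_add hg ht.le (hX.mem_A ht.le)
  have e2 := hX.inner_φ ht (X.M a g t)
  have p2 := S.parts _ (S.H1s_le (hX.ψ.mem_ut t ht.le)) _ (hX.φ.mem_ut t ht.le)
  have eA : ⟪X.ψ.ut t, X.At a t⟫ = ⟪X.ψ.ut t, X.φ.uxt t⟫ + ‖X.ψ.ut t‖ ^ 2
      + a.l * ⟪X.ψ.ut t, X.w.ut t⟫ := by
    simp only [Triple.At, inner_add_right, real_inner_smul_right, real_inner_self_eq_norm_sq]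
  have hk := a.k₁_pos.ne'
  rw [real_inner_self_eq_norm_sq] at e
  rw [real_inner_comm, real_inner_comm (X.M a g t) (X.Ax a t),
    real_inner_comm (X.M a g t) (X.B a t)] at e2
  simp only at p p2
  rw [eA]
  simp only [inner_sub_left, inner_add_left, real_inner_smul_left]
  have e3 : a.ρ₁ / a.k₁ * ⟪X.M a g t, X.φ.utt t⟫ =
      ⟪X.M a g t, X.Ax a t⟫ + a.l * ⟪X.M a g t, X.B a t⟫ := by
    field_simp
    linear_combination e2
  linear_combination e + p + e3 + a.ρ₂ * p2

omit [CompleteSpace H] in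
/-- The cross terms `⟪A_x, B⟫` and `⟪A, B_x⟫` cancel because `k₃ = k₁`. -/
theorem hasDerivAt_I₄ {t : ℝ} (ht : 0 < t) :
    HasDerivAt (X.I₄ a) (-a.l * a.k₁ * ‖X.B a t‖ ^ 2 + a.l * a.k₁ * ‖X.A a t‖ ^ 2
      + a.l * a.ρ₁ * ‖X.φ.ut t‖ ^ 2 - a.l * a.ρ₁ * ‖X.w.ut t‖ ^ 2
      - a.ρ₁ * ⟪X.w.ut t, X.ψ.ut t⟫) t := by
  have h := (((hX.φ.hasDerivAt_ut t).inner ℝ (hX.hasDerivAt_B t)).add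
    ((hX.w.hasDerivAt_ut t).inner ℝ (hX.hasDerivAt_A t))).const_mul (-a.ρ₁)
  refine h.congr_deriv ?_
  have e1 := hX.inner_φ ht (X.B a t)
  have e2 := hX.inner_w ht (X.A a t)
  have p1 := S.parts _ (hX.mem_A ht.le) _ (hX.mem_B ht.le)
  have p2 := S.parts _ (S.H1s_le (hX.w.mem_ut t ht.le)) _ (hX.φ.mem_ut t ht.le)
  have eA : ⟪X.w.ut t, X.At a t⟫ = ⟪X.w.ut t, X.φ.uxt t⟫ + ⟪X.w.ut t, X.ψ.ut t⟫
      + a.l * ‖X.w.ut t‖ ^ 2 := by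
    simp only [Triple.At, inner_add_right, real_inner_smul_right, real_inner_self_eq_norm_sq]
  have eB : ⟪X.φ.ut t, X.Bt a t⟫ = ⟪X.φ.ut t, X.w.uxt t⟫ - a.l * ‖X.φ.ut t‖ ^ 2 := by
    simp only [Triple.Bt, inner_sub_right, real_inner_smul_right, real_inner_self_eq_norm_sq]
  simp only at p1 p2
  rw [real_inner_self_eq_norm_sq] at e1 e2
  rw [real_inner_comm] at p2
  rw [eA, eB]
  rw [real_inner_comm (X.Bx a t) (X.A a t)] at p1
  linear_combination -e1 - e2 - a.k₁ * p1 - a.ρ₁ * p2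

omit [CompleteSpace H] in
theorem hasDerivAt_I₅ {t : ℝ} (ht : 0 < t) :
    HasDerivAt (X.I₅ a) (-a.ρ₁ * ‖X.φ.ut t‖ ^ 2 + a.k₁ * ⟪X.A a t, X.φ.ux t⟫
      - a.l * a.k₁ * ⟪X.B a t, X.φ.u t⟫) t := by
  have h := ((hX.φ.hasDerivAt_ut t).inner ℝ (hX.φ.hasDerivAt_u t)).const_mul (-a.ρ₁)
  refine h.congr_deriv ?_
  have e := hX.inner_φ ht (X.φ.u t)
  have p := S.parts _ (hX.mem_A ht.le) _ (hX.φ.mem_u t ht.le)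
  simp only at p
  rw [real_inner_self_eq_norm_sq]
  linear_combination -e - a.k₁ * p

end IsSolution

/-! ### The Lyapunov functional -/

omit [CompleteSpace H] in
theorem abs_inner_le_young (u v : H) {δ : ℝ} (hδ : 0 < δ) :
    |⟪u, v⟫| ≤ δ * ‖u‖ ^ 2 + 1 / (4 * δ) * ‖v‖ ^ 2 := by
  refine (abs_real_inner_le_norm u v).trans ?_
  have h : δ * ‖u‖ ^ 2 + 1 / (4 * δ) * ‖v‖ ^ 2 - ‖u‖ * ‖v‖ = δ * (‖u‖ - ‖v‖ / (2 * δ)) ^ 2 := by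
    field_simp; ring
  have : 0 ≤ δ * (‖u‖ - ‖v‖ / (2 * δ)) ^ 2 := by positivity
  linarith

omit [CompleteSpace H] in
theorem abs_inner_le_half (u v : H) : |⟪u, v⟫| ≤ ‖u‖ ^ 2 + ‖v‖ ^ 2 := by
  have := abs_inner_le_young u v one_pos
  nlinarith [sq_nonneg ‖v‖]

omit [InnerProductSpace ℝ H] [CompleteSpace H] in
theorem norm_add_sq_le_two (u v : H) : ‖u + v‖ ^ 2 ≤ 2 * ‖u‖ ^ 2 + 2 * ‖v‖ ^ 2 := by
  have := norm_add_le u v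
  nlinarith [norm_nonneg (u + v), norm_nonneg u, norm_nonneg v, sq_nonneg (‖u‖ - ‖v‖)]

/-- The weight of the multiplier `I₃`. The first summand compensates the term in `‖A‖²` produced by
`I₂`, the number `28` exceeds the total `27` of those produced by `I₄` and `2 l I₅`. -/
def Coeffs.N₃ (a : Coeffs) (c κ : ℝ) : ℝ := a.k₁ * c ^ 2 / κ + 28

/-- The smallness of `l` needed for the Lyapunov functional: the last two conditions keep the
coefficients of `‖B‖²` and `‖ψ_x‖²` in its derivative negative. -/
structure Coeffs.IsSmall (a : Coeffs) (c κ : ℝ) : Prop where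
  le_one : a.l ≤ 1
  sq_le : 70 * c ^ 2 * a.l ^ 2 ≤ 1
  mul_le : a.l * (4 * a.N₃ c κ ^ 2 * a.k₂ ^ 2 / a.k₁ + 24 * a.k₁ * c ^ 2) ≤ κ / 4

namespace Triple

variable (a : Coeffs) (g k : ℝ → ℝ) (X : Triple H) (t : ℝ)

/-- The quadratic part of the energy, without coefficients. -/
def Q : ℝ := ‖X.A a t‖ ^ 2 + ‖X.B a t‖ ^ 2 + ‖X.ψ.ux t‖ ^ 2 + ‖X.ψ.ut t‖ ^ 2 + ‖X.φ.ut t‖ ^ 2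
  + ‖X.w.ut t‖ ^ 2

/-- The terms with memory or with `ψ_xt`, which the multipliers do not dissipate. -/
def R : ℝ := quad g X.ψ.ux t + quad k X.ψ.ux t + g t * ‖X.ψ.ux t‖ ^ 2 + ‖X.ψ.uxt t‖ ^ 2

end Triple

namespace IsSolution

variable {S : DerivSystem H} {a : Coeffs} {g k : ℝ → ℝ} {f : ℝ → H} {X : Triple H} {κ : ℝ}

section Bounds

variable (hX : IsSolution S a g f X)
include hX

section
variable (hg : IsRelaxation g k)
include hg

omit [CompleteSpace H] in
theorem norm_relax_ux_sq_le (hκ : 0 < κ) (hκg : κ + ∫ s in Ioi (0 : ℝ), g s ≤ a.k₂) {t : ℝ}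
    (ht : 0 ≤ t) : ‖relax g X.ψ.ux t‖ ^ 2 ≤ a.k₂ * quad g X.ψ.ux t := by
  refine (hg.weight.norm_relax_sq_le ht hX.ψ.cont_ux).trans ?_
  have := hg.integral_le ht
  exact mul_le_mul_of_nonneg_right (by linarith) (hg.weight.quad_nonneg ht _)

omit [CompleteSpace H] in
theorem norm_relax_u_sq_le (hκ : 0 < κ) (hκg : κ + ∫ s in Ioi (0 : ℝ), g s ≤ a.k₂) {t : ℝ}
    (ht : 0 ≤ t) : ‖relax g X.ψ.u t‖ ^ 2 ≤ a.k₂ * S.c ^ 2 * quad g X.ψ.ux t := by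
  refine (hg.weight.norm_relax_sq_le ht hX.ψ.cont_u).trans ?_
  have h1 := hg.integral_le ht
  have h2 := hg.weight.quad_le_of_norm_le ht hX.ψ.cont_u hX.ψ.cont_ux (c := S.c)
    fun s hs _ => S.poincares _ (S.H1s.sub_mem (hX.ψ.mem_u t ht) (hX.ψ.mem_u s hs))
  rw [mul_assoc]
  exact mul_le_mul (by linarith) h2 (hg.weight.quad_nonneg ht _) a.k₂_pos.le

omit [CompleteSpace H] in
theorem norm_relax_dissipation_sq_le {t : ℝ} (ht : 0 ≤ t) :
    ‖relax k X.ψ.ux t‖ ^ 2 ≤ g 0 * quad k X.ψ.ux t :=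
  (hg.weight_dissipation.norm_relax_sq_le ht hX.ψ.cont_ux).trans
    (mul_le_mul_of_nonneg_right (hg.integral_dissipation_le ht)
      (hg.weight_dissipation.quad_nonneg ht _))

omit [CompleteSpace H] in
theorem norm_relax_dissipation_u_sq_le {t : ℝ} (ht : 0 ≤ t) :
    ‖relax k X.ψ.u t‖ ^ 2 ≤ g 0 * S.c ^ 2 * quad k X.ψ.ux t := by
  have hk := hg.weight_dissipation
  refine (hk.norm_relax_sq_le ht hX.ψ.cont_u).trans ?_
  have h2 := hk.quad_le_of_norm_le ht hX.ψ.cont_u hX.ψ.cont_ux (c := S.c)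
    fun s hs _ => S.poincares _ (S.H1s.sub_mem (hX.ψ.mem_u t ht) (hX.ψ.mem_u s hs))
  rw [mul_assoc]
  exact mul_le_mul (hg.integral_dissipation_le ht) h2 (hk.quad_nonneg ht _) hg.pos_zero.le

theorem norm_M_sq_le (hκ : 0 < κ) (hκg : κ + ∫ s in Ioi (0 : ℝ), g s ≤ a.k₂) {t : ℝ}
    (ht : 0 ≤ t) :
    ‖X.M a g t‖ ^ 2 ≤ 2 * a.k₂ ^ 2 * ‖X.ψ.ux t‖ ^ 2 + 2 * a.k₂ * quad g X.ψ.ux t := by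
  rw [hX.M_eq hg]
  refine (norm_add_sq_le_two _ _).trans ?_
  have h1 := hX.norm_relax_ux_sq_le hg hκ hκg ht
  have h2 := hg.integral_le ht
  have h3 := hg.weight.integral_nonneg ht
  rw [norm_smul, mul_pow, Real.norm_eq_abs, sq_abs]
  have h4 : (a.k₂ - ∫ s in (0 : ℝ)..t, g s) ^ 2 ≤ a.k₂ ^ 2 :=
    pow_le_pow_left₀ (by linarith) (by linarith) 2
  nlinarith [mul_le_mul_of_nonneg_right h4 (sq_nonneg ‖X.ψ.ux t‖)]

end

omit [CompleteSpace H] in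
/-- For small `l` the two strains and `ψ_x` control `φ_x`. -/
theorem norm_φ_ux_sq_le (ha : a.IsSmall S.c κ) {t : ℝ} (ht : 0 ≤ t) :
    ‖X.φ.ux t‖ ^ 2 ≤ 12 * (‖X.A a t‖ ^ 2 + S.c ^ 2 * ‖X.ψ.ux t‖ ^ 2
      + a.l ^ 2 * S.c ^ 2 * ‖X.B a t‖ ^ 2) := by
  have hl := a.l_pos
  have hc := S.c_pos
  have p1 : ‖X.φ.u t‖ ≤ S.c * ‖X.φ.ux t‖ := S.poincare10 _ (hX.φ.mem_u t ht)
  have p2 : ‖X.ψ.u t‖ ≤ S.c * ‖X.ψ.ux t‖ := S.poincares _ (hX.ψ.mem_u t ht)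
  have p3 : ‖X.w.u t‖ ≤ S.c * ‖X.w.ux t‖ := S.poincares _ (hX.w.mem_u t ht)
  have e1 : X.φ.ux t = X.A a t - X.ψ.u t - a.l • X.w.u t := by simp only [Triple.A]; abel
  have e2 : X.w.ux t = X.B a t + a.l • X.φ.u t := by simp only [Triple.B]; abel
  have n1 : ‖X.φ.ux t‖ ≤ ‖X.A a t‖ + ‖X.ψ.u t‖ + a.l * ‖X.w.u t‖ := by
    conv_lhs => rw [e1]
    refine (norm_sub_le _ _).trans ?_
    rw [norm_smul, Real.norm_of_nonneg hl.le]
    gcongr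
    exact norm_sub_le _ _
  have n2 : ‖X.w.ux t‖ ≤ ‖X.B a t‖ + a.l * ‖X.φ.u t‖ := by
    conv_lhs => rw [e2]
    refine (norm_add_le _ _).trans ?_
    rw [norm_smul, Real.norm_of_nonneg hl.le]
  have hs := ha.sq_le
  set F := ‖X.φ.ux t‖
  have hF : 0 ≤ F := norm_nonneg _
  have n3 : F ≤ ‖X.A a t‖ + S.c * ‖X.ψ.ux t‖ + a.l * (S.c * (‖X.B a t‖ + a.l * (S.c * F))) := by
    calc F ≤ _ := n1
      _ ≤ ‖X.A a t‖ + S.c * ‖X.ψ.ux t‖ + a.l * (S.c * ‖X.w.ux t‖) := by gcongr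
      _ ≤ _ := by
        gcongr
        exact n2.trans (by gcongr)
  have n4 : a.l * (S.c * (a.l * (S.c * F))) ≤ F / 2 := by
    have : a.l * (S.c * (a.l * (S.c * F))) = (S.c ^ 2 * a.l ^ 2) * F := by ring
    rw [this]
    nlinarith
  have n5 : F ≤ 2 * (‖X.A a t‖ + S.c * ‖X.ψ.ux t‖ + a.l * S.c * ‖X.B a t‖) := by linarith
  have n6 := pow_le_pow_left₀ hF n5 2
  refine n6.trans ?_
  nlinarith [sq_nonneg (‖X.A a t‖ - S.c * ‖X.ψ.ux t‖), sq_nonneg (‖X.A a t‖ - a.l * S.c * ‖X.B a t‖),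
    sq_nonneg (S.c * ‖X.ψ.ux t‖ - a.l * S.c * ‖X.B a t‖)]

end Bounds

/-- The derivative of `I₂`: its main term `⟪M, ψ_x⟫` is at least `κ ‖ψ_x‖²` up to the memory. -/
theorem deriv_I₂_bound (hX : IsSolution S a g f X) (hg : IsRelaxation g k) (hκ : 0 < κ)
    (hκg : κ + ∫ s in Ioi (0 : ℝ), g s ≤ a.k₂) {t : ℝ} (ht : 0 < t) :
    a.ρ₂ * ‖X.ψ.ut t‖ ^ 2 - ⟪X.M a g t, X.ψ.ux t⟫ - a.k₁ * ⟪X.A a t, X.ψ.u t⟫ ≤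
      a.ρ₂ * ‖X.ψ.ut t‖ ^ 2 - κ / 2 * ‖X.ψ.ux t‖ ^ 2 + a.k₁ ^ 2 * S.c ^ 2 / κ * ‖X.A a t‖ ^ 2
        + a.k₂ / κ * quad g X.ψ.ux t := by
  have hl := a.l_pos
  have hk1 := a.k₁_pos
  have hk2 := a.k₂_pos
  have hr1 := a.ρ₁_pos
  have hr2 := a.ρ₂_pos
  have hc := S.c_pos
  have e : ⟪X.M a g t, X.ψ.ux t⟫ = (a.k₂ - ∫ s in (0 : ℝ)..t, g s) * ‖X.ψ.ux t‖ ^ 2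
      + ⟪X.ψ.ux t, relax g X.ψ.ux t⟫ := by
    rw [hX.M_eq hg, inner_add_left, real_inner_smul_left, real_inner_self_eq_norm_sq,
      real_inner_comm (X.ψ.ux t) (relax g X.ψ.ux t)]
  have y1 := (abs_le.1 (abs_inner_le_young (X.ψ.ux t) (relax g X.ψ.ux t)
    (δ := κ / 4) (by positivity))).1
  have y2 := (abs_le.1 (abs_inner_le_young (X.ψ.u t) (X.A a t)
    (δ := κ / (4 * a.k₁ * S.c ^ 2)) (by positivity))).1
  have p2 : ‖X.ψ.u t‖ ≤ S.c * ‖X.ψ.ux t‖ := S.poincares _ (hX.ψ.mem_u t ht.le)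
  have p3 := pow_le_pow_left₀ (norm_nonneg _) p2 2
  have h1 := hX.norm_relax_ux_sq_le hg hκ hκg ht.le
  have h2 := hg.integral_le ht.le
  have q1 : 1 / (4 * (κ / 4)) * ‖relax g X.ψ.ux t‖ ^ 2 ≤ a.k₂ / κ * quad g X.ψ.ux t := by
    calc 1 / (4 * (κ / 4)) * ‖relax g X.ψ.ux t‖ ^ 2
        ≤ 1 / (4 * (κ / 4)) * (a.k₂ * quad g X.ψ.ux t) := by gcongr
      _ = _ := by field_simp
  have q2 : a.k₁ * (κ / (4 * a.k₁ * S.c ^ 2) * ‖X.ψ.u t‖ ^ 2) ≤ κ / 4 * ‖X.ψ.ux t‖ ^ 2 := by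
    calc a.k₁ * (κ / (4 * a.k₁ * S.c ^ 2) * ‖X.ψ.u t‖ ^ 2)
        ≤ a.k₁ * (κ / (4 * a.k₁ * S.c ^ 2) * (S.c * ‖X.ψ.ux t‖) ^ 2) := by gcongr
      _ = _ := by field_simp
  have q3 : a.k₁ * (1 / (4 * (κ / (4 * a.k₁ * S.c ^ 2))) * ‖X.A a t‖ ^ 2) =
      a.k₁ ^ 2 * S.c ^ 2 / κ * ‖X.A a t‖ ^ 2 := by field_simp
  have q4 := mul_le_mul_of_nonneg_left y2 hk1.le
  have q5 : κ * ‖X.ψ.ux t‖ ^ 2 ≤ (a.k₂ - ∫ s in (0 : ℝ)..t, g s) * ‖X.ψ.ux t‖ ^ 2 :=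
    mul_le_mul_of_nonneg_right (by linarith) (sq_nonneg _)
  rw [e, real_inner_comm (X.ψ.u t) (X.A a t)]
  nlinarith [q1, q2, q3, q4, q5]

omit [CompleteSpace H] in
/-- Young's inequality for the term of `I₃'` with the difference `θ` of the wave speeds; the part in
`‖φ_t‖²` is a quarter of what `I₄` and `2 l I₅` provide. -/
theorem N₃_inner_uxt_le (X : Triple H) (N θ t : ℝ) :
    N * (θ * ⟪X.ψ.uxt t, X.φ.ut t⟫) ≤ a.l * a.ρ₁ / 4 * ‖X.φ.ut t‖ ^ 2
      + (N ^ 2 / (a.l * a.ρ₁) * θ ^ 2) * ‖X.ψ.uxt t‖ ^ 2 := by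
  have hl := a.l_pos
  have hk1 := a.k₁_pos
  have hk2 := a.k₂_pos
  have hr1 := a.ρ₁_pos
  have hr2 := a.ρ₂_pos
  have y := (abs_le.1 (abs_inner_le_young (X.φ.ut t) ((N * θ) • X.ψ.uxt t)
    (δ := a.l * a.ρ₁ / 4) (by positivity))).2
  rw [real_inner_smul_right, norm_smul, mul_pow, Real.norm_eq_abs, sq_abs] at y
  rw [real_inner_comm (X.φ.ut t) (X.ψ.uxt t), ← mul_assoc]
  refine y.trans (le_of_eq ?_)
  field_simp

omit [CompleteSpace H] in
theorem N₃_inner_relax_le (hX : IsSolution S a g f X) (hg : IsRelaxation g k) (N : ℝ) {t : ℝ} (ht : 0 < t) :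
    -(N * (a.ρ₁ / a.k₁ * ⟪g t • X.ψ.ux t + relax k X.ψ.ux t, X.φ.ut t⟫)) ≤
      a.l * a.ρ₁ / 4 * ‖X.φ.ut t‖ ^ 2 + (N ^ 2 / (a.l * a.ρ₁) * (a.ρ₁ / a.k₁) ^ 2 * (2 * g 0)) * (g t * ‖X.ψ.ux t‖ ^ 2 + quad k X.ψ.ux t) := by
  have hl := a.l_pos
  have hk1 := a.k₁_pos
  have hk2 := a.k₂_pos
  have hr1 := a.ρ₁_pos
  have hr2 := a.ρ₂_pos
  have hg0 := hg.pos_zero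
  have hgt := hg.nonneg t
  have hgt0 : g t ≤ g 0 := hg.antitone ht.le
  have hd0 := hg.weight_dissipation.quad_nonneg ht.le X.ψ.ux
  have y := (abs_le.1 (abs_inner_le_young (X.φ.ut t)
    ((-(N * (a.ρ₁ / a.k₁))) • (g t • X.ψ.ux t + relax k X.ψ.ux t))
    (δ := a.l * a.ρ₁ / 4) (by positivity))).2
  rw [real_inner_smul_right, norm_smul, mul_pow, Real.norm_eq_abs, sq_abs] at y
  rw [real_inner_comm (X.φ.ut t), ← mul_assoc, ← neg_mul]
  refine y.trans ?_
  have n1 := norm_add_sq_le_two (g t • X.ψ.ux t) (relax k X.ψ.ux t)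
  have n2 := hX.norm_relax_dissipation_sq_le hg ht.le
  rw [norm_smul, mul_pow, Real.norm_eq_abs, sq_abs] at n1
  have n3 : g t ^ 2 * ‖X.ψ.ux t‖ ^ 2 ≤ g 0 * (g t * ‖X.ψ.ux t‖ ^ 2) := by
    nlinarith [mul_le_mul_of_nonneg_right hgt0 (mul_nonneg hgt (sq_nonneg ‖X.ψ.ux t‖))]
  have n4 : ‖g t • X.ψ.ux t + relax k X.ψ.ux t‖ ^ 2 ≤
      2 * g 0 * (g t * ‖X.ψ.ux t‖ ^ 2 + quad k X.ψ.ux t) := by linarith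
  have n5 : 1 / (4 * (a.l * a.ρ₁ / 4)) * ((-(N * (a.ρ₁ / a.k₁))) ^ 2
      * ‖g t • X.ψ.ux t + relax k X.ψ.ux t‖ ^ 2) ≤
      1 / (4 * (a.l * a.ρ₁ / 4)) * ((-(N * (a.ρ₁ / a.k₁))) ^ 2
      * (2 * g 0 * (g t * ‖X.ψ.ux t‖ ^ 2 + quad k X.ψ.ux t))) := by gcongr
  have n6 : 1 / (4 * (a.l * a.ρ₁ / 4)) * ((-(N * (a.ρ₁ / a.k₁))) ^ 2
      * (2 * g 0 * (g t * ‖X.ψ.ux t‖ ^ 2 + quad k X.ψ.ux t))) =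
      (N ^ 2 / (a.l * a.ρ₁) * (a.ρ₁ / a.k₁) ^ 2 * (2 * g 0)) * (g t * ‖X.ψ.ux t‖ ^ 2 + quad k X.ψ.ux t) := by
    field_simp
  linarith

theorem N₃_inner_M_le (hX : IsSolution S a g f X) (hg : IsRelaxation g k) (hκ : 0 < κ)
    (hκg : κ + ∫ s in Ioi (0 : ℝ), g s ≤ a.k₂) (N : ℝ) {t : ℝ} (ht : 0 < t) :
    N * (a.l * ⟪X.M a g t, X.B a t⟫) ≤ a.l * a.k₁ / 8 * ‖X.B a t‖ ^ 2
      + a.l * (4 * N ^ 2 * a.k₂ ^ 2 / a.k₁) * ‖X.ψ.ux t‖ ^ 2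
      + 4 * a.l * N ^ 2 * a.k₂ / a.k₁ * quad g X.ψ.ux t := by
  have hl := a.l_pos
  have hk1 := a.k₁_pos
  have hk2 := a.k₂_pos
  have hr1 := a.ρ₁_pos
  have hr2 := a.ρ₂_pos
  have hc := S.c_pos
  have y := (abs_le.1 (abs_inner_le_young (X.B a t) ((N * a.l) • X.M a g t)
    (δ := a.l * a.k₁ / 8) (by positivity))).2
  rw [real_inner_smul_right, norm_smul, mul_pow, Real.norm_eq_abs, sq_abs] at y
  rw [real_inner_comm (X.B a t) (X.M a g t), ← mul_assoc]
  refine y.trans ?_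
  have n1 := hX.norm_M_sq_le hg hκ hκg ht.le
  have n5 : 1 / (4 * (a.l * a.k₁ / 8)) * ((N * a.l) ^ 2 * ‖X.M a g t‖ ^ 2) ≤
      1 / (4 * (a.l * a.k₁ / 8)) * ((N * a.l) ^ 2 *
        (2 * a.k₂ ^ 2 * ‖X.ψ.ux t‖ ^ 2 + 2 * a.k₂ * quad g X.ψ.ux t)) := by gcongr
  have n6 : 1 / (4 * (a.l * a.k₁ / 8)) * ((N * a.l) ^ 2 *
        (2 * a.k₂ ^ 2 * ‖X.ψ.ux t‖ ^ 2 + 2 * a.k₂ * quad g X.ψ.ux t)) =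
      a.l * (4 * N ^ 2 * a.k₂ ^ 2 / a.k₁) * ‖X.ψ.ux t‖ ^ 2
    + 4 * a.l * N ^ 2 * a.k₂ / a.k₁ * quad g X.ψ.ux t := by field_simp; ring
  linarith

omit [CompleteSpace H] in
theorem N₃_inner_ψ_w_le (X : Triple H) (N t : ℝ) :
    N * (a.l * a.ρ₂ * ⟪X.ψ.ut t, X.w.ut t⟫) ≤ a.l * a.ρ₁ / 8 * ‖X.w.ut t‖ ^ 2
      + 2 * a.l * N ^ 2 * a.ρ₂ ^ 2 / a.ρ₁ * ‖X.ψ.ut t‖ ^ 2 := by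
  have hl := a.l_pos
  have hk1 := a.k₁_pos
  have hk2 := a.k₂_pos
  have hr1 := a.ρ₁_pos
  have hr2 := a.ρ₂_pos
  have y := (abs_le.1 (abs_inner_le_young (X.w.ut t) ((N * (a.l * a.ρ₂)) • X.ψ.ut t)
    (δ := a.l * a.ρ₁ / 8) (by positivity))).2
  rw [real_inner_smul_right, norm_smul, mul_pow, Real.norm_eq_abs, sq_abs] at y
  rw [real_inner_comm (X.w.ut t) (X.ψ.ut t), ← mul_assoc]
  refine y.trans (le_of_eq ?_)
  field_simp
  ring

omit [CompleteSpace H] in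
theorem deriv_I₄_bound (X : Triple H) (t : ℝ) :
    -(a.ρ₁ * ⟪X.w.ut t, X.ψ.ut t⟫) ≤ a.l * a.ρ₁ / 2 * ‖X.w.ut t‖ ^ 2
      + a.ρ₁ / (2 * a.l) * ‖X.ψ.ut t‖ ^ 2 := by
  have hl := a.l_pos
  have hk1 := a.k₁_pos
  have hk2 := a.k₂_pos
  have hr1 := a.ρ₁_pos
  have hr2 := a.ρ₂_pos
  have y := (abs_le.1 (abs_inner_le_young (X.w.ut t) (X.ψ.ut t)
    (δ := a.l / 2) (by positivity))).1
  have y2 := mul_le_mul_of_nonneg_left y hr1.le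
  have e : a.ρ₁ * (1 / (4 * (a.l / 2)) * ‖X.ψ.ut t‖ ^ 2) =
    a.ρ₁ / (2 * a.l) * ‖X.ψ.ut t‖ ^ 2 := by field_simp; ring
  linarith

omit [CompleteSpace H] in
theorem deriv_I₅_bound (hX : IsSolution S a g f X) (ha : a.IsSmall S.c κ) {t : ℝ} (ht : 0 < t) :
    a.k₁ * ⟪X.A a t, X.φ.ux t⟫ - a.l * a.k₁ * ⟪X.B a t, X.φ.u t⟫ ≤
      13 * a.k₁ * ‖X.A a t‖ ^ 2 + 12 * a.k₁ * S.c ^ 2 * ‖X.ψ.ux t‖ ^ 2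
        + 13 * a.k₁ * S.c ^ 2 * a.l ^ 2 * ‖X.B a t‖ ^ 2 := by
  have hl := a.l_pos
  have hk1 := a.k₁_pos
  have hk2 := a.k₂_pos
  have hr1 := a.ρ₁_pos
  have hr2 := a.ρ₂_pos
  have hc := S.c_pos
  have y1 := (abs_le.1 (abs_inner_le_young (X.A a t) (X.φ.ux t)
    (δ := 1 / 2) (by positivity))).2
  have y2 := (abs_le.1 (abs_inner_le_young (X.B a t) (X.φ.u t)
    (δ := S.c ^ 2 * a.l / 2) (by positivity))).1
  have p1 : ‖X.φ.u t‖ ≤ S.c * ‖X.φ.ux t‖ := S.poincare10 _ (hX.φ.mem_u t ht.le)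
  have p3 := pow_le_pow_left₀ (norm_nonneg _) p1 2
  have q : a.l * a.k₁ * (1 / (4 * (S.c ^ 2 * a.l / 2)) * ‖X.φ.u t‖ ^ 2) ≤
      a.k₁ / 2 * ‖X.φ.ux t‖ ^ 2 := by
    calc a.l * a.k₁ * (1 / (4 * (S.c ^ 2 * a.l / 2)) * ‖X.φ.u t‖ ^ 2)
        ≤ a.l * a.k₁ * (1 / (4 * (S.c ^ 2 * a.l / 2)) * (S.c * ‖X.φ.ux t‖) ^ 2) := by gcongr
      _ = _ := by field_simp; ring
  have n := hX.norm_φ_ux_sq_le ha ht.le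
  have z1 := mul_le_mul_of_nonneg_left y1 hk1.le
  have z2 := mul_le_mul_of_nonneg_left y2 (mul_pos hl hk1).le
  have z3 := mul_le_mul_of_nonneg_left n hk1.le
  have z4 : 0 ≤ a.k₁ * S.c ^ 2 * a.l ^ 2 * ‖X.B a t‖ ^ 2 := by positivity
  have z5 : 0 ≤ a.k₁ * ‖X.A a t‖ ^ 2 := by positivity
  linarith

/-- Everything but `ψ_t` is dissipated by `I₂ + N₃ I₃ + I₄ + 2 l I₅`. -/
theorem exists_deriv_J_le (hg : IsRelaxation g k) (hκ : 0 < κ)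
    (hκg : κ + ∫ s in Ioi (0 : ℝ), g s ≤ a.k₂) (ha : a.IsSmall S.c κ) :
    ∃ β > 0, ∃ C ≥ 0, ∀ X, IsSolution S a g 0 X → ∀ t, 0 < t → ∃ d,
      HasDerivAt (fun t => X.I₂ a t + a.N₃ S.c κ * X.I₃ a g t + X.I₄ a t + 2 * a.l * X.I₅ a t) d t ∧
        d ≤ -β * X.Q a t + C * (‖X.ψ.ut t‖ ^ 2 + X.R g k t) := by
  have hl := a.l_pos
  have hk1 := a.k₁_pos
  have hk2 := a.k₂_pos
  have hr1 := a.ρ₁_pos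
  have hr2 := a.ρ₂_pos
  have hc := S.c_pos
  have hg0 := hg.pos_zero
  set N := a.N₃ S.c κ with hN
  have hNpos : 0 < N := by rw [hN, Coeffs.N₃]; positivity
  set β := min (min a.k₁ (κ / 4)) (min (a.l * a.k₁ / 2) (min (a.l * a.ρ₁ / 2)
    (a.l * a.ρ₁ * (3 / 8)))) with hβ
  have hβpos : 0 < β := by rw [hβ]; positivity
  set θ := a.ρ₁ / a.k₁ * a.k₂ - a.ρ₂ with hθ
  set Cy := a.ρ₂ + N * a.ρ₂ + 2 * a.l * N ^ 2 * a.ρ₂ ^ 2 / a.ρ₁ + a.ρ₁ / (2 * a.l) + β with hCy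
  set Cm := a.k₂ / κ + 4 * a.l * N ^ 2 * a.k₂ / a.k₁ with hCm
  set Cd := N ^ 2 / (a.l * a.ρ₁) * (a.ρ₁ / a.k₁) ^ 2 * (2 * g 0) with hCd
  set Cq := N ^ 2 / (a.l * a.ρ₁) * θ ^ 2 with hCq
  have hCy0 : 0 < Cy := by positivity
  have hCm0 : 0 < Cm := by positivity
  have hCd0 : 0 < Cd := by positivity
  have hCq0 : 0 ≤ Cq := by positivity
  refine ⟨β, hβpos, Cy + Cm + Cd + Cq, by positivity, fun X hX t ht => ⟨_,
    (((hX.hasDerivAt_I₂ hg ht).add ((hX.hasDerivAt_I₃ hg ht).const_mul N)).add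
    (hX.hasDerivAt_I₄ ht)).add ((hX.hasDerivAt_I₅ ht).const_mul (2 * a.l)), ?_⟩⟩
  have hm0 := hg.weight.quad_nonneg ht.le X.ψ.ux
  have hd0 := hg.weight_dissipation.quad_nonneg ht.le X.ψ.ux
  have hgt := hg.nonneg t
  have hgt0 : g t ≤ g 0 := hg.antitone ht.le
  have b2 := hX.deriv_I₂_bound hg hκ hκg ht
  have b3a := N₃_inner_uxt_le (a := a) X N θ t
  have b3b := hX.N₃_inner_relax_le hg N ht
  have b3c := hX.N₃_inner_M_le hg hκ hκg N ht
  have b3d := N₃_inner_ψ_w_le (a := a) X N t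
  have b4 := deriv_I₄_bound (a := a) X t
  have b5 := hX.deriv_I₅_bound ha ht
  have b5' := mul_le_mul_of_nonneg_left b5 (by positivity : 0 ≤ 2 * a.l)
  -- the coefficients of `‖A‖²`, `‖ψ_x‖²`, `‖B‖²`, `‖φ_t‖²` and `‖w_t‖²` in the sum
  have hNk : N * a.k₁ = a.k₁ ^ 2 * S.c ^ 2 / κ + 28 * a.k₁ := by
    rw [hN, Coeffs.N₃]; field_simp
  have cA : a.k₁ ^ 2 * S.c ^ 2 / κ - N * a.k₁ + 27 * a.l * a.k₁ ≤ -β := by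
    have : a.l * a.k₁ ≤ a.k₁ := mul_le_of_le_one_left hk1.le ha.le_one
    have hb : β ≤ a.k₁ := (min_le_left _ _).trans (min_le_left _ _)
    linarith
  have cx : -(κ / 2) + a.l * (4 * N ^ 2 * a.k₂ ^ 2 / a.k₁) + 24 * a.l * a.k₁ * S.c ^ 2 ≤ -β := by
    have hb : β ≤ κ / 4 := (min_le_left _ _).trans (min_le_right _ _)
    have := ha.mul_le
    linarith
  have cb : -(a.l * a.k₁) + a.l * a.k₁ / 8 + 26 * a.k₁ * S.c ^ 2 * a.l ^ 3 ≤ -β := by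
    have hb : β ≤ a.l * a.k₁ / 2 := (min_le_right _ _).trans (min_le_left _ _)
    have h1 := mul_le_mul_of_nonneg_left ha.sq_le (mul_pos hl hk1).le
    have h2 : 26 * a.k₁ * S.c ^ 2 * a.l ^ 3 =
        26 / 70 * (a.l * a.k₁ * (70 * S.c ^ 2 * a.l ^ 2)) := by ring
    have h3 := mul_pos hl hk1
    rw [h2]
    linarith only [h1, h3, hb]
  have cf : -(a.l * a.ρ₁ / 2) ≤ -β := by
    have hb : β ≤ a.l * a.ρ₁ / 2 :=
      (min_le_right _ _).trans ((min_le_right _ _).trans (min_le_left _ _))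
    linarith
  have cz : -(a.l * a.ρ₁ * (3 / 8)) ≤ -β := by
    have hb : β ≤ a.l * a.ρ₁ * (3 / 8) :=
      (min_le_right _ _).trans ((min_le_right _ _).trans (min_le_right _ _))
    linarith
  have dA := mul_le_mul_of_nonneg_right cA (sq_nonneg ‖X.A a t‖)
  have dx := mul_le_mul_of_nonneg_right cx (sq_nonneg ‖X.ψ.ux t‖)
  have db := mul_le_mul_of_nonneg_right cb (sq_nonneg ‖X.B a t‖)
  have df := mul_le_mul_of_nonneg_right cf (sq_nonneg ‖X.φ.ut t‖)
  have dz := mul_le_mul_of_nonneg_right cz (sq_nonneg ‖X.w.ut t‖)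
  have dy : Cy * ‖X.ψ.ut t‖ ^ 2 = (a.ρ₂ + N * a.ρ₂ + 2 * a.l * N ^ 2 * a.ρ₂ ^ 2 / a.ρ₁
    + a.ρ₁ / (2 * a.l)) * ‖X.ψ.ut t‖ ^ 2 + β * ‖X.ψ.ut t‖ ^ 2 := by rw [hCy]; ring
  have dm : Cm * quad g X.ψ.ux t = a.k₂ / κ * quad g X.ψ.ux t
    + 4 * a.l * N ^ 2 * a.k₂ / a.k₁ * quad g X.ψ.ux t := by rw [hCm]; ring
  have hgx : 0 ≤ g t * ‖X.ψ.ux t‖ ^ 2 := by positivity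
  -- every remaining coefficient is at most the sum of the constants
  have fin : Cy * ‖X.ψ.ut t‖ ^ 2 + Cm * quad g X.ψ.ux t
      + Cd * (g t * ‖X.ψ.ux t‖ ^ 2 + quad k X.ψ.ux t) + Cq * ‖X.ψ.uxt t‖ ^ 2 ≤
      (Cy + Cm + Cd + Cq) * (‖X.ψ.ut t‖ ^ 2 + X.R g k t) := by
    have hq := sq_nonneg ‖X.ψ.uxt t‖
    have hy := sq_nonneg ‖X.ψ.ut t‖
    rw [Triple.R]
    set m := quad g X.ψ.ux t
    set d := quad k X.ψ.ux t
    set gx := g t * ‖X.ψ.ux t‖ ^ 2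
    have i1 : 0 ≤ Cy * (m + d + gx + ‖X.ψ.uxt t‖ ^ 2) := by positivity
    have i2 : 0 ≤ Cm * (‖X.ψ.ut t‖ ^ 2 + d + gx + ‖X.ψ.uxt t‖ ^ 2) := by positivity
    have i3 : 0 ≤ Cd * (‖X.ψ.ut t‖ ^ 2 + m + ‖X.ψ.uxt t‖ ^ 2) := by positivity
    have i4 : 0 ≤ Cq * (‖X.ψ.ut t‖ ^ 2 + m + d + gx) := by positivity
    linarith
  rw [Triple.Q]
  linarith

/-- The multiplier `I₁` dissipates `ψ_t` from any positive time on. -/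
theorem exists_deriv_I₁_le (hg : IsRelaxation g k) (hκ : 0 < κ)
    (hκg : κ + ∫ s in Ioi (0 : ℝ), g s ≤ a.k₂) {t₀ : ℝ} (ht₀ : 0 < t₀) {δ : ℝ} (hδ : 0 < δ) :
    ∃ C ≥ 0, ∀ X, IsSolution S a g 0 X → ∀ t, t₀ ≤ t → ∃ d, HasDerivAt (X.I₁ a g) d t ∧
      d ≤ -(a.ρ₂ * (∫ s in (0 : ℝ)..t₀, g s) / 2) * ‖X.ψ.ut t‖ ^ 2 + δ * X.Q a t
        + C * X.R g k t := by
  have hk1 := a.k₁_pos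
  have hk2 := a.k₂_pos
  have hr2 := a.ρ₂_pos
  have hc := S.c_pos
  have hg0 := hg.pos_zero
  set G₀ := ∫ s in (0 : ℝ)..t₀, g s with hG₀
  have hG₀pos : 0 < G₀ := hg.integral_pos ht₀
  set ν := δ / (2 * a.k₂ ^ 2) with hν
  have hνpos : 0 < ν := by positivity
  refine ⟨ν * (2 * a.k₂) + 1 / (4 * ν) * a.k₂ + a.k₁ ^ 2 / (4 * δ) * (a.k₂ * S.c ^ 2)
    + a.ρ₂ / (2 * G₀) * (g 0 * S.c ^ 2), by positivity, fun X hX t htt => ?_⟩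
  have ht : 0 < t := ht₀.trans_le htt
  refine ⟨_, hX.hasDerivAt_I₁ hg ht, ?_⟩
  have hm0 := hg.weight.quad_nonneg ht.le X.ψ.ux
  have hd0 := hg.weight_dissipation.quad_nonneg ht.le X.ψ.ux
  have hgx : 0 ≤ g t * ‖X.ψ.ux t‖ ^ 2 := mul_nonneg (hg.nonneg t) (sq_nonneg _)
  have y1 := (abs_le.1 (abs_inner_le_young (X.M a g t) (relax g X.ψ.ux t) hνpos)).2
  have y2 := (abs_le.1 (abs_inner_le_young (X.A a t) (a.k₁ • relax g X.ψ.u t) hδ)).2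
  have y3 := (abs_le.1 (abs_inner_le_young (X.ψ.ut t) (relax k X.ψ.u t)
    (δ := G₀ / 2) (by positivity))).2
  rw [real_inner_smul_right, norm_smul, mul_pow, Real.norm_eq_abs, sq_abs] at y2
  have n1 := mul_le_mul_of_nonneg_left (hX.norm_M_sq_le hg hκ hκg ht.le) hνpos.le
  have n2 := mul_le_mul_of_nonneg_left (hX.norm_relax_ux_sq_le hg hκ hκg ht.le)
    (by positivity : 0 ≤ 1 / (4 * ν))
  have n3 := mul_le_mul_of_nonneg_left (hX.norm_relax_u_sq_le hg hκ hκg ht.le)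
    (by positivity : 0 ≤ a.k₁ ^ 2 / (4 * δ))
  have n4 := mul_le_mul_of_nonneg_left (hX.norm_relax_dissipation_u_sq_le hg ht.le)
    (by positivity : 0 ≤ a.ρ₂ / (2 * G₀))
  have y3' := mul_le_mul_of_nonneg_left y3 hr2.le
  have e1 : ν * (2 * a.k₂ ^ 2 * ‖X.ψ.ux t‖ ^ 2) = δ * ‖X.ψ.ux t‖ ^ 2 := by
    rw [hν]; field_simp
  have e2 : 1 / (4 * δ) * (a.k₁ ^ 2 * ‖relax g X.ψ.u t‖ ^ 2) =
    a.k₁ ^ 2 / (4 * δ) * ‖relax g X.ψ.u t‖ ^ 2 := by ring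
  have e3 : a.ρ₂ * (1 / (4 * (G₀ / 2)) * ‖relax k X.ψ.u t‖ ^ 2) =
    a.ρ₂ / (2 * G₀) * ‖relax k X.ψ.u t‖ ^ 2 := by field_simp; ring
  have h1 : a.ρ₂ * G₀ * ‖X.ψ.ut t‖ ^ 2 ≤
      a.ρ₂ * (∫ s in (0 : ℝ)..t, g s) * ‖X.ψ.ut t‖ ^ 2 := by
    have := hg.integral_mono htt
    gcongr
  set m := quad g X.ψ.ux t
  set d := quad k X.ψ.ux t
  set gx := g t * ‖X.ψ.ux t‖ ^ 2
  have i1 : 0 ≤ (ν * (2 * a.k₂) + 1 / (4 * ν) * a.k₂ + a.k₁ ^ 2 / (4 * δ) * (a.k₂ * S.c ^ 2)) *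
    (d + gx + ‖X.ψ.uxt t‖ ^ 2) := by positivity
  have i2 : 0 ≤ a.ρ₂ / (2 * G₀) * (g 0 * S.c ^ 2) * (m + gx + ‖X.ψ.uxt t‖ ^ 2) := by positivity
  have i3 : 0 ≤ δ * (‖X.B a t‖ ^ 2 + ‖X.ψ.ut t‖ ^ 2 + ‖X.φ.ut t‖ ^ 2 + ‖X.w.ut t‖ ^ 2) := by
    positivity
  rw [Triple.R, Triple.Q]
  linarith

omit [CompleteSpace H] in
theorem E_le (hg : IsRelaxation g k) : ∃ C > 0, ∀ X : Triple H, ∀ t, 0 ≤ t →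
    X.E a g t ≤ C * (X.Q a t + quad g X.ψ.ux t) := by
  have hk1 := a.k₁_pos
  have hk2 := a.k₂_pos
  have hr1 := a.ρ₁_pos
  have hr2 := a.ρ₂_pos
  refine ⟨a.ρ₁ + a.ρ₂ + a.k₂ + a.k₁ + 1, by positivity, fun X t ht => ?_⟩
  have hm0 := hg.weight.quad_nonneg ht X.ψ.ux
  have h3 : (a.k₂ - ∫ s in (0 : ℝ)..t, g s) * ‖X.ψ.ux t‖ ^ 2 ≤ a.k₂ * ‖X.ψ.ux t‖ ^ 2 :=
    mul_le_mul_of_nonneg_right (by linarith [hg.weight.integral_nonneg ht]) (sq_nonneg _)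
  rw [Triple.E, Triple.Q]
  set C := a.ρ₁ + a.ρ₂ + a.k₂ + a.k₁ + 1 with hC
  have c1 : a.ρ₁ ≤ C := by linarith
  have c2 : a.ρ₂ ≤ C := by linarith
  have c3 : a.k₂ ≤ C := by linarith
  have c4 : a.k₁ ≤ C := by linarith
  have c5 : 1 ≤ C := by linarith
  have d1 := mul_le_mul_of_nonneg_right c1 (sq_nonneg ‖X.φ.ut t‖)
  have d2 := mul_le_mul_of_nonneg_right c2 (sq_nonneg ‖X.ψ.ut t‖)
  have d3 := mul_le_mul_of_nonneg_right c1 (sq_nonneg ‖X.w.ut t‖)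
  have d4 := mul_le_mul_of_nonneg_right c3 (sq_nonneg ‖X.ψ.ux t‖)
  have d5 := mul_le_mul_of_nonneg_right c4 (sq_nonneg ‖X.B a t‖)
  have d6 := mul_le_mul_of_nonneg_right c4 (sq_nonneg ‖X.A a t‖)
  have d7 := mul_le_mul_of_nonneg_right c5 hm0
  have hC0 : 0 < C := by positivity
  have : 0 ≤ C * (‖X.A a t‖ ^ 2 + ‖X.B a t‖ ^ 2 + ‖X.ψ.ux t‖ ^ 2 + ‖X.ψ.ut t‖ ^ 2
    + ‖X.φ.ut t‖ ^ 2 + ‖X.w.ut t‖ ^ 2 + quad g X.ψ.ux t) := by positivity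
  linarith

omit [CompleteSpace H] in
theorem le_E (hg : IsRelaxation g k) (hκ : 0 < κ)
    (hκg : κ + ∫ s in Ioi (0 : ℝ), g s ≤ a.k₂) : ∃ e > 0, ∀ X : Triple H, ∀ t, 0 ≤ t →
    e * (X.Q a t + quad g X.ψ.ux t) ≤ X.E a g t := by
  have hk1 := a.k₁_pos
  have hr1 := a.ρ₁_pos
  have hr2 := a.ρ₂_pos
  refine ⟨(1 / 2) * min (min a.ρ₁ a.ρ₂) (min κ (min a.k₁ 1)), by positivity, fun X t ht => ?_⟩
  have hm0 := hg.weight.quad_nonneg ht X.ψ.ux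
  have h3 : κ * ‖X.ψ.ux t‖ ^ 2 ≤ (a.k₂ - ∫ s in (0 : ℝ)..t, g s) * ‖X.ψ.ux t‖ ^ 2 :=
    mul_le_mul_of_nonneg_right (by linarith [hg.integral_le ht]) (sq_nonneg _)
  rw [Triple.E, Triple.Q]
  set C := min (min a.ρ₁ a.ρ₂) (min κ (min a.k₁ 1)) with hC
  have c1 : C ≤ a.ρ₁ := (min_le_left _ _).trans (min_le_left _ _)
  have c2 : C ≤ a.ρ₂ := (min_le_left _ _).trans (min_le_right _ _)
  have c3 : C ≤ κ := (min_le_right _ _).trans (min_le_left _ _)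
  have c4 : C ≤ a.k₁ := (min_le_right _ _).trans ((min_le_right _ _).trans (min_le_left _ _))
  have c5 : C ≤ 1 := (min_le_right _ _).trans ((min_le_right _ _).trans (min_le_right _ _))
  have d1 := mul_le_mul_of_nonneg_right c1 (sq_nonneg ‖X.φ.ut t‖)
  have d2 := mul_le_mul_of_nonneg_right c2 (sq_nonneg ‖X.ψ.ut t‖)
  have d3 := mul_le_mul_of_nonneg_right c1 (sq_nonneg ‖X.w.ut t‖)
  have d4 := mul_le_mul_of_nonneg_right c3 (sq_nonneg ‖X.ψ.ux t‖)
  have d5 := mul_le_mul_of_nonneg_right c4 (sq_nonneg ‖X.B a t‖)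
  have d6 := mul_le_mul_of_nonneg_right c4 (sq_nonneg ‖X.A a t‖)
  have d7 := mul_le_mul_of_nonneg_right c5 hm0
  linarith

omit [CompleteSpace H] in
theorem Q_nonneg (X : Triple H) (t : ℝ) : 0 ≤ X.Q a t := by rw [Triple.Q]; positivity

/-- The multipliers are dominated by the energy. -/
theorem exists_abs_multipliers_le (hg : IsRelaxation g k) (hκ : 0 < κ)
    (hκg : κ + ∫ s in Ioi (0 : ℝ), g s ≤ a.k₂) (ha : a.IsSmall S.c κ) :
    ∃ C ≥ 0, ∀ X, IsSolution S a g 0 X → ∀ t, 0 ≤ t →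
      |X.I₁ a g t| ≤ C * (X.Q a t + quad g X.ψ.ux t) ∧
      |X.I₂ a t + a.N₃ S.c κ * X.I₃ a g t + X.I₄ a t + 2 * a.l * X.I₅ a t| ≤
        C * (X.Q a t + quad g X.ψ.ux t) := by
  have hl := a.l_pos
  have hk1 := a.k₁_pos
  have hk2 := a.k₂_pos
  have hr1 := a.ρ₁_pos
  have hr2 := a.ρ₂_pos
  have hc := S.c_pos
  set N := a.N₃ S.c κ with hN
  have hNpos : 0 < N := by rw [hN, Coeffs.N₃]; positivity
  set C₁ := a.ρ₂ * (1 + a.k₂ * S.c ^ 2) with hC₁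
  set C₂ := a.ρ₂ * (1 + S.c ^ 2) with hC₂
  set C₃ := a.ρ₂ + a.ρ₁ / a.k₁ * (1 + 2 * a.k₂ ^ 2 + 2 * a.k₂) with hC₃
  set C₅ := a.ρ₁ * (1 + 12 * S.c ^ 2 * (1 + S.c ^ 2 + a.l ^ 2 * S.c ^ 2)) with hC₅
  refine ⟨C₁ + (C₂ + N * C₃ + 2 * a.ρ₁ + 2 * a.l * C₅), by positivity, fun X hX t ht => ?_⟩
  have hm0 := hg.weight.quad_nonneg ht X.ψ.ux
  have hQ := Q_nonneg (a := a) X t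
  have mulabs : ∀ r x y : ℝ, 0 ≤ r → |x| ≤ y → |r * x| ≤ r * y := fun r x y hr h => by
    rw [abs_mul, abs_of_nonneg hr]; gcongr
  set P := X.Q a t + quad g X.ψ.ux t with hP
  have sq : ∀ x : H, 0 ≤ ‖x‖ ^ 2 := fun x => sq_nonneg _
  have pA : ‖X.A a t‖ ^ 2 ≤ X.Q a t := by
    rw [Triple.Q]
    linarith [sq (X.B a t), sq (X.ψ.ux t), sq (X.ψ.ut t), sq (X.φ.ut t), sq (X.w.ut t)]
  have px : ‖X.ψ.ux t‖ ^ 2 ≤ X.Q a t := by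
    rw [Triple.Q]
    linarith [sq (X.B a t), sq (X.A a t), sq (X.ψ.ut t), sq (X.φ.ut t), sq (X.w.ut t)]
  have pB : ‖X.B a t‖ ^ 2 ≤ X.Q a t := by
    rw [Triple.Q]
    linarith [sq (X.A a t), sq (X.ψ.ux t), sq (X.ψ.ut t), sq (X.φ.ut t), sq (X.w.ut t)]
  have py : ‖X.ψ.ut t‖ ^ 2 ≤ X.Q a t := by
    rw [Triple.Q]
    linarith [sq (X.B a t), sq (X.ψ.ux t), sq (X.A a t), sq (X.φ.ut t), sq (X.w.ut t)]
  have pf : ‖X.φ.ut t‖ ^ 2 ≤ X.Q a t := by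
    rw [Triple.Q]
    linarith [sq (X.B a t), sq (X.ψ.ux t), sq (X.ψ.ut t), sq (X.A a t), sq (X.w.ut t)]
  have pr := hX.norm_relax_u_sq_le hg hκ hκg ht
  have i1 : |X.I₁ a g t| ≤ C₁ * P := by
    rw [Triple.I₁, neg_mul, abs_neg, hC₁, mul_assoc]
    refine mulabs _ _ _ hr2.le ((abs_inner_le_half _ _).trans ?_)
    have : 0 ≤ a.k₂ * S.c ^ 2 * X.Q a t := by positivity
    rw [hP]; linarith
  have i2 : |X.I₂ a t| ≤ C₂ * P := by
    rw [Triple.I₂, hC₂, mul_assoc]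
    refine mulabs _ _ _ hr2.le ((abs_inner_le_half _ _).trans ?_)
    have p2 : ‖X.ψ.u t‖ ≤ S.c * ‖X.ψ.ux t‖ := S.poincares _ (hX.ψ.mem_u t ht)
    have p3 := pow_le_pow_left₀ (norm_nonneg _) p2 2
    rw [mul_pow] at p3
    have p4 := mul_le_mul_of_nonneg_left px (sq_nonneg S.c)
    have : 0 ≤ S.c ^ 2 * quad g X.ψ.ux t := by positivity
    rw [hP]; linarith
  have i3 : |X.I₃ a g t| ≤ C₃ * P := by
    rw [Triple.I₃, hC₃, add_mul, mul_assoc]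
    refine (abs_add_le _ _).trans (add_le_add (mulabs _ _ _ hr2.le ?_)
      (mulabs _ _ _ (by positivity) ?_))
    · refine (abs_inner_le_half _ _).trans ?_
      have : ‖X.ψ.ut t‖ ^ 2 + ‖X.A a t‖ ^ 2 ≤ X.Q a t := by
        rw [Triple.Q]; linarith [sq_nonneg ‖X.B a t‖,
          sq_nonneg ‖X.ψ.ux t‖, sq_nonneg ‖X.φ.ut t‖, sq_nonneg ‖X.w.ut t‖]
      linarith
    · refine (abs_inner_le_half _ _).trans ?_
      have hM := hX.norm_M_sq_le hg hκ hκg ht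
      have p4 := mul_le_mul_of_nonneg_left px (by positivity : 0 ≤ 2 * a.k₂ ^ 2)
      have : 0 ≤ 2 * a.k₂ * X.Q a t := by positivity
      have : 0 ≤ 2 * a.k₂ ^ 2 * quad g X.ψ.ux t := by positivity
      rw [hP]; linarith
  have i4 : |X.I₄ a t| ≤ 2 * a.ρ₁ * P := by
    rw [Triple.I₄, neg_mul, abs_neg, mul_comm 2, mul_assoc]
    refine mulabs _ _ _ hr1.le ((abs_add_le _ _).trans ?_)
    have h1 := abs_inner_le_half (X.φ.ut t) (X.B a t)
    have h2 := abs_inner_le_half (X.w.ut t) (X.A a t)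
    have : ‖X.φ.ut t‖ ^ 2 + ‖X.B a t‖ ^ 2 + (‖X.w.ut t‖ ^ 2 + ‖X.A a t‖ ^ 2) ≤ X.Q a t := by
      rw [Triple.Q]; linarith [sq_nonneg ‖X.ψ.ux t‖, sq_nonneg ‖X.ψ.ut t‖]
    linarith
  have i5 : |X.I₅ a t| ≤ C₅ * P := by
    rw [Triple.I₅, neg_mul, abs_neg, hC₅, mul_assoc]
    refine mulabs _ _ _ hr1.le ((abs_inner_le_half _ _).trans ?_)
    have p2 : ‖X.φ.u t‖ ≤ S.c * ‖X.φ.ux t‖ := S.poincare10 _ (hX.φ.mem_u t ht)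
    have p3 := pow_le_pow_left₀ (norm_nonneg _) p2 2
    have n := hX.norm_φ_ux_sq_le ha ht
    have n2 : ‖X.φ.ux t‖ ^ 2 ≤ 12 * (1 + S.c ^ 2 + a.l ^ 2 * S.c ^ 2) * X.Q a t := by
      have q1 := mul_le_mul_of_nonneg_left px (sq_nonneg S.c)
      have q2 := mul_le_mul_of_nonneg_left pB (by positivity : 0 ≤ a.l ^ 2 * S.c ^ 2)
      linarith
    have n3 := mul_le_mul_of_nonneg_left n2 (sq_nonneg S.c)
    have : 0 ≤ 12 * S.c ^ 2 * (1 + S.c ^ 2 + a.l ^ 2 * S.c ^ 2) * quad g X.ψ.ux t := by positivity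
    rw [mul_pow] at p3
    rw [hP]; linarith
  have hP0 : 0 ≤ P := by positivity
  have z1 : 0 ≤ C₁ * P := by positivity
  have z2 : 0 ≤ (C₂ + N * C₃ + 2 * a.ρ₁ + 2 * a.l * C₅) * P := by positivity
  refine ⟨by linarith, ?_⟩
  have j3 := mulabs N _ _ hNpos.le i3
  have j5 := mulabs (2 * a.l) _ _ (by positivity) i5
  have s1 := abs_add_le (X.I₂ a t + N * X.I₃ a g t + X.I₄ a t) (2 * a.l * X.I₅ a t)
  have s2 := abs_add_le (X.I₂ a t + N * X.I₃ a g t) (X.I₄ a t)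
  have s3 := abs_add_le (X.I₂ a t) (N * X.I₃ a g t)
  linarith

/-- The Lyapunov functional: comparable to the energy from above, nonnegative, and decreasing up to
the memory term and `ψ_xt`. -/
theorem exists_lyapunov (hg : IsRelaxation g k) (hκ : 0 < κ)
    (hκg : κ + ∫ s in Ioi (0 : ℝ), g s ≤ a.k₂) (ha : a.IsSmall S.c κ) {t₀ : ℝ} (ht₀ : 0 < t₀) :
    ∃ c > 0, ∃ C > 0, ∀ X, IsSolution S a g 0 X → ∃ V V' : ℝ → ℝ,
      ∀ t, t₀ ≤ t → HasDerivAt V (V' t) t ∧ 0 ≤ V t ∧ V t ≤ C * X.E a g t ∧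
        V' t ≤ -c * X.E a g t + C * (quad g X.ψ.ux t + ‖X.ψ.uxt t‖ ^ 2) := by
  obtain ⟨β, hβ, C₀, hC₀, hJ⟩ := exists_deriv_J_le (S := S) hg hκ hκg ha
  set γ := a.ρ₂ * (∫ s in (0 : ℝ)..t₀, g s) / 2 with hγ
  have hγpos : 0 < γ := by have := hg.integral_pos ht₀; have := a.ρ₂_pos; positivity
  -- `N₁ I₁` absorbs the term in `‖ψ_t‖²`, `δ` keeps its other terms below half of the decay, and
  -- `N E` absorbs the dissipation terms and makes the functional nonnegative
  set N₁ := C₀ / γ with hN₁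
  have hN₁pos : 0 ≤ N₁ := by positivity
  set δ := β / (2 * (N₁ + 1)) with hδ
  have hδpos : 0 < δ := by positivity
  obtain ⟨C₁, hC₁, hI⟩ := exists_deriv_I₁_le (S := S) hg hκ hκg ht₀ hδpos
  obtain ⟨Ce, hCe, hE⟩ := E_le (H := H) (a := a) hg
  obtain ⟨e, he, hE'⟩ := le_E (H := H) hg hκ hκg
  obtain ⟨Cm, hCm, hM⟩ := exists_abs_multipliers_le (S := S) hg hκ hκg ha
  set CR := C₀ + N₁ * C₁ with hCR
  have hCR0 : 0 ≤ CR := by positivity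
  set N := 2 * CR + Cm * (1 + N₁) / e with hN
  have hN0 : 0 ≤ N := by positivity
  refine ⟨β / 2 / Ce, by positivity, N + Cm * (1 + N₁) / e + CR + β / 2 + 1, by positivity,
    fun X hX => ?_⟩
  choose! dJ hdJ hdJ' using hJ X hX
  choose! dI hdI hdI' using hI X hX
  refine ⟨fun t => N * X.E a g t + N₁ * X.I₁ a g t
    + (X.I₂ a t + a.N₃ S.c κ * X.I₃ a g t + X.I₄ a t + 2 * a.l * X.I₅ a t), fun t =>
    N * (-(1 / 2) * quad k X.ψ.ux t - (1 / 2) * (g t * ‖X.ψ.ux t‖ ^ 2)) + N₁ * dI t + dJ t,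
    fun t htt => ?_⟩
  have ht : 0 < t := ht₀.trans_le htt
  have hdE := hX.hasDerivAt_E hg ht
  simp only [Pi.zero_apply, inner_zero_left, sub_zero] at hdE
  have hm0 := hg.weight.quad_nonneg ht.le X.ψ.ux
  have hd0 := hg.weight_dissipation.quad_nonneg ht.le X.ψ.ux
  have hgx : 0 ≤ g t * ‖X.ψ.ux t‖ ^ 2 := mul_nonneg (hg.nonneg t) (sq_nonneg _)
  have hQ := Q_nonneg (a := a) X t
  have hq := sq_nonneg ‖X.ψ.uxt t‖
  set P := X.Q a t + quad g X.ψ.ux t with hP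
  have hP0 : 0 ≤ P := by positivity
  have hPE : P ≤ X.E a g t / e := by
    rw [le_div_iff₀ he, mul_comm]; exact hE' X t ht.le
  have hE0 : 0 ≤ X.E a g t := le_trans (by positivity) (hE' X t ht.le)
  have habs : |N₁ * X.I₁ a g t
      + (X.I₂ a t + a.N₃ S.c κ * X.I₃ a g t + X.I₄ a t + 2 * a.l * X.I₅ a t)| ≤
      Cm * (1 + N₁) / e * X.E a g t := by
    obtain ⟨m1, m2⟩ := hM X hX t ht.le
    refine (abs_add_le _ _).trans ?_
    rw [abs_mul, abs_of_nonneg hN₁pos]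
    have m3 := mul_le_mul_of_nonneg_left m1 hN₁pos
    have m4 : Cm * (1 + N₁) / e * X.E a g t = Cm * (1 + N₁) * (X.E a g t / e) := by ring
    have m5 := mul_le_mul_of_nonneg_left hPE (by positivity : 0 ≤ Cm * (1 + N₁))
    rw [m4]
    linarith
  refine ⟨?_, ?_, ?_, ?_⟩
  · exact ((hdE.const_mul N).add ((hdI t htt).const_mul N₁)).add (hdJ t ht)
  · have := (abs_le.1 habs).1
    have z : 0 ≤ 2 * CR * X.E a g t := by positivity
    have : N * X.E a g t = 2 * CR * X.E a g t + Cm * (1 + N₁) / e * X.E a g t := by rw [hN]; ring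
    linarith
  · have := (abs_le.1 habs).2
    have z : 0 ≤ (CR + β / 2 + 1) * X.E a g t := by positivity
    linarith
  · have h1 := hdJ' t ht
    have h2 := mul_le_mul_of_nonneg_left (hdI' t htt) hN₁pos
    rw [← hγ] at h2
    have e1 : N₁ * γ = C₀ := by rw [hN₁]; field_simp
    have e2 : N₁ * δ ≤ β / 2 := by
      rw [hδ, ← mul_div_assoc, div_le_iff₀ (by positivity)]
      nlinarith
    have e3 := mul_le_mul_of_nonneg_right e2 hQ
    have e4 : N₁ * (γ * ‖X.ψ.ut t‖ ^ 2) = C₀ * ‖X.ψ.ut t‖ ^ 2 := by rw [← mul_assoc, e1]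
    have h3 : N₁ * dI t + dJ t ≤ -(β / 2) * X.Q a t + CR * X.R g k t := by
      rw [hCR]; linarith
    have h4 : β / 2 / Ce * X.E a g t ≤ β / 2 * P := by
      have := mul_le_mul_of_nonneg_left (hE X t ht.le) (by positivity : 0 ≤ β / 2 / Ce)
      refine this.trans (le_of_eq ?_)
      rw [hP]; field_simp
    have h5 : 2 * CR * ((1 / 2) * quad k X.ψ.ux t + (1 / 2) * (g t * ‖X.ψ.ux t‖ ^ 2)) ≤
        N * ((1 / 2) * quad k X.ψ.ux t + (1 / 2) * (g t * ‖X.ψ.ux t‖ ^ 2)) := by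
      gcongr
      rw [hN]
      have : 0 ≤ Cm * (1 + N₁) / e := by positivity
      linarith
    have z1 : 0 ≤ (N + Cm * (1 + N₁) / e + 1) * (quad g X.ψ.ux t + ‖X.ψ.uxt t‖ ^ 2) := by
      positivity
    have z2 : 0 ≤ β / 2 * ‖X.ψ.uxt t‖ ^ 2 := by positivity
    rw [Triple.R] at h3
    linarith

end IsSolution

/-! ### The second-order energy -/

section Quotient

variable {E : Type*} [NormedAddCommGroup E] [NormedSpace ℝ E]

/-- The difference quotient `h⁻¹ (v(t + h) - v(t))`. -/
def quot (h : ℝ) (v : ℝ → E) (t : ℝ) : E := h⁻¹ • (v (t + h) - v t)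

theorem continuous_quot (h : ℝ) {v : ℝ → E} (hv : Continuous v) : Continuous (quot h v) := by
  unfold quot; fun_prop

theorem hasDerivAt_quot (h : ℝ) {v v' : ℝ → E} (hv : ∀ t, HasDerivAt v (v' t) t) (t : ℝ) :
    HasDerivAt (quot h v) (quot h v' t) t :=
  (((hv (t + h)).comp_add_const t h).sub (hv t)).const_smul h⁻¹

theorem tendsto_quot {v : ℝ → E} {v' : E} {t : ℝ} (hv : HasDerivAt v v' t) :
    Tendsto (fun h => quot h v t) (𝓝[>] 0) (𝓝 v') :=
  (hasDerivAt_iff_tendsto_slope_zero.1 hv).mono_left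
    (nhdsWithin_mono _ fun _ hx => (mem_Ioi.1 hx).ne')

/-- Difference quotients of a `C¹` function converge uniformly on compact intervals. -/
theorem eventually_norm_sub_quot_le {v v' : ℝ → E} (hv : ∀ t, HasDerivAt v (v' t) t)
    (hv' : Continuous v') (T : ℝ) {ε : ℝ} (hε : 0 < ε) :
    ∀ᶠ h in 𝓝[>] (0 : ℝ), ∀ t, 0 ≤ t → t ≤ T → ‖v' t - quot h v t‖ ≤ ε := by
  have huc := (isCompact_Icc (a := (0 : ℝ)) (b := T + 1)).uniformContinuousOn_of_continuous
    hv'.continuousOn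
  obtain ⟨δ, hδ, hd⟩ := Metric.uniformContinuousOn_iff_le.1 huc ε hε
  filter_upwards [Ioo_mem_nhdsGT (lt_min hδ one_pos)] with h hh t ht htT
  have hh0 : 0 < h := hh.1
  have hhδ : h < δ := hh.2.trans_le (min_le_left _ _)
  have hh1 : h < 1 := hh.2.trans_le (min_le_right _ _)
  have key := (convex_Icc t (t + h)).norm_image_sub_le_of_norm_hasDerivWithin_le
    (f := fun s => v s - s • v' t) (f' := fun s => v' s - (1 : ℝ) • v' t) (C := ε)
    (fun s _ => ((hv s).sub ((hasDerivAt_id s).smul_const (v' t))).hasDerivWithinAt)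
    (fun s hs => by
      rw [one_smul, ← dist_eq_norm]
      refine hd s ⟨ht.trans hs.1, by linarith [hs.2]⟩ t ⟨ht, by linarith⟩ ?_
      rw [Real.dist_eq, abs_of_nonneg (by linarith [hs.1])]
      linarith [hs.2])
    (left_mem_Icc.2 (by linarith)) (right_mem_Icc.2 (by linarith))
  have e : v' t - quot h v t = -(h⁻¹ • (v (t + h) - (t + h) • v' t - (v t - t • v' t))) := by
    have : v' t = h⁻¹ • (h • v' t) := by rw [smul_smul, inv_mul_cancel₀ hh0.ne', one_smul]
    rw [quot]
    conv_lhs => rw [this]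
    rw [← smul_sub, ← smul_neg, add_smul]
    congr 1; abel
  rw [e, norm_neg, norm_smul, Real.norm_of_nonneg (inv_nonneg.2 hh0.le)]
  rw [add_sub_cancel_left, Real.norm_of_nonneg hh0.le] at key
  calc h⁻¹ * _ ≤ h⁻¹ * (ε * h) := by gcongr
    _ = ε := by field_simp

end Quotient

/-- The difference quotient of a motion. -/
def Motion.quot (h : ℝ) (m : Motion H) : Motion H :=
  ⟨Bresse.quot h m.u, Bresse.quot h m.ux, Bresse.quot h m.uxx, Bresse.quot h m.ut,
    Bresse.quot h m.uxt, Bresse.quot h m.utt⟩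

/-- The difference quotient of a triple. -/
def Triple.quot (h : ℝ) (X : Triple H) : Triple H := ⟨X.φ.quot h, X.ψ.quot h, X.w.quot h⟩

omit [CompleteSpace H] in
theorem IsMotion.quot {V W : Submodule ℝ (H × H)} {m : Motion H} (hm : IsMotion V W m) {h : ℝ}
    (hh : 0 < h) : IsMotion V W (m.quot h) where
  hasDerivAt_u := hasDerivAt_quot h hm.hasDerivAt_u
  hasDerivAt_ux := hasDerivAt_quot h hm.hasDerivAt_ux
  hasDerivAt_ut := hasDerivAt_quot h hm.hasDerivAt_ut
  cont_uxx := continuous_quot h hm.cont_uxx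
  cont_uxt := continuous_quot h hm.cont_uxt
  cont_utt := continuous_quot h hm.cont_utt
  mem_u t ht := V.smul_mem _ (V.sub_mem (hm.mem_u (t + h) (by linarith)) (hm.mem_u t ht))
  mem_ut t ht := V.smul_mem _ (V.sub_mem (hm.mem_ut (t + h) (by linarith)) (hm.mem_ut t ht))
  mem_ux t ht := W.smul_mem _ (W.sub_mem (hm.mem_ux (t + h) (by linarith)) (hm.mem_ux t ht))

/-- The forcing that the memory of the first `h` units of time exerts on a difference quotient. -/
def quotForcing (g : ℝ → ℝ) (h : ℝ) (v : ℝ → H) (t : ℝ) : H :=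
  h⁻¹ • ∫ s in (0 : ℝ)..h, g (t + h - s) • v s

omit [CompleteSpace H] in
/-- A shift in time leaves the initial part of the memory behind, which becomes a forcing. -/
theorem quot_conv {g k : ℝ → ℝ} (hg : IsRelaxation g k) {v : ℝ → H} (hv : Continuous v) (h t : ℝ) :
    quot h (conv g v) t = conv g (quot h v) t + quotForcing g h v t := by
  have hgc := hg.continuous
  have e1 : conv g v (t + h) = (∫ s in (0 : ℝ)..h, g (t + h - s) • v s)
      + ∫ s in (0 : ℝ)..t, g (t - s) • v (s + h) := by
    have := intervalIntegral.integral_comp_add_right (a := 0) (b := t)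
      (fun s => g (t + h - s) • v s) h
    simp only [add_sub_add_right_eq_sub, zero_add] at this
    rw [this, conv, intervalIntegral.integral_add_adjacent_intervals] <;>
    exact Continuous.intervalIntegrable (by fun_prop) _ _
  have e2 : conv g (quot h v) t = h⁻¹ • ((∫ s in (0 : ℝ)..t, g (t - s) • v (s + h))
      - conv g v t) := by
    rw [conv, conv, ← intervalIntegral.integral_sub, ← intervalIntegral.integral_smul]
    · congr 1; funext s
      rw [quot, ← smul_sub, smul_comm]
    all_goals exact Continuous.intervalIntegrable (by fun_prop) _ _
  rw [quot, e1, e2, quotForcing, ← smul_add]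
  congr 1; abel

omit [CompleteSpace H] in
theorem norm_quotForcing_le {g k : ℝ → ℝ} (hg : IsRelaxation g k) {v : ℝ → H} {h t K : ℝ}
    (hh : 0 < h) (hK : ∀ s, 0 ≤ s → s ≤ h → ‖v s‖ ≤ K) : ‖quotForcing g h v t‖ ≤ K * g t := by
  have hK0 : 0 ≤ K := (norm_nonneg _).trans (hK 0 le_rfl hh.le)
  rw [quotForcing, norm_smul, Real.norm_of_nonneg (inv_nonneg.2 hh.le)]
  have := intervalIntegral.norm_integral_le_of_norm_le_const (a := 0) (b := h)
    (f := fun s => g (t + h - s) • v s) (C := K * g t) (fun s hs => by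
      rw [uIoc_of_le hh.le] at hs
      rw [norm_smul, Real.norm_of_nonneg (hg.nonneg _), mul_comm]
      exact mul_le_mul (hK s hs.1.le hs.2) (hg.antitone (by linarith [hs.2])) (hg.nonneg _) hK0)
  rw [sub_zero, abs_of_pos hh] at this
  calc h⁻¹ * _ ≤ h⁻¹ * (K * g t * h) := by gcongr
    _ = K * g t := by field_simp

namespace Triple

variable (a : Coeffs) (g : ℝ → ℝ) (X : Triple H) (h t : ℝ)

omit [CompleteSpace H] in
theorem A_quot : (X.quot h).A a t = Bresse.quot h (X.A a) t := by
  simp only [A, Triple.quot, Motion.quot, Bresse.quot]; module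

omit [CompleteSpace H] in
theorem Ax_quot : (X.quot h).Ax a t = Bresse.quot h (X.Ax a) t := by
  simp only [Ax, Triple.quot, Motion.quot, Bresse.quot]; module

omit [CompleteSpace H] in
theorem B_quot : (X.quot h).B a t = Bresse.quot h (X.B a) t := by
  simp only [B, Triple.quot, Motion.quot, Bresse.quot]; module

omit [CompleteSpace H] in
theorem Bx_quot : (X.quot h).Bx a t = Bresse.quot h (X.Bx a) t := by
  simp only [Bx, Triple.quot, Motion.quot, Bresse.quot]; module

/-- The quadratic part of the second-order energy, without coefficients. -/
def Q₂ : ℝ := ‖X.At a t‖ ^ 2 + ‖X.Bt a t‖ ^ 2 + ‖X.ψ.uxt t‖ ^ 2 + ‖X.ψ.utt t‖ ^ 2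
  + ‖X.φ.utt t‖ ^ 2 + ‖X.w.utt t‖ ^ 2

end Triple

namespace IsSolution

variable {S : DerivSystem H} {a : Coeffs} {g k : ℝ → ℝ} {f : ℝ → H} {X : Triple H} {κ : ℝ}

omit [CompleteSpace H] in
theorem quot (hX : IsSolution S a g 0 X) (hg : IsRelaxation g k) {h : ℝ} (hh : 0 < h) :
    IsSolution S a g (quotForcing g h X.ψ.uxx) (X.quot h) where
  φ := hX.φ.quot hh
  ψ := hX.ψ.quot hh
  w := hX.w.quot hh
  eq_φ t ht := by
    have e1 := hX.eq_φ t ht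
    have e2 := hX.eq_φ (t + h) (by linarith)
    rw [X.Ax_quot, X.B_quot]
    simp only [Triple.quot, Motion.quot, Bresse.quot]
    rw [smul_comm, smul_sub, e1, e2]; module
  eq_ψ t ht := by
    have e1 := hX.eq_ψ t ht
    have e2 := hX.eq_ψ (t + h) (by linarith)
    have e3 := quot_conv hg hX.ψ.cont_uxx h t
    simp only [Triple.Mx, Pi.zero_apply, sub_zero] at e1 e2
    rw [X.A_quot, Triple.Mx]
    simp only [Triple.quot, Motion.quot]
    rw [eq_sub_of_add_eq e3.symm]
    simp only [Bresse.quot]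
    rw [smul_comm, smul_sub, e1, e2]; module
  eq_w t ht := by
    have e1 := hX.eq_w t ht
    have e2 := hX.eq_w (t + h) (by linarith)
    rw [X.Bx_quot, X.A_quot]
    simp only [Triple.quot, Motion.quot, Bresse.quot]
    rw [smul_comm, smul_sub, e1, e2]; module

omit [InnerProductSpace ℝ H] [CompleteSpace H] in
theorem continuous_quad_max (hg : IsRelaxation g k) {v : ℝ → H} (hv : Continuous v) :
    Continuous fun s => quad k v (max s 0) :=
  (hg.weight_dissipation.continuousOn_quad hv).comp_continuous (by fun_prop)
    fun _ => mem_Ici.2 (le_max_right _ _)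

omit [CompleteSpace H] in
theorem E_nonneg (hg : IsRelaxation g k) (hκ : 0 < κ)
    (hκg : κ + ∫ s in Ioi (0 : ℝ), g s ≤ a.k₂) (X : Triple H) {t : ℝ} (ht : 0 ≤ t) :
    0 ≤ X.E a g t := by
  obtain ⟨e, he, h⟩ := le_E (H := H) hg hκ hκg
  refine le_trans ?_ (h X t ht)
  have := Q_nonneg (a := a) X t
  have := hg.weight.quad_nonneg ht X.ψ.ux
  positivity

/-- An energy bound by Gronwall's inequality when the forcing is dominated by `g`. -/
theorem E_add_integral_le (hX : IsSolution S a g f X) (hg : IsRelaxation g k) (hκ : 0 < κ)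
    (hκg : κ + ∫ s in Ioi (0 : ℝ), g s ≤ a.k₂) {K : ℝ} (hK : 0 ≤ K)
    (hf : ∀ t, 0 < t → ‖f t‖ ≤ K * g t) {T : ℝ} (hT : 0 ≤ T) :
    X.E a g T + 1 / 2 * ∫ s in (0 : ℝ)..T, quad k X.ψ.ux (max s 0) ≤
      Real.exp (K * (1 + 2 / a.ρ₂) * ∫ s in Ioi (0 : ℝ), g s) * (1 + X.E a g 0) := by
  have hr2 := a.ρ₂_pos
  set μ := K * (1 + 2 / a.ρ₂) with hμ
  have hμ0 : 0 ≤ μ := by positivity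
  set G : ℝ → ℝ := fun t => ∫ s in (0 : ℝ)..t, g s with hG
  set I := ∫ s in Ioi (0 : ℝ), g s with hI
  have hGd := hg.hasDerivAt_integral
  have hDc := continuous_quad_max hg hX.ψ.cont_ux
  have hDd : ∀ t, HasDerivAt (fun t => ∫ s in (0 : ℝ)..t, quad k X.ψ.ux (max s 0))
      (quad k X.ψ.ux (max t 0)) t := fun t =>
    intervalIntegral.integral_hasDerivAt_right (hDc.intervalIntegrable _ _)
      (hDc.stronglyMeasurableAtFilter _ _) hDc.continuousAt
  -- the integrating factor is `exp (-μ ∫₀ᵗ g)`, which stays above `exp (-μ I)`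
  set z : ℝ → ℝ := fun t => (1 + X.E a g t) * Real.exp (-μ * G t)
    + Real.exp (-μ * I) * (1 / 2 * ∫ s in (0 : ℝ)..t, quad k X.ψ.ux (max s 0)) with hz
  have hzc : ContinuousOn z (Ici 0) := by
    have h1 := hX.continuous_E hg
    have h2 : Continuous G := continuous_iff_continuousAt.2 fun t => (hGd t).continuousAt
    have h3 : Continuous fun t => ∫ s in (0 : ℝ)..t, quad k X.ψ.ux (max s 0) :=
      continuous_iff_continuousAt.2 fun t => (hDd t).continuousAt
    exact Continuous.continuousOn (by fun_prop)
  have hanti : AntitoneOn z (Ici 0) := by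
    refine antitoneOn_of_hasDerivWithinAt_nonpos (convex_Ici 0) hzc (f' := fun t =>
      (-(1 / 2) * quad k X.ψ.ux t - (1 / 2) * (g t * ‖X.ψ.ux t‖ ^ 2) - ⟪f t, X.ψ.ut t⟫)
        * Real.exp (-μ * G t) + (1 + X.E a g t) * (Real.exp (-μ * G t) * (-μ * g t))
      + Real.exp (-μ * I) * (1 / 2 * quad k X.ψ.ux (max t 0))) ?_ ?_
    · intro t ht
      rw [interior_Ici] at ht
      exact ((((hX.hasDerivAt_E hg ht).const_add 1).mul
        (((hGd t).const_mul (-μ)).exp)).add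
        (((hDd t).const_mul (1 / 2)).const_mul (Real.exp (-μ * I)))).hasDerivWithinAt
    · intro t ht
      rw [interior_Ici] at ht
      have ht0 : 0 < t := ht
      rw [max_eq_left ht0.le]
      have hd0 := hg.weight_dissipation.quad_nonneg ht0.le X.ψ.ux
      have hgt := hg.nonneg t
      have hgx : 0 ≤ g t * ‖X.ψ.ux t‖ ^ 2 := by positivity
      have hexp : Real.exp (-μ * I) ≤ Real.exp (-μ * G t) := by
        refine Real.exp_le_exp.2 ?_
        rw [neg_mul, neg_mul, neg_le_neg_iff]
        exact mul_le_mul_of_nonneg_left (hg.integral_le ht0.le) hμ0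
      have hE : a.ρ₂ / 2 * ‖X.ψ.ut t‖ ^ 2 ≤ X.E a g t := by
        have hm0 := hg.weight.quad_nonneg ht0.le X.ψ.ux
        have h3 : 0 ≤ (a.k₂ - ∫ s in (0 : ℝ)..t, g s) * ‖X.ψ.ux t‖ ^ 2 :=
          mul_nonneg (by linarith [hg.integral_le ht0.le]) (sq_nonneg _)
        have h1 := mul_nonneg a.ρ₁_pos.le (sq_nonneg ‖X.φ.ut t‖)
        have h4 := mul_nonneg a.ρ₁_pos.le (sq_nonneg ‖X.w.ut t‖)
        have h5 := mul_nonneg a.k₁_pos.le (sq_nonneg ‖X.B a t‖)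
        have h6 := mul_nonneg a.k₁_pos.le (sq_nonneg ‖X.A a t‖)
        rw [Triple.E]; linarith
      have hfψ : -⟪f t, X.ψ.ut t⟫ ≤ μ * g t * (1 + X.E a g t) := by
        have h1 := (neg_le_abs _).trans (abs_real_inner_le_norm (f t) (X.ψ.ut t))
        have h2 := mul_le_mul_of_nonneg_right (hf t ht0) (norm_nonneg (X.ψ.ut t))
        have h3 : ‖X.ψ.ut t‖ ≤ (1 + 2 / a.ρ₂) * (1 + X.E a g t) := by
          have h4 : ‖X.ψ.ut t‖ ^ 2 ≤ 2 / a.ρ₂ * X.E a g t := by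
            have : 2 / a.ρ₂ * (a.ρ₂ / 2 * ‖X.ψ.ut t‖ ^ 2) = ‖X.ψ.ut t‖ ^ 2 := by field_simp
            rw [← this]
            gcongr
          have h5 : 0 ≤ X.E a g t := le_trans (by positivity) hE
          have h6 : 0 ≤ 2 / a.ρ₂ := by positivity
          nlinarith [sq_nonneg (‖X.ψ.ut t‖ - 1)]
        have h4 := mul_le_mul_of_nonneg_left h3 (mul_nonneg hK hgt)
        rw [hμ]; linarith
      have e1 := mul_le_mul_of_nonneg_right hexp (by positivity : 0 ≤ 1 / 2 * quad k X.ψ.ux t)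
      have e2 := mul_le_mul_of_nonneg_right hfψ (Real.exp_pos (-μ * G t)).le
      have e3 : 0 ≤ (1 / 2) * (g t * ‖X.ψ.ux t‖ ^ 2) * Real.exp (-μ * G t) := by positivity
      linarith
  have h1 := hanti (mem_Ici.2 le_rfl) (mem_Ici.2 hT) hT
  simp only [hz, hG, intervalIntegral.integral_same, mul_zero, Real.exp_zero, mul_one,
    add_zero] at h1
  have hexp : Real.exp (-μ * I) ≤ Real.exp (-μ * G T) := by
    refine Real.exp_le_exp.2 ?_
    rw [neg_mul, neg_mul, neg_le_neg_iff]
    exact mul_le_mul_of_nonneg_left (hg.integral_le hT) hμ0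
  have hE0 := E_nonneg hg hκ hκg X hT
  have h2 : Real.exp (-μ * I) * (X.E a g T + 1 / 2 * ∫ s in (0 : ℝ)..T, quad k X.ψ.ux (max s 0))
      ≤ 1 + X.E a g 0 := by
    have h3 := mul_le_mul_of_nonneg_left hexp hE0
    have h4 := Real.exp_pos (-μ * G T)
    simp only [hG] at h3 h4
    linarith
  calc X.E a g T + 1 / 2 * ∫ s in (0 : ℝ)..T, quad k X.ψ.ux (max s 0)
      = Real.exp (μ * I) * (Real.exp (-μ * I) *
        (X.E a g T + 1 / 2 * ∫ s in (0 : ℝ)..T, quad k X.ψ.ux (max s 0))) := by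
        rw [← mul_assoc, ← Real.exp_add]; simp
    _ ≤ _ := by gcongr

/-- Bounds for the second-order energy in terms of the initial data: the estimates for the
difference quotients, which are forced solutions, pass to the limit. -/
theorem exists_second_order_bound (hg : IsRelaxation g k) (hκ : 0 < κ)
    (hκg : κ + ∫ s in Ioi (0 : ℝ), g s ≤ a.k₂) (K : ℝ) :
    ∃ C > 0, ∀ X, IsSolution S a g 0 X → X.Q₂ a 0 ≤ K → ‖X.ψ.uxx 0‖ ≤ K → ∀ T, 0 ≤ T →
      ‖X.ψ.uxt T‖ ^ 2 ≤ C ∧ ∫ s in (0 : ℝ)..T, quad k X.ψ.uxt (max s 0) ≤ C := by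
  obtain ⟨Ce, hCe, hE⟩ := E_le (H := H) (a := a) hg
  obtain ⟨e, he, hE'⟩ := le_E (H := H) hg hκ hκg
  set K₁ := Real.exp ((|K| + 1) * (1 + 2 / a.ρ₂) * ∫ s in Ioi (0 : ℝ), g s)
    * (1 + Ce * (|K| + 1)) with hK₁
  have hK₁0 : 0 < K₁ := by positivity
  refine ⟨K₁ / e + (4 * K₁ + 1), by positivity, fun X hX hQ₂ hxx T hT => ?_⟩
  have hk := hg.weight_dissipation
  have hQ : Tendsto (fun h => (X.quot h).Q a 0) (𝓝[>] 0) (𝓝 (X.Q₂ a 0)) := by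
    have t1 := (tendsto_quot (hX.hasDerivAt_A 0)).norm.pow 2
    have t2 := (tendsto_quot (hX.hasDerivAt_B 0)).norm.pow 2
    have t3 := (tendsto_quot (hX.ψ.hasDerivAt_ux 0)).norm.pow 2
    have t4 := (tendsto_quot (hX.ψ.hasDerivAt_ut 0)).norm.pow 2
    have t5 := (tendsto_quot (hX.φ.hasDerivAt_ut 0)).norm.pow 2
    have t6 := (tendsto_quot (hX.w.hasDerivAt_ut 0)).norm.pow 2
    have := ((((t1.add t2).add t3).add t4).add t5).add t6
    simp only [Triple.Q, Triple.A_quot, Triple.B_quot]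
    exact this
  have hQev : ∀ᶠ h in 𝓝[>] (0 : ℝ), (X.quot h).Q a 0 ≤ |K| + 1 :=
    (hQ.eventually_lt_const (u := |K| + 1) (by linarith [le_abs_self K])).mono fun _ h => h.le
  have hxxev : ∀ᶠ h in 𝓝[>] (0 : ℝ), ∀ s, 0 ≤ s → s ≤ h → ‖X.ψ.uxx s‖ ≤ |K| + 1 := by
    have h1 : ∀ᶠ s in 𝓝 (0 : ℝ), ‖X.ψ.uxx s‖ < |K| + 1 :=
      hX.ψ.cont_uxx.norm.continuousAt.eventually_lt_const (by linarith [le_abs_self K])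
    obtain ⟨δ, hδ, hd⟩ := Metric.eventually_nhds_iff.1 h1
    filter_upwards [Ioo_mem_nhdsGT hδ] with h hh s hs hsh
    refine (hd ?_).le
    rw [Real.dist_eq, sub_zero, abs_of_nonneg hs]
    exact hsh.trans_lt hh.2
  have main : ∀ᶠ h in 𝓝[>] (0 : ℝ), (X.quot h).E a g T
      + 1 / 2 * ∫ s in (0 : ℝ)..T, quad k (X.quot h).ψ.ux (max s 0) ≤ K₁ := by
    filter_upwards [hQev, hxxev, self_mem_nhdsWithin] with h h1 h2 hh
    have hh0 : 0 < h := hh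
    have b := (hX.quot hg hh0).E_add_integral_le hg hκ hκg (K := |K| + 1) (by positivity)
      (fun t _ => norm_quotForcing_le hg hh0 h2) hT
    refine b.trans ?_
    rw [hK₁]
    have b2 := hE (X.quot h) 0 le_rfl
    have b3 : quad g (X.quot h).ψ.ux 0 = 0 := by simp [quad]
    rw [b3, add_zero] at b2
    have b4 := b2.trans (mul_le_mul_of_nonneg_left h1 hCe.le)
    gcongr
  have hDc := continuous_quad_max hg (hX.ψ.cont_uxt)
  constructor
  · have t1 := (tendsto_quot (hX.ψ.hasDerivAt_ux T)).norm.pow 2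
    have : ‖X.ψ.uxt T‖ ^ 2 ≤ K₁ / e := by
      refine le_of_tendsto t1 ?_
      filter_upwards [main, self_mem_nhdsWithin] with h h1 hh
      have hh0 : 0 < h := hh
      rw [le_div_iff₀ he]
      have b1 := hE' (X.quot h) T hT
      have b2 : ‖Bresse.quot h X.ψ.ux T‖ ^ 2 ≤ (X.quot h).Q a T := by
        rw [Triple.Q]
        have : (X.quot h).ψ.ux T = Bresse.quot h X.ψ.ux T := rfl
        rw [this]
        have sq : ∀ x : H, 0 ≤ ‖x‖ ^ 2 := fun x => sq_nonneg _
        linarith [sq ((X.quot h).A a T), sq ((X.quot h).B a T), sq ((X.quot h).ψ.ut T),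
          sq ((X.quot h).φ.ut T), sq ((X.quot h).w.ut T)]
      have b3 := hg.weight.quad_nonneg hT (X.quot h).ψ.ux
      have b4 : 0 ≤ ∫ s in (0 : ℝ)..T, quad k (X.quot h).ψ.ux (max s 0) :=
        intervalIntegral.integral_nonneg hT fun s _ => hk.quad_nonneg (le_max_right _ _) _
      nlinarith
    linarith
  · -- on `[0, T]` the quotients of `ψ_x` are eventually so close to `ψ_xt` that the dissipation of
    -- the difference is negligible
    set ε := 1 / (8 * g 0 * T + 8) with hε
    have hg0 := hg.pos_zero
    have hεpos : 0 < ε := by positivity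
    have hε1 : ε ≤ 1 := by
      rw [hε, div_le_one (by positivity)]
      have : 0 ≤ 8 * g 0 * T := by positivity
      linarith
    obtain ⟨h, h1, h2, hh⟩ := (main.and ((eventually_norm_sub_quot_le hX.ψ.hasDerivAt_ux
      hX.ψ.cont_uxt T hεpos).and self_mem_nhdsWithin)).exists
    have hh0 : 0 < h := hh
    have hqc := continuous_quot h hX.ψ.cont_ux
    have hDhc := continuous_quad_max hg hqc
    have b0 := E_nonneg hg hκ hκg (X.quot h) hT
    have b1 : ∫ s in (0 : ℝ)..T, quad k (Bresse.quot h X.ψ.ux) (max s 0) ≤ 2 * K₁ := by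
      have : (X.quot h).ψ.ux = Bresse.quot h X.ψ.ux := rfl
      rw [this] at h1
      linarith
    have b2 : ∫ s in (0 : ℝ)..T, quad k X.ψ.uxt (max s 0) ≤
        ∫ s in (0 : ℝ)..T, (2 * quad k (Bresse.quot h X.ψ.ux) (max s 0)
          + 2 * (g 0 * (4 * ε ^ 2))) := by
      refine intervalIntegral.integral_mono_on hT (hDc.intervalIntegrable _ _)
        (Continuous.intervalIntegrable (by fun_prop) _ _) fun s hs => ?_
      rw [max_eq_left hs.1]
      have c1 := hk.quad_le_two_mul_add hs.1 hX.ψ.cont_uxt hqc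
      have c2 := hk.quad_le_of_bound hs.1 (v := fun s => X.ψ.uxt s - Bresse.quot h X.ψ.ux s)
        (hX.ψ.cont_uxt.sub hqc) (M := ε ^ 2) fun r hr hrs =>
          pow_le_pow_left₀ (norm_nonneg _) (h2 r hr (hrs.trans hs.2)) 2
      have c3 := mul_le_mul_of_nonneg_right (hg.integral_dissipation_le hs.1)
        (by positivity : 0 ≤ 4 * ε ^ 2)
      linarith
    rw [intervalIntegral.integral_add ((hDhc.intervalIntegrable _ _).const_mul 2)
      (by simp), intervalIntegral.integral_const_mul, intervalIntegral.integral_const,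
      smul_eq_mul, sub_zero] at b2
    have b3 : T * (2 * (g 0 * (4 * ε ^ 2))) ≤ 1 := by
      have e1 : (8 * g 0 * T + 8) * ε = 1 := by rw [hε]; field_simp
      have e2 : ε ^ 2 ≤ ε := by nlinarith
      have e3 := mul_le_mul_of_nonneg_left e2 (by positivity : 0 ≤ 8 * g 0 * T)
      linarith
    have : 0 < K₁ / e := by positivity
    linarith

/-- The memory controls `ψ_xt`: the terms on the right are the memory of `ψ_xt`, the dissipation of
the energy, and an integrable function of time. -/
theorem exists_norm_uxt_sq_le (hg : IsRelaxation g k) {t₀ : ℝ} (ht₀ : 0 < t₀) {K : ℝ}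
    (hK : 0 ≤ K) :
    ∃ C > 0, ∀ X, IsSolution S a g 0 X → (∀ t, 0 ≤ t → ‖X.ψ.ux t‖ ^ 2 ≤ K) → ∀ t, t₀ ≤ t →
      ‖X.ψ.uxt t‖ ^ 2 ≤ C * (quad g X.ψ.uxt t + quad k X.ψ.ux t + g t) := by
  have hg0 := hg.pos_zero
  set G₀ := ∫ s in (0 : ℝ)..t₀, g s with hG₀
  have hG₀pos : 0 < G₀ := hg.integral_pos ht₀
  set I := ∫ s in Ioi (0 : ℝ), g s with hI
  have hI0 : 0 ≤ I := setIntegral_nonneg measurableSet_Ioi fun s _ => hg.nonneg s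
  refine ⟨(2 * I + 4 * g 0 + 16 * g 0 * K) / G₀ ^ 2, by positivity, fun X hX hb t htt => ?_⟩
  have ht : 0 < t := ht₀.trans_le htt
  have hm0 := hg.weight.quad_nonneg ht.le X.ψ.uxt
  have hd0 := hg.weight_dissipation.quad_nonneg ht.le X.ψ.ux
  have hgt := hg.nonneg t
  have hgt0 : g t ≤ g 0 := hg.antitone ht.le
  -- the convolution of `g` with `ψ_xt` is integrated by parts in time
  have e1 : (∫ s in (0 : ℝ)..t, g s) • X.ψ.uxt t =
      relax g X.ψ.uxt t + (g t • (X.ψ.ux t - X.ψ.ux 0) + relax k X.ψ.ux t) := by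
    rw [hg.relax_eq hX.ψ.cont_uxt, hg.conv_deriv hX.ψ.hasDerivAt_ux hX.ψ.cont_uxt ht.le]
    abel
  have n0 : G₀ ^ 2 * ‖X.ψ.uxt t‖ ^ 2 ≤ ‖(∫ s in (0 : ℝ)..t, g s) • X.ψ.uxt t‖ ^ 2 := by
    rw [norm_smul, mul_pow, Real.norm_eq_abs, sq_abs]
    have := hg.integral_mono htt
    gcongr
  rw [e1] at n0
  have n1 := norm_add_sq_le_two (relax g X.ψ.uxt t)
    (g t • (X.ψ.ux t - X.ψ.ux 0) + relax k X.ψ.ux t)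
  have n2 := norm_add_sq_le_two (g t • (X.ψ.ux t - X.ψ.ux 0)) (relax k X.ψ.ux t)
  have n3 := hg.weight.norm_relax_sq_le ht.le hX.ψ.cont_uxt
  have n4 := hX.norm_relax_dissipation_sq_le hg ht.le
  have n5 : ‖g t • (X.ψ.ux t - X.ψ.ux 0)‖ ^ 2 ≤ g 0 * g t * (4 * K) := by
    rw [norm_smul, mul_pow, Real.norm_eq_abs, sq_abs]
    have m1 := norm_add_sq_le_two (X.ψ.ux t) (-X.ψ.ux 0)
    rw [norm_neg, ← sub_eq_add_neg] at m1
    have m2 := hb t ht.le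
    have m3 := hb 0 le_rfl
    have m4 : g t ^ 2 ≤ g 0 * g t := by rw [sq]; gcongr
    exact mul_le_mul m4 (by linarith) (sq_nonneg _) (by positivity)
  have n6 := mul_le_mul_of_nonneg_right (hg.integral_le ht.le) hm0
  rw [div_mul_eq_mul_div, le_div_iff₀ (by positivity), mul_comm]
  have p1 : 0 ≤ (4 * g 0 + 16 * g 0 * K) * quad g X.ψ.uxt t := by positivity
  have p2 : 0 ≤ (2 * I + 16 * g 0 * K) * quad k X.ψ.ux t := by positivity
  have p3 : 0 ≤ (2 * I + 4 * g 0) * g t := by positivity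
  linarith

end IsSolution

/-! ### Decay of the energy -/

/-- A decay rate: `g' ≤ -ξ g ^ p`, where `k = -g'` and `ξ` is extended to a continuous antitone
function on `ℝ`. -/
structure IsRate (g k ξ : ℝ → ℝ) (p : ℝ) : Prop where
  continuous : Continuous ξ
  antitone : Antitone ξ
  pos : ∀ t, 0 < ξ t
  differentiableAt : ∀ t, 0 < t → DifferentiableAt ℝ ξ t
  one_le : 1 ≤ p
  lt_three_halves : p < 3 / 2
  mul_rpow_le : ∀ t, 0 < t → ξ t * g t ^ p ≤ k t

/-- A form of Young's inequality. For `p = 1` no interpolation is needed, but the proof is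
uniform: either `√x ≤ ε a` or `a < √x / ε`. -/
theorem rpow_mul_le_add {a x ε p : ℝ} (ha : 0 ≤ a) (hx : 0 ≤ x) (hε : 0 < ε) (hp : 1 ≤ p) :
    a ^ (2 * p - 2) * x ≤ ε * a ^ (2 * p - 1) * √x + ε ^ (2 - 2 * p) * x ^ p := by
  obtain ⟨y, hy, rfl⟩ : ∃ y, 0 ≤ y ∧ x = y ^ 2 := ⟨√x, Real.sqrt_nonneg x, (Real.sq_sqrt hx).symm⟩
  rw [Real.sqrt_sq hy]
  rcases le_or_gt y (ε * a) with h | h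
  · have h2 : a ^ (2 * p - 2) * y ^ 2 ≤ ε * a ^ (2 * p - 1) * y := by
      have e : a ^ (2 * p - 1) = a ^ (2 * p - 2) * a := by
        have := Real.rpow_add_of_nonneg ha (y := 2 * p - 2) (z := 1) (by linarith) zero_le_one
        rw [Real.rpow_one] at this
        rw [← this]; congr 1; ring
      have h0 : 0 ≤ a ^ (2 * p - 2) := by positivity
      rw [e]
      nlinarith [mul_le_mul_of_nonneg_left (mul_le_mul_of_nonneg_right h hy) h0]
    have : 0 ≤ ε ^ (2 - 2 * p) * (y ^ 2) ^ p := by positivity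
    linarith
  · have hy0 : 0 < y := lt_of_le_of_lt (by positivity) h
    have h2 : a ^ (2 * p - 2) * y ^ 2 ≤ ε ^ (2 - 2 * p) * (y ^ 2) ^ p := by
      have h3 : a ≤ y / ε := by rw [le_div_iff₀ hε]; linarith
      have e1 : (y / ε) ^ (2 * p - 2) = ε ^ (2 - 2 * p) * y ^ (2 * p - 2) := by
        rw [Real.div_rpow hy hε.le, div_eq_mul_inv, ← Real.rpow_neg hε.le, mul_comm]
        congr 2; ring
      have e2 : (y ^ 2) ^ p = y ^ (2 * p - 2) * y ^ 2 := by
        rw [← Real.rpow_natCast y 2, ← Real.rpow_mul hy, ← Real.rpow_add hy0]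
        congr 1; push_cast; ring
      rw [e2, ← mul_assoc, ← e1]
      gcongr
      linarith
    have : 0 ≤ ε * a ^ (2 * p - 1) * y := by positivity
    linarith

namespace IsRate

variable {g k ξ : ℝ → ℝ} {p : ℝ} (hξ : IsRate g k ξ p) (hg : IsRelaxation g k)
include hξ hg

/-- The function `ξ √g` is integrable on `(0, ∞)`: where `g > 0` it is at most the derivative of
`- g ^ (3/2 - p) / (3/2 - p)`. -/
theorem integral_sqrt_le {T : ℝ} (hT : 0 ≤ T) :
    ∫ s in (0 : ℝ)..T, ξ s * √(g s) ≤ g 0 ^ (3 / 2 - p) / (3 / 2 - p) := by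
  have hp := hξ.lt_three_halves
  have hq : 0 < 3 / 2 - p := by linarith
  set q := 3 / 2 - p with hqdef
  set G : ℝ → ℝ := fun t => -(g t ^ q / q) with hG
  have hcont : Continuous G := by
    have := (hg.continuous).rpow_const (p := q) fun _ => Or.inr hq.le
    fun_prop
  have hint : Continuous fun s => ξ s * √(g s) := hξ.continuous.mul hg.continuous.sqrt
  have key := intervalIntegral.integral_le_sub_of_hasDeriv_right_of_le hT hcont.continuousOn
    (g' := fun t => if 0 < g t then k t * g t ^ (q - 1) else 0)
    (φ := fun s => ξ s * √(g s)) ?_ hint.integrableOn_Icc ?_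
  · refine key.trans ?_
    have h0 : 0 ≤ g T := hg.nonneg T
    have : 0 ≤ g T ^ q / q := by positivity
    simp only [hG]
    linarith
  · intro t ht
    by_cases h : 0 < g t
    · simp only [h, if_true]
      have := (((hg.hasDerivAt t ht.1).rpow_const (p := q) (Or.inl h.ne')).div_const q).neg
      refine (this.congr_deriv ?_).hasDerivWithinAt
      field_simp
    · simp only [h, if_false]
      -- once `g` vanishes, it vanishes for all later times
      have hz : ∀ s, t ≤ s → g s = 0 := fun s hs =>
        le_antisymm ((hg.antitone hs).trans (not_lt.1 h)) (hg.nonneg s)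
      refine (hasDerivWithinAt_const t (Ioi t) (0 : ℝ)).congr (fun s hs => ?_) ?_
      · simp [hG, hz s (le_of_lt hs), Real.zero_rpow hq.ne']
      · simp [hG, hz t le_rfl, Real.zero_rpow hq.ne']
  · intro t ht
    by_cases h : 0 < g t
    · simp only [h, if_true]
      have h1 := mul_le_mul_of_nonneg_right (hξ.mul_rpow_le t ht.1)
        (Real.rpow_nonneg h.le (q - 1))
      refine le_trans (le_of_eq ?_) h1
      rw [mul_assoc, ← Real.rpow_add h, Real.sqrt_eq_rpow]
      congr 2; rw [hqdef]; ring
    · simp [le_antisymm (not_lt.1 h) (hg.nonneg t)]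

omit [InnerProductSpace ℝ H] [CompleteSpace H] in
/-- The weighted memory energy with kernel `g` is controlled by the dissipation with kernel `k`,
up to a small multiple of the quantity that the Lyapunov function makes decay. -/
theorem rpow_mul_quad_le {v : ℝ → H} (hv : Continuous v) {t M e ε : ℝ} (ht : 0 ≤ t)
    (hM : ∀ s, 0 ≤ s → ‖v s‖ ^ 2 ≤ M) (he : 0 ≤ e) (hε : 0 < ε) :
    e ^ (2 * p - 2) * ξ t ^ (2 * p - 1) * quad g v t ≤
      ε * (4 * M * (g 0 ^ (3 / 2 - p) / (3 / 2 - p))) *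
        (e ^ (2 * p - 1) * ξ t ^ (2 * p - 1)) + ε ^ (2 - 2 * p) * quad k v t := by
  have hξt := hξ.pos t
  have hp := hξ.one_le
  have hM0 : 0 ≤ M := (sq_nonneg _).trans (hM 0 le_rfl)
  set Y := e ^ (2 * p - 1) * ξ t ^ (2 * p - 1) with hY
  have hY0 : 0 ≤ Y := by positivity
  have hI := integral_sqrt_le hξ hg ht
  have hint : Continuous fun s => ξ (t - s) * √(g (t - s)) := by
    have := hξ.continuous; have := hg.continuous; fun_prop
  have hkint := hg.weight_dissipation.reflect_mul ht (y := fun s => ‖v t - v s‖ ^ 2) (by fun_prop)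
  have e1 : ∫ s in (0 : ℝ)..t, (ε * (4 * M) * Y * (ξ (t - s) * √(g (t - s)))
        + ε ^ (2 - 2 * p) * (k (t - s) * ‖v t - v s‖ ^ 2)) =
      ε * (4 * M) * Y * (∫ s in (0 : ℝ)..t, ξ s * √(g s)) + ε ^ (2 - 2 * p) * quad k v t := by
    rw [intervalIntegral.integral_add ((hint.intervalIntegrable _ _).const_mul _)
      (hkint.const_mul _), intervalIntegral.integral_const_mul,
      intervalIntegral.integral_const_mul,
      IsWeight.integral_reflect (k := fun s => ξ s * √(g s))]
    rfl
  have e2 : e ^ (2 * p - 2) * ξ t ^ (2 * p - 1) * quad g v t ≤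
      ∫ s in (0 : ℝ)..t, (ε * (4 * M) * Y * (ξ (t - s) * √(g (t - s)))
        + ε ^ (2 - 2 * p) * (k (t - s) * ‖v t - v s‖ ^ 2)) := by
    rw [quad, ← intervalIntegral.integral_const_mul]
    refine intervalIntegral.integral_mono_on_of_le_Ioo ht
      ((hg.weight.reflect_mul ht (by fun_prop)).const_mul _)
      (((hint.intervalIntegrable _ _).const_mul _).add (hkint.const_mul _)) fun s hs => ?_
    have hts : 0 < t - s := sub_pos.2 hs.2
    have hgs := hg.nonneg (t - s)
    have hd : ‖v t - v s‖ ^ 2 ≤ 4 * M := by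
      have b1 := hM t ht
      have b2 := hM s hs.1.le
      have b3 := norm_sub_le (v t) (v s)
      nlinarith [norm_nonneg (v t - v s), sq_nonneg (‖v t‖ - ‖v s‖)]
    have y := rpow_mul_le_add (a := e * ξ t) (by positivity) hgs hε hp
    rw [Real.mul_rpow he hξt.le, Real.mul_rpow he hξt.le, ← hY] at y
    have e3 : ξ t ^ (2 * p - 1) = ξ t ^ (2 * p - 2) * ξ t := by
      rw [← Real.rpow_add_one hξt.ne']; congr 1; ring
    have hmono : ξ t ≤ ξ (t - s) := hξ.antitone (by linarith [hs.1])
    have hr := hξ.mul_rpow_le (t - s) hts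
    have hgp : 0 ≤ g (t - s) ^ p := by positivity
    have hsq := Real.sqrt_nonneg (g (t - s))
    have hξs := (hξ.pos (t - s)).le
    have hd0 : 0 ≤ ‖v t - v s‖ ^ 2 := by positivity
    have c1 : ξ t * √(g (t - s)) * ‖v t - v s‖ ^ 2 ≤ ξ (t - s) * √(g (t - s)) * (4 * M) := by
      gcongr
    have c2 : ξ t * g (t - s) ^ p ≤ k (t - s) :=
      le_trans (mul_le_mul_of_nonneg_right hmono hgp) hr
    have c3 : ξ t * g (t - s) ^ p * ‖v t - v s‖ ^ 2 ≤ k (t - s) * ‖v t - v s‖ ^ 2 := by gcongr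
    rw [e3]
    calc e ^ (2 * p - 2) * (ξ t ^ (2 * p - 2) * ξ t) * (g (t - s) * ‖v t - v s‖ ^ 2)
        = (e ^ (2 * p - 2) * ξ t ^ (2 * p - 2) * g (t - s)) * (ξ t * ‖v t - v s‖ ^ 2) := by ring
      _ ≤ (ε * Y * √(g (t - s)) + ε ^ (2 - 2 * p) * g (t - s) ^ p) * (ξ t * ‖v t - v s‖ ^ 2) := by
          gcongr
      _ = ε * Y * (ξ t * √(g (t - s)) * ‖v t - v s‖ ^ 2)
          + ε ^ (2 - 2 * p) * (ξ t * g (t - s) ^ p * ‖v t - v s‖ ^ 2) := by ring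
      _ ≤ ε * Y * (ξ (t - s) * √(g (t - s)) * (4 * M))
          + ε ^ (2 - 2 * p) * (k (t - s) * ‖v t - v s‖ ^ 2) := by gcongr
      _ = _ := by ring
  refine e2.trans ?_
  rw [e1]
  have : ε * (4 * M) * Y * (∫ s in (0 : ℝ)..t, ξ s * √(g s)) ≤
      ε * (4 * M) * Y * (g 0 ^ (3 / 2 - p) / (3 / 2 - p)) := by gcongr
  linarith

end IsRate

/-- The Lyapunov inequality `v ≤ -c e + C₁ (q₀ + C₃ (q₁ + p₀ + r))` after multiplication by `y`,
when `y q₀` and `y q₁` are controlled by `p₀`, `p₁` and small multiples of `y e`. -/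
theorem weighted_lyapunov_le {c C₁ C₃ y W Z e η p₀ p₁ q₀ q₁ r B₀ B₁ ε v : ℝ} (hC₁ : 0 ≤ C₁)
    (hC₃ : 0 ≤ C₃) (hy : 0 ≤ y) (hyW : y ≤ W) (hZ : 0 ≤ Z) (hp₀ : 0 ≤ p₀) (hp₁ : 0 ≤ p₁)
    (hr : 0 ≤ r) (hη : 0 ≤ η) (hye : y * e = Z) (h₀ : y * q₀ ≤ ε * B₀ * Z + η * p₀)
    (h₁ : y * q₁ ≤ ε * B₁ * Z + η * p₁) (hε : ε * (C₁ * B₀ + C₁ * C₃ * B₁) ≤ c / 2)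
    (hv : v ≤ -c * e + C₁ * (q₀ + C₃ * (q₁ + p₀ + r))) :
    y * v ≤ -(c / 2) * Z + (C₁ * η + C₁ * C₃ * η + C₁ * C₃ * W) * (p₀ + p₁ + r) := by
  have hW : 0 ≤ W := hy.trans hyW
  have f1 := mul_le_mul_of_nonneg_left hv hy
  have f2 : y * (-c * e + C₁ * (q₀ + C₃ * (q₁ + p₀ + r))) =
      -c * Z + C₁ * (y * q₀) + C₁ * C₃ * (y * q₁) + C₁ * C₃ * (y * (p₀ + r)) := by
    rw [← hye]; ring
  have f3 := mul_le_mul_of_nonneg_left h₀ hC₁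
  have f4 := mul_le_mul_of_nonneg_left h₁ (mul_nonneg hC₁ hC₃)
  have f5 : C₁ * C₃ * (y * (p₀ + r)) ≤ C₁ * C₃ * (W * (p₀ + r)) := by gcongr
  have f6 := mul_le_mul_of_nonneg_right hε hZ
  have f7 : 0 ≤ C₁ * η * (p₁ + r) := by positivity
  have f8 : 0 ≤ C₁ * C₃ * η * (p₀ + r) := by positivity
  have f9 : 0 ≤ C₁ * C₃ * W * p₁ := by positivity
  linarith

namespace IsSolution

variable {S : DerivSystem H} {a : Coeffs} {g k ξ : ℝ → ℝ} {X : Triple H} {κ p : ℝ}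

theorem antitoneOn_E (hX : IsSolution S a g 0 X) (hg : IsRelaxation g k) :
    AntitoneOn (X.E a g) (Ici 0) := by
  refine antitoneOn_of_hasDerivWithinAt_nonpos (convex_Ici 0) (hX.continuous_E hg).continuousOn
    (f' := fun t => -(1 / 2) * quad k X.ψ.ux t - (1 / 2) * (g t * ‖X.ψ.ux t‖ ^ 2)) ?_ ?_
  · intro t ht
    rw [interior_Ici] at ht
    exact ((hX.hasDerivAt_E hg ht).congr_deriv (by simp)).hasDerivWithinAt
  · intro t ht
    rw [interior_Ici] at ht
    have h1 := hg.weight_dissipation.quad_nonneg (le_of_lt ht) X.ψ.ux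
    have h2 := hg.nonneg t
    have : 0 ≤ g t * ‖X.ψ.ux t‖ ^ 2 := by positivity
    linarith

set_option maxHeartbeats 400000 in
/-- The decay estimate. The Lyapunov inequality at times `t ≤ T` is multiplied by
`E(T) ^ (2p-2) ξ(t) ^ (2p-1)`; integrated up to `T`, it bounds
`E(T) ^ (2p-1) ∫ ξ ^ (2p-1)` by first- and second-order dissipation, whose integrals are finite. -/
theorem exists_decay (hg : IsRelaxation g k) (hξ : IsRate g k ξ p) (hκ : 0 < κ)
    (hκg : κ + ∫ s in Ioi (0 : ℝ), g s ≤ a.k₂) (ha : a.IsSmall S.c κ) {t₀ : ℝ} (ht₀ : 0 < t₀)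
    (K : ℝ) :
    ∃ C > 0, ∀ X, IsSolution S a g 0 X → X.E a g 0 ≤ K → X.Q₂ a 0 ≤ K → ‖X.ψ.uxx 0‖ ≤ K →
      ∀ t, t₀ < t → X.E a g t ≤
        C * (1 / ∫ s in t₀..t, ξ s ^ (2 * p - 1)) ^ (1 / (2 * p - 1)) := by
  have hp1 := hξ.one_le
  have hp2 := hξ.lt_three_halves
  have hg0 := hg.pos_zero
  have hξ0 := hξ.pos 0
  obtain ⟨c, hc, C₁, hC₁, hlyap⟩ := exists_lyapunov (S := S) hg hκ hκg ha ht₀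
  obtain ⟨e₀, he₀, hE⟩ := le_E (H := H) hg hκ hκg
  obtain ⟨C₂, hC₂, hsecond⟩ := exists_second_order_bound (S := S) hg hκ hκg K
  set K₀ := |K| with hK₀
  obtain ⟨C₃, hC₃, huxt⟩ := exists_norm_uxt_sq_le (S := S) (a := a) hg ht₀ (K := K₀ / e₀)
    (by positivity)
  set σ := g 0 ^ (3 / 2 - p) / (3 / 2 - p) with hσ
  have hσ0 : 0 ≤ σ := div_nonneg (by positivity) (by linarith)
  set D := C₁ * (4 * (K₀ / e₀) * σ) + C₁ * C₃ * (4 * C₂ * σ) with hD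
  have hD0 : 0 ≤ D := by positivity
  -- with this choice the error terms absorb at most half of the decay
  set ε := c / (2 * (D + 1)) with hε
  have hεpos : 0 < ε := by positivity
  have hεD : ε * D ≤ c / 2 := by
    have e : c / 2 = ε * (D + 1) := by rw [hε]; field_simp
    rw [e]; gcongr; linarith
  set W := K₀ ^ (2 * p - 2) * ξ 0 ^ (2 * p - 1) with hW
  have hW0 : 0 ≤ W := by positivity
  set C₅ := C₁ * ε ^ (2 - 2 * p) + C₁ * C₃ * ε ^ (2 - 2 * p) + C₁ * C₃ * W with hC₅
  have hC₅0 : 0 ≤ C₅ := by positivity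
  set I := ∫ s in Ioi (0 : ℝ), g s with hI
  have hI0 : 0 ≤ I := setIntegral_nonneg measurableSet_Ioi fun s _ => hg.nonneg s
  set C₆ := 2 / c * (W * (C₁ * K₀) + C₅ * (2 * (1 + K₀) + C₂ + I)) + 1 with hC₆
  have hC₆0 : 0 < C₆ := by positivity
  refine ⟨C₆ ^ (1 / (2 * p - 1)), by positivity, fun X hX hXE hXQ hXx T hT => ?_⟩
  have hr : 0 < 2 * p - 1 := by linarith
  have hr2 : 0 ≤ 2 * p - 2 := by linarith
  have hT0 : 0 < T := ht₀.trans hT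
  have hmono := hX.antitoneOn_E hg
  set e := X.E a g T with he
  have he0 : 0 ≤ e := E_nonneg hg hκ hκg X hT0.le
  have hEK : ∀ t, 0 ≤ t → X.E a g t ≤ K₀ := fun t ht =>
    ((hmono (mem_Ici.2 le_rfl) (mem_Ici.2 ht) ht).trans hXE).trans (le_abs_self K)
  have hux : ∀ t, 0 ≤ t → ‖X.ψ.ux t‖ ^ 2 ≤ K₀ / e₀ := fun t ht => by
    rw [le_div_iff₀ he₀]
    have h1 := hE X t ht
    have h2 := hg.weight.quad_nonneg ht X.ψ.ux
    have h3 : ‖X.ψ.ux t‖ ^ 2 ≤ X.Q a t := by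
      simp only [Triple.Q]
      nlinarith [sq_nonneg ‖X.A a t‖, sq_nonneg ‖X.B a t‖, sq_nonneg ‖X.φ.ut t‖,
        sq_nonneg ‖X.ψ.ut t‖, sq_nonneg ‖X.w.ut t‖]
    have h4 := hEK t ht
    nlinarith
  have hsec := hsecond X hX hXQ hXx
  obtain ⟨V, V', hV⟩ := hlyap X hX
  have hcu := hX.ψ.cont_ux
  have hcut := hX.ψ.cont_uxt
  have hD1c := continuous_quad_max hg hcu
  have hD2c := continuous_quad_max hg hcut
  have hgc := hg.continuous
  have hξc := hξ.continuous
  set F : ℝ → ℝ := fun t => ξ t ^ (2 * p - 1) with hF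
  have hFpos : ∀ t, 0 < F t := fun t => Real.rpow_pos_of_pos (hξ.pos t) _
  have hFc : Continuous F := hξc.rpow_const fun t => Or.inr hr.le
  have hFanti : Antitone F := fun s t hst =>
    Real.rpow_le_rpow (hξ.pos t).le (hξ.antitone hst) hr.le
  have hFd : ∀ t, 0 < t → HasDerivAt F (deriv F t) t := fun t ht =>
    ((hξ.differentiableAt t ht).rpow_const (Or.inl (hξ.pos t).ne')).hasDerivAt
  set α := e ^ (2 * p - 2) with hα
  have hα0 : 0 ≤ α := by positivity
  have hαe : α * e = e ^ (2 * p - 1) := by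
    have := Real.rpow_add_of_nonneg he0 (y := 2 * p - 2) (z := 1) hr2 zero_le_one
    rw [Real.rpow_one] at this
    rw [hα, ← this]; congr 1; ring
  have hαF : ∀ t, 0 ≤ t → α * F t ≤ W := fun t ht => by
    have h1 : α ≤ K₀ ^ (2 * p - 2) := Real.rpow_le_rpow he0 (hEK T hT0.le) hr2
    have h2 : F t ≤ ξ 0 ^ (2 * p - 1) := hFanti ht
    have := (hFpos t).le
    rw [hW]
    gcongr
  have key : (α * F T * V T) - (α * F t₀ * V t₀) ≤ ∫ s in t₀..T,
      (-(c / 2) * (e ^ (2 * p - 1)) * F s + C₅ * (quad k X.ψ.ux (max s 0)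
        + quad k X.ψ.uxt (max s 0) + g s)) := by
    refine intervalIntegral.sub_le_integral_of_hasDeriv_right_of_le
      (g := fun t => α * F t * V t)
      (g' := fun t => α * deriv F t * V t + α * F t * V' t) hT.le ?_ ?_ ?_ ?_
    · intro t ht
      exact ((hFc.const_mul α).continuousAt.mul
        (hV t ht.1).1.continuousAt).continuousWithinAt
    · intro t ht
      exact (((hFd t (ht₀.trans ht.1)).const_mul α).mul (hV t ht.1.le).1).hasDerivWithinAt
    · exact Continuous.integrableOn_Icc (by fun_prop)
    · intro t ht
      have ht0 : 0 < t := ht₀.trans ht.1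
      obtain ⟨-, hV0, -, hV'⟩ := hV t ht.1.le
      rw [max_eq_left ht0.le]
      have a1 : α * deriv F t * V t ≤ 0 :=
        mul_nonpos_of_nonpos_of_nonneg
          (mul_nonpos_of_nonneg_of_nonpos hα0 hFanti.deriv_nonpos) hV0
      have hαF0 : 0 ≤ α * F t := mul_nonneg hα0 (hFpos t).le
      have a2 : e ≤ X.E a g t := hmono (mem_Ici.2 ht0.le) (mem_Ici.2 hT0.le) ht.2.le
      have a3 := huxt X hX hux t ht.1.le
      have b1 := hξ.rpow_mul_quad_le hg hcu ht0.le hux he0 hεpos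
      have b2 := hξ.rpow_mul_quad_le hg hcut ht0.le (fun s hs => (hsec s hs).1) he0 hεpos
      change α * F t * _ ≤ _ * (_ * F t) + _ at b1
      change α * F t * _ ≤ _ * (_ * F t) + _ at b2
      rw [← hσ] at b1 b2
      have d1 := hg.weight_dissipation.quad_nonneg ht0.le X.ψ.ux
      have d2 := hg.weight_dissipation.quad_nonneg ht0.le X.ψ.uxt
      have d3 := hg.nonneg t
      have a4 := hαF t ht0.le
      set q0 := quad g X.ψ.ux t
      set q1 := quad g X.ψ.uxt t
      set p0 := quad k X.ψ.ux t
      set p1 := quad k X.ψ.uxt t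
      set Z := e ^ (2 * p - 1) * F t with hZ
      have hZ0 : 0 ≤ Z := mul_nonneg (by positivity) (hFpos t).le
      have a5 : α * F t * e = Z := by rw [hZ, ← hαe]; ring
      have f12 : -(c / 2) * e ^ (2 * p - 1) * F t = -(c / 2) * Z := by rw [hZ]; ring
      rw [f12]
      have := weighted_lyapunov_le hC₁.le hC₃.le hαF0 a4 hZ0 d1 d2 d3 (by positivity) a5
        b1 b2 hεD (hV'.trans (add_le_add
        (mul_le_mul_of_nonpos_left a2 (neg_nonpos.2 hc.le)) (by gcongr)))
      linarith
  have i1 : Continuous fun s => quad k X.ψ.ux (max s 0) + quad k X.ψ.uxt (max s 0) + g s := by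
    fun_prop
  rw [intervalIntegral.integral_add
    (Continuous.intervalIntegrable (by fun_prop) _ _)
    (Continuous.intervalIntegrable (by fun_prop) _ _),
    intervalIntegral.integral_const_mul, intervalIntegral.integral_const_mul] at key
  have i2 : ∫ s in t₀..T, (quad k X.ψ.ux (max s 0) + quad k X.ψ.uxt (max s 0) + g s) ≤
      2 * (1 + K₀) + C₂ + I := by
    have j1 : ∫ s in t₀..T, (quad k X.ψ.ux (max s 0) + quad k X.ψ.uxt (max s 0) + g s) ≤
        ∫ s in (0 : ℝ)..T, (quad k X.ψ.ux (max s 0) + quad k X.ψ.uxt (max s 0) + g s) := by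
      refine intervalIntegral.integral_mono_interval ht₀.le hT.le le_rfl
        (Eventually.of_forall fun s => ?_) (i1.intervalIntegrable _ _)
      have d1 := hg.weight_dissipation.quad_nonneg (le_max_right s 0) X.ψ.ux
      have d2 := hg.weight_dissipation.quad_nonneg (le_max_right s 0) X.ψ.uxt
      have d3 := hg.nonneg s
      simp only [Pi.zero_apply]
      positivity
    refine j1.trans ?_
    rw [intervalIntegral.integral_add (Continuous.intervalIntegrable (by fun_prop) _ _)
      (hgc.intervalIntegrable _ _), intervalIntegral.integral_add
      (hD1c.intervalIntegrable _ _) (hD2c.intervalIntegrable _ _)]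
    have j2 := hX.E_add_integral_le hg hκ hκg le_rfl (fun t _ => by simp) hT0.le
    rw [zero_mul, zero_mul, Real.exp_zero, one_mul] at j2
    have j3 := (hsec T hT0.le).2
    have j4 := hg.integral_le hT0.le
    have j5 := hEK 0 le_rfl
    linarith
  have hJ : 0 < ∫ s in t₀..T, F s :=
    intervalIntegral.intervalIntegral_pos_of_pos (hFc.intervalIntegrable _ _) hFpos hT
  set J := ∫ s in t₀..T, F s with hJdef
  have m1 : α * F t₀ * V t₀ ≤ W * (C₁ * K₀) := by
    obtain ⟨-, v1, v2, -⟩ := hV t₀ le_rfl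
    have v3 : V t₀ ≤ C₁ * K₀ := v2.trans (by have := hEK t₀ ht₀.le; gcongr)
    have v4 := hαF t₀ ht₀.le
    gcongr
  have m2 : 0 ≤ α * F T * V T := mul_nonneg (mul_nonneg hα0 (hFpos T).le) (hV T hT.le).2.1
  have m3 := mul_le_mul_of_nonneg_left i2 hC₅0
  have m4 : e ^ (2 * p - 1) * J ≤ C₆ := by
    have : c / 2 * (e ^ (2 * p - 1) * J) ≤
        W * (C₁ * K₀) + C₅ * (2 * (1 + K₀) + C₂ + I) := by linarith
    have n := mul_le_mul_of_nonneg_left this (show (0 : ℝ) ≤ 2 / c by positivity)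
    have e1 : 2 / c * (c / 2 * (e ^ (2 * p - 1) * J)) = e ^ (2 * p - 1) * J := by
      field_simp
    rw [e1] at n
    linarith
  have m5 : e ^ (2 * p - 1) ≤ C₆ * (1 / J) := by
    rw [mul_one_div, le_div_iff₀ hJ]; exact m4
  have m6 := Real.rpow_le_rpow (by positivity) m5 (show 0 ≤ 1 / (2 * p - 1) by positivity)
  rwa [Real.mul_rpow hC₆0.le (by positivity), ← Real.rpow_mul he0, mul_one_div_cancel hr.ne',
    Real.rpow_one] at m6

end IsSolution

/-! ### The derivative on `L²(0, L)` as an abstract system -/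

section Graphs

variable {L : ℝ}

theorem inner_toLp {η : ℝ → ℝ} (hη : MemLp η 2 (volume.restrict (Ioo (0 : ℝ) L))) (u : L2 L) :
    ⟪hη.toLp η, u⟫ = ∫ x in Ioo (0 : ℝ) L, u x * η x := by
  rw [L2.inner_def]
  refine integral_congr_ae ?_
  filter_upwards [hη.coeFn_toLp] with x hx
  simp [hx]

theorem memLp_test {η : ℝ → ℝ} (h1 : ContDiff ℝ ∞ η) (h2 : HasCompactSupport η) :
    MemLp η 2 (volume.restrict (Ioo (0 : ℝ) L)) :=
  (h1.continuous.memLp_of_hasCompactSupport h2).restrict _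

theorem memLp_deriv_test {η : ℝ → ℝ} (h1 : ContDiff ℝ ∞ η) (h2 : HasCompactSupport η) :
    MemLp (deriv η) 2 (volume.restrict (Ioo (0 : ℝ) L)) :=
  ((h1.continuous_deriv (by simp)).memLp_of_hasCompactSupport h2.deriv).restrict _

theorem isWeakDeriv_iff_inner {u v : L2 L} : IsWeakDeriv u v ↔
    ∀ (η : ℝ → ℝ) (h1 : ContDiff ℝ ∞ η) (h2 : HasCompactSupport η), tsupport η ⊆ Ioo 0 L →
      ⟪(memLp_deriv_test h1 h2).toLp (deriv η), u⟫ + ⟪(memLp_test h1 h2).toLp η, v⟫ = 0 := by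
  simp only [IsWeakDeriv, inner_toLp, eq_neg_iff_add_eq_zero]

/-- The graph of the weak derivative on `H¹(0, L)`. -/
def graphH1 (L : ℝ) : Submodule ℝ (L2 L × L2 L) where
  carrier := {p | IsWeakDeriv p.1 p.2}
  zero_mem' := isWeakDeriv_iff_inner.2 fun η h1 h2 h3 => by simp
  add_mem' := fun {p q} hp hq => isWeakDeriv_iff_inner.2 fun η h1 h2 h3 => by
    have a := isWeakDeriv_iff_inner.1 hp η h1 h2 h3
    have b := isWeakDeriv_iff_inner.1 hq η h1 h2 h3
    simp only [Prod.fst_add, Prod.snd_add, inner_add_right]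
    linarith
  smul_mem' := fun c p hp => isWeakDeriv_iff_inner.2 fun η h1 h2 h3 => by
    have a := isWeakDeriv_iff_inner.1 hp η h1 h2 h3
    simp only [Prod.smul_fst, Prod.smul_snd, real_inner_smul_right]
    rw [← mul_add, a, mul_zero]

theorem mem_graphH1 {p : L2 L × L2 L} : p ∈ graphH1 L ↔ IsWeakDeriv p.1 p.2 := Iff.rfl

/-- The graph of the weak derivative on `H¹₀(0, L)`. The boundary condition is encoded by the
integration by parts formula against `H¹(0, L)`, so that the graph is visibly closed. -/
def graphH10 (L : ℝ) : Submodule ℝ (L2 L × L2 L) where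
  carrier := {p | IsWeakDeriv p.1 p.2 ∧ ∀ q ∈ graphH1 L, ⟪q.2, p.1⟫ + ⟪q.1, p.2⟫ = 0}
  zero_mem' := ⟨(graphH1 L).zero_mem, fun q _ => by simp⟩
  add_mem' := fun {p p'} hp hp' => ⟨(graphH1 L).add_mem hp.1 hp'.1, fun q hq => by
    have a := hp.2 q hq
    have b := hp'.2 q hq
    simp only [Prod.fst_add, Prod.snd_add, inner_add_right]
    linarith⟩
  smul_mem' := fun c p hp => ⟨(graphH1 L).smul_mem c hp.1, fun q hq => by
    simp only [Prod.smul_fst, Prod.smul_snd, real_inner_smul_right]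
    rw [← mul_add, hp.2 q hq, mul_zero]⟩

theorem memL2s_iff_inner {u : L2 L} :
    MemL2s u ↔ ⟪(memLp_const (1 : ℝ)).toLp (fun _ => (1 : ℝ)), u⟫ = 0 := by
  rw [inner_toLp]
  simp [MemL2s]

/-- The graph of the weak derivative on `H¹_*(0, L)`. -/
def graphH1s (L : ℝ) : Submodule ℝ (L2 L × L2 L) where
  carrier := {p | IsWeakDeriv p.1 p.2 ∧ MemL2s p.1}
  zero_mem' := ⟨(graphH1 L).zero_mem, memL2s_iff_inner.2 (by simp)⟩
  add_mem' := fun {p p'} hp hp' => ⟨(graphH1 L).add_mem hp.1 hp'.1, memL2s_iff_inner.2 (by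
    rw [Prod.fst_add, inner_add_right, memL2s_iff_inner.1 hp.2, memL2s_iff_inner.1 hp'.2,
      add_zero])⟩
  smul_mem' := fun c p hp => ⟨(graphH1 L).smul_mem c hp.1, memL2s_iff_inner.2 (by
    rw [Prod.smul_fst, real_inner_smul_right, memL2s_iff_inner.1 hp.2, mul_zero])⟩

theorem isClosed_graphH1 : IsClosed (graphH1 L : Set (L2 L × L2 L)) := by
  have e : (graphH1 L : Set (L2 L × L2 L)) = ⋂ (η : ℝ → ℝ) (h1 : ContDiff ℝ ∞ η)
      (h2 : HasCompactSupport η) (_ : tsupport η ⊆ Ioo 0 L),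
      {p | ⟪(memLp_deriv_test h1 h2).toLp (deriv η), p.1⟫
        + ⟪(memLp_test h1 h2).toLp η, p.2⟫ = 0} := by
    ext p
    simp only [SetLike.mem_coe, mem_graphH1, mem_iInter, mem_ofPred_eq, isWeakDeriv_iff_inner]
  rw [e]
  exact isClosed_iInter fun η => isClosed_iInter fun h1 => isClosed_iInter fun h2 =>
    isClosed_iInter fun h3 => isClosed_eq (by fun_prop) continuous_const

theorem isClosed_graphH10 : IsClosed (graphH10 L : Set (L2 L × L2 L)) := by
  have e : (graphH10 L : Set (L2 L × L2 L)) = (graphH1 L : Set (L2 L × L2 L)) ∩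
      ⋂ q ∈ graphH1 L, {p | ⟪q.2, p.1⟫ + ⟪q.1, p.2⟫ = 0} := by
    ext p
    simp only [mem_inter_iff, mem_iInter, mem_ofPred_eq]
    rfl
  rw [e]
  exact isClosed_graphH1.inter (isClosed_iInter fun q => isClosed_iInter fun _ =>
    isClosed_eq (by fun_prop) continuous_const)

theorem isClosed_graphH1s : IsClosed (graphH1s L : Set (L2 L × L2 L)) := by
  have e : (graphH1s L : Set (L2 L × L2 L)) = (graphH1 L : Set (L2 L × L2 L)) ∩
      {p | ⟪(memLp_const (1 : ℝ)).toLp (fun _ => (1 : ℝ)), p.1⟫ = 0} := by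
    ext p
    simp only [mem_inter_iff, mem_ofPred_eq, ← memL2s_iff_inner]
    rfl
  rw [e]
  exact isClosed_graphH1.inter (isClosed_eq (by fun_prop) continuous_const)

theorem MemH1.mem_graph {u : L2 L} (hu : MemH1 u) : (u, dx u) ∈ graphH1 L := isWeakDeriv_dx hu

theorem MemH10.mem_graph (hL : 0 < L) {u : L2 L} (hu : MemH10 u) : (u, dx u) ∈ graphH10 L :=
  ⟨isWeakDeriv_dx hu.1, fun _ hq => MemH10.inner_add_inner hL hq hu⟩

theorem MemH1s.mem_graph {u : L2 L} (hu : MemH1s u) : (u, dx u) ∈ graphH1s L :=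
  ⟨isWeakDeriv_dx hu.1, hu.2⟩

/-- The weak derivative on `(0, L)` with Dirichlet and mean-zero conditions. -/
def sobolevSystem (L : ℝ) (hL : 0 < L) : DerivSystem (L2 L) where
  H1 := graphH1 L
  H10 := graphH10 L
  H1s := graphH1s L
  c := L
  c_pos := hL
  H1s_le := fun _ hp => hp.1
  parts := fun p hp _ hq => hq.2 p hp
  poincare10 := fun _ hp => norm_le_of_inner_add_inner hL fun u u' hu => hp.2 (u, u') hu
  poincares := fun _ hp => hp.2.norm_le hL hp.1

end Graphs

/-! ### Extension of strong solutions to negative times -/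

section Extension

variable {E : Type*} [NormedAddCommGroup E] [NormedSpace ℝ E]

theorem mem_of_hasDerivWithinAt_Ici {V : Submodule ℝ E} (hV : IsClosed (V : Set E)) {f : ℝ → E}
    {f' : E} {t : ℝ} (ht : 0 ≤ t) (hf : ∀ s, 0 ≤ s → f s ∈ V)
    (h : HasDerivWithinAt f f' (Ici 0) t) : f' ∈ V := by
  have h2 : HasDerivWithinAt f f' (Ioi t) t :=
    h.mono fun s hs => mem_Ici.2 (ht.trans (le_of_lt hs))
  rw [hasDerivWithinAt_iff_tendsto_slope' self_notMem_Ioi] at h2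
  refine hV.mem_of_tendsto h2 ?_
  filter_upwards [self_mem_nhdsWithin] with s hs
  exact V.smul_mem _ (V.sub_mem (hf s (ht.trans (le_of_lt hs))) (hf t ht))

theorem continuous_derivWithin_max {f : ℝ → E} (hf : ContDiffOn ℝ 1 f (Ici 0)) :
    Continuous fun t => derivWithin f (Ici 0) (max t 0) :=
  (hf.continuousOn_derivWithin (uniqueDiffOn_Ici 0) le_rfl).comp_continuous (by fun_prop)
    fun _ => mem_Ici.2 (le_max_right _ _)

theorem ContDiffOn.hasDerivWithinAt_Ici {f : ℝ → E} (hf : ContDiffOn ℝ 1 f (Ici 0)) {t : ℝ}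
    (ht : 0 ≤ t) : HasDerivWithinAt f (derivWithin f (Ici 0) t) (Ici 0) t :=
  (hf.differentiableOn one_ne_zero t ht).hasDerivWithinAt

variable [CompleteSpace E]

theorem hasDerivAt_const_add_integral {f : ℝ → E} (hf : Continuous f) (c : E) (t : ℝ) :
    HasDerivAt (fun t => c + ∫ s in (0 : ℝ)..t, f s) (f t) t :=
  (intervalIntegral.integral_hasDerivAt_right (hf.intervalIntegrable _ _)
    (hf.stronglyMeasurableAtFilter _ _) hf.continuousAt).const_add c

theorem add_integral_derivWithin_max {f : ℝ → E} (hf : ContDiffOn ℝ 1 f (Ici 0)) {t : ℝ}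
    (ht : 0 ≤ t) : f 0 + ∫ s in (0 : ℝ)..t, derivWithin f (Ici 0) (max s 0) = f t := by
  have h := intervalIntegral.integral_eq_sub_of_hasDeriv_right_of_le ht
    (hf.continuousOn.mono Icc_subset_Ici_self)
    (f' := fun s => derivWithin f (Ici 0) (max s 0)) (fun s hs => ?_)
    ((continuous_derivWithin_max hf).intervalIntegrable _ _)
  · rw [h]; abel
  · have h2 := ContDiffOn.hasDerivWithinAt_Ici hf hs.1.le
    simp only [max_eq_left hs.1.le]
    exact h2.mono fun r hr => mem_Ici.2 (hs.1.le.trans (le_of_lt hr))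

end Extension

section Motion

variable {L : ℝ}

/-- The extension to all times of a path `u` defined for `t ≥ 0`: `u_tt`, `u_xt` and `u_xx` are
extended by their values at `0`, and the other components are recovered by integration in time. -/
def extend (u : ℝ → L2 L) : Motion (L2 L) where
  u := fun t => u 0 + ∫ s in (0 : ℝ)..t, (dt u 0 + ∫ r in (0 : ℝ)..s, dt (dt u) (max r 0))
  ux := fun t => dx (u 0) + ∫ s in (0 : ℝ)..t, dt (fun r => dx (u r)) (max s 0)
  uxx := fun t => dx (dx (u (max t 0)))
  ut := fun t => dt u 0 + ∫ s in (0 : ℝ)..t, dt (dt u) (max s 0)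
  uxt := fun t => dt (fun r => dx (u r)) (max t 0)
  utt := fun t => dt (dt u) (max t 0)

namespace StrongRegularity

variable {P₂ P₁ : L2 L → Prop} {u : ℝ → L2 L} (hu : StrongRegularity P₂ P₁ u)
include hu

theorem contDiffOn_dt : ContDiffOn ℝ 1 (dt u) (Ici 0) :=
  hu.contDiff_zero.derivWithin (uniqueDiffOn_Ici 0) (by norm_num)

theorem contDiffOn_dx : ContDiffOn ℝ 1 (fun t => dx (u t)) (Ici 0) :=
  contDiff_snd.comp_contDiffOn hu.contDiff_one

theorem extend_ut {t : ℝ} (ht : 0 ≤ t) : (extend u).ut t = dt u t :=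
  add_integral_derivWithin_max hu.contDiffOn_dt ht

theorem extend_ux {t : ℝ} (ht : 0 ≤ t) : (extend u).ux t = dx (u t) :=
  add_integral_derivWithin_max hu.contDiffOn_dx ht

theorem extend_u {t : ℝ} (ht : 0 ≤ t) : (extend u).u t = u t := by
  have h := add_integral_derivWithin_max (hu.contDiff_zero.of_le one_le_two) ht
  rw [← h]
  change _ + _ = _ + _
  congr 1
  refine intervalIntegral.integral_congr fun s hs => ?_
  rw [uIcc_of_le ht] at hs
  simp only [max_eq_left hs.1]
  exact hu.extend_ut hs.1

theorem hasDerivWithinAt_jet1 {t : ℝ} (ht : 0 ≤ t) :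
    HasDerivWithinAt (fun s => (u s, dx (u s))) (dt u t, dt (fun r => dx (u r)) t) (Ici 0) t :=
  (ContDiffOn.hasDerivWithinAt_Ici (hu.contDiff_zero.of_le one_le_two) ht).prodMk
    (ContDiffOn.hasDerivWithinAt_Ici hu.contDiffOn_dx ht)

/-- Derivatives in space and time commute. -/
theorem dx_dt (h : ∀ s, 0 ≤ s → MemH1 (u s)) {t : ℝ} (ht : 0 ≤ t) :
    dx (dt u t) = dt (fun r => dx (u r)) t :=
  IsWeakDeriv.dx_eq (mem_of_hasDerivWithinAt_Ici isClosed_graphH1 ht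
    (fun s hs => (h s hs).mem_graph) (hu.hasDerivWithinAt_jet1 ht))

theorem isMotion {V W : Submodule ℝ (L2 L × L2 L)}
    (hV : IsClosed (V : Set (L2 L × L2 L))) (h1 : ∀ s, 0 ≤ s → (u s, dx (u s)) ∈ V)
    (h2 : ∀ s, 0 ≤ s → (dx (u s), dx (dx (u s))) ∈ W) : IsMotion V W (extend u) := by
  have ctt : Continuous (extend u).utt := continuous_derivWithin_max hu.contDiffOn_dt
  have cxt : Continuous (extend u).uxt := continuous_derivWithin_max hu.contDiffOn_dx
  have dt' : ∀ t, HasDerivAt (extend u).ut ((extend u).utt t) t := fun t =>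
    hasDerivAt_const_add_integral ctt _ t
  have ct : Continuous (extend u).ut :=
    continuous_iff_continuousAt.2 fun t => (dt' t).continuousAt
  refine ⟨fun t => hasDerivAt_const_add_integral ct _ t,
    fun t => hasDerivAt_const_add_integral cxt _ t, dt', ?_, cxt, ctt, ?_, ?_, ?_⟩
  · exact (continuous_snd.comp continuous_snd).comp
      (hu.cont_two.comp_continuous (f := fun t => max t 0) (by fun_prop)
        fun _ => mem_Ici.2 (le_max_right _ _))
  · intro t ht
    rw [hu.extend_u ht, hu.extend_ux ht]
    exact h1 t ht
  · intro t ht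
    rw [hu.extend_ut ht]
    simp only [extend, max_eq_left ht]
    exact mem_of_hasDerivWithinAt_Ici hV ht h1 (hu.hasDerivWithinAt_jet1 ht)
  · intro t ht
    rw [hu.extend_ux ht]
    simp only [extend, max_eq_left ht]
    exact h2 t ht

end StrongRegularity

end Motion

/-! ### Strong solutions -/

section Strong

theorem AssumptionA1.isRelaxation {k₂ : ℝ} {g : ℝ → ℝ} (h : AssumptionA1 k₂ g) :
    IsRelaxation (fun t => g (max t 0)) (fun t => -derivWithin g (Ici 0) t) where
  continuous := h.differentiable.continuousOn.comp_continuous (by fun_prop)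
    fun _ => mem_Ici.2 (le_max_right _ _)
  antitone := fun s t hst => h.antitone (mem_Ici.2 (le_max_right _ _))
    (mem_Ici.2 (le_max_right _ _)) (max_le_max_right 0 hst)
  nonneg := fun t => h.nonneg _ (le_max_right _ _)
  pos_zero := by simpa using h.pos_zero
  hasDerivAt := fun t ht => by
    rw [neg_neg]
    refine (((h.differentiable t (mem_Ici.2 ht.le)).hasDerivWithinAt).hasDerivAt
      (Ici_mem_nhds ht)).congr_of_eventuallyEq ?_
    filter_upwards [Ioi_mem_nhds ht] with s hs
    rw [max_eq_left (le_of_lt hs)]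
  integrable := h.integrable.congr_fun (fun s hs => by simp [le_of_lt (mem_Ioi.1 hs)])
    measurableSet_Ioi

theorem integral_Ioi_comp_max (g : ℝ → ℝ) :
    ∫ s in Ioi (0 : ℝ), g (max s 0) = ∫ s in Ioi (0 : ℝ), g s :=
  setIntegral_congr_fun measurableSet_Ioi fun s hs => by simp [le_of_lt (mem_Ioi.1 hs)]

theorem AssumptionA2.isRate {g ξ : ℝ → ℝ} {p : ℝ} (h : AssumptionA2 g ξ p) :
    IsRate (fun t => g (max t 0)) (fun t => -derivWithin g (Ici 0) t) (fun t => ξ (max t 0)) p where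
  continuous := h.differentiable.continuousOn.comp_continuous (by fun_prop)
    fun _ => mem_Ici.2 (le_max_right _ _)
  antitone := fun s t hst => h.antitone (mem_Ici.2 (le_max_right _ _))
    (mem_Ici.2 (le_max_right _ _)) (max_le_max_right 0 hst)
  pos := fun t => h.pos _ (le_max_right _ _)
  differentiableAt := fun t ht => by
    refine ((h.differentiable t (mem_Ici.2 ht.le)).differentiableAt
      (Ici_mem_nhds ht)).congr_of_eventuallyEq ?_
    filter_upwards [Ioi_mem_nhds ht] with s hs
    rw [max_eq_left (le_of_lt hs)]
  one_le := h.one_le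
  lt_three_halves := h.lt_three_halves
  mul_rpow_le := fun t ht => by
    have := h.deriv_le t ht.le
    simp only [max_eq_left ht.le]
    linarith

variable {L : ℝ} {a : Coeffs} {g : ℝ → ℝ} {φ₀ φ₁ ψ₀ ψ₁ w₀ w₁ : L2 L} {φ ψ w : ℝ → L2 L}

/-- A strong solution extended to all times. -/
def extendTriple (φ ψ w : ℝ → L2 L) : Triple (L2 L) := ⟨extend φ, extend ψ, extend w⟩

theorem dx_add_add_smul {x y z : L2 L} (hx : MemH1 x) (hy : MemH1 y) (hz : MemH1 z) (c : ℝ) :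
    dx (x + y + c • z) = dx x + dx y + c • dx z :=
  IsWeakDeriv.dx_eq ((graphH1 L).add_mem ((graphH1 L).add_mem hx.mem_graph hy.mem_graph)
    ((graphH1 L).smul_mem c hz.mem_graph))

theorem dx_sub_smul {x z : L2 L} (hx : MemH1 x) (hz : MemH1 z) (c : ℝ) :
    dx (x - c • z) = dx x - c • dx z :=
  IsWeakDeriv.dx_eq ((graphH1 L).sub_mem hx.mem_graph ((graphH1 L).smul_mem c hz.mem_graph))

namespace IsStrongSolution

variable (h : IsStrongSolution a.ρ₁ a.ρ₂ a.k₁ a.k₂ a.k₁ a.l g φ₀ φ₁ ψ₀ ψ₁ w₀ w₁ φ ψ w)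
include h

theorem extend_A {t : ℝ} (ht : 0 ≤ t) :
    (extendTriple φ ψ w).A a t = dx (φ t) + ψ t + a.l • w t := by
  simp only [Triple.A, extendTriple, h.reg_φ.extend_ux ht, h.reg_ψ.extend_u ht,
    h.reg_w.extend_u ht]

theorem extend_B {t : ℝ} (ht : 0 ≤ t) : (extendTriple φ ψ w).B a t = dx (w t) - a.l • φ t := by
  simp only [Triple.B, extendTriple, h.reg_w.extend_ux ht, h.reg_φ.extend_u ht]

theorem isSolution (hL : 0 < L) :
    IsSolution (sobolevSystem L hL) a (fun t => g (max t 0)) 0 (extendTriple φ ψ w) where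
  φ := h.reg_φ.isMotion isClosed_graphH10 (fun s hs => (h.reg_φ.mem_one s hs).mem_graph hL)
    fun s hs => (h.reg_φ.mem_two s hs).1.2.mem_graph
  ψ := h.reg_ψ.isMotion isClosed_graphH1s (fun s hs => (h.reg_ψ.mem_one s hs).mem_graph)
    fun s hs => (h.reg_ψ.mem_two s hs).1.2.mem_graph hL
  w := h.reg_w.isMotion isClosed_graphH1s (fun s hs => (h.reg_w.mem_one s hs).mem_graph)
    fun s hs => (h.reg_w.mem_two s hs).1.2.mem_graph hL
  eq_φ := fun t ht => by
    have e := h.eq_φ t ht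
    rw [dx_add_add_smul (h.reg_φ.mem_two t ht.le).1.2 (h.reg_ψ.mem_one t ht.le).1
      (h.reg_w.mem_one t ht.le).1, sub_sub, sub_eq_zero] at e
    rw [h.extend_B ht.le]
    simp only [Triple.Ax, extendTriple, h.reg_ψ.extend_ux ht.le, h.reg_w.extend_ux ht.le]
    simp only [extend, max_eq_left ht.le]
    exact e
  eq_ψ := fun t ht => by
    have e := h.eq_ψ t ht
    have c : conv (fun t => g (max t 0)) (extend ψ).uxx t =
        ∫ s in (0 : ℝ)..t, g (t - s) • dx (dx (ψ s)) := by
      refine intervalIntegral.integral_congr fun s hs => ?_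
      rw [uIcc_of_le ht.le] at hs
      simp only [extend, max_eq_left hs.1, max_eq_left (sub_nonneg.2 hs.2)]
    rw [h.extend_A ht.le]
    simp only [Triple.Mx, extendTriple, c]
    simp only [extend, max_eq_left ht.le, Pi.zero_apply, sub_zero]
    rw [← sub_eq_zero]
    refine Eq.trans ?_ e
    abel
  eq_w := fun t ht => by
    have e := h.eq_w t ht
    rw [dx_sub_smul (h.reg_w.mem_two t ht.le).1.1.2 (h.reg_φ.mem_one t ht.le).1] at e
    rw [h.extend_A ht.le]
    simp only [Triple.Bx, extendTriple, h.reg_φ.extend_ux ht.le]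
    simp only [extend, max_eq_left ht.le]
    rw [← sub_eq_zero, ← e]
    abel

theorem energy_eq {t : ℝ} (ht : 0 ≤ t) :
    energy a.ρ₁ a.ρ₂ a.k₁ a.k₂ a.k₁ a.l g φ ψ w t =
      (extendTriple φ ψ w).E a (fun t => g (max t 0)) t := by
  have e1 : ∫ s in (0 : ℝ)..t, g s = ∫ s in (0 : ℝ)..t, g (max s 0) := by
    refine intervalIntegral.integral_congr fun s hs => ?_
    rw [uIcc_of_le ht] at hs
    simp only [max_eq_left hs.1]
  have e2 : memoryForm g (fun s => dx (ψ s)) t =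
      quad (fun t => g (max t 0)) (extendTriple φ ψ w).ψ.ux t := by
    refine intervalIntegral.integral_congr fun s hs => ?_
    rw [uIcc_of_le ht] at hs
    simp only [extendTriple, h.reg_ψ.extend_ux ht, h.reg_ψ.extend_ux hs.1,
      max_eq_left (sub_nonneg.2 hs.2)]
  rw [energy, Triple.E, e2, h.extend_A ht, h.extend_B ht, e1]
  simp only [extendTriple, h.reg_φ.extend_ut ht, h.reg_ψ.extend_ut ht, h.reg_w.extend_ut ht,
    h.reg_ψ.extend_ux ht]

end IsStrongSolution

/-! ### Initial values and smallness of `l` -/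

/-- The constant motion whose components are `u₀`, its derivatives, `u₁`, its derivative, and
`u₂`. It records the values at time `0` of a motion with initial data `(u₀, u₁)` and `u_tt(0) = u₂`. -/
def initialMotion (u₀ u₁ u₂ : L2 L) : Motion (L2 L) :=
  ⟨fun _ => u₀, fun _ => dx u₀, fun _ => dx (dx u₀), fun _ => u₁, fun _ => dx u₁, fun _ => u₂⟩

theorem StrongRegularity.extend_zero {P₂ P₁ : L2 L → Prop} {u : ℝ → L2 L}
    (hu : StrongRegularity P₂ P₁ u) (h1 : ∀ s, 0 ≤ s → MemH1 (u s)) :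
    (extend u).u 0 = u 0 ∧ (extend u).ux 0 = dx (u 0) ∧ (extend u).uxx 0 = dx (dx (u 0)) ∧
      (extend u).ut 0 = dt u 0 ∧ (extend u).uxt 0 = dx (dt u 0) := by
  refine ⟨hu.extend_u le_rfl, hu.extend_ux le_rfl, by simp [extend], hu.extend_ut le_rfl, ?_⟩
  rw [hu.dx_dt h1 le_rfl]
  simp [extend]

/-- The values at time `0` of a strong solution, as determined by the initial data: the second
derivatives in time are given by the equations, where the memory term vanishes. -/
def initialTriple (a : Coeffs) (φ₀ φ₁ ψ₀ ψ₁ w₀ w₁ : L2 L) : Triple (L2 L) :=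
  let Y : Triple (L2 L) := ⟨initialMotion φ₀ φ₁ 0, initialMotion ψ₀ ψ₁ 0, initialMotion w₀ w₁ 0⟩
  ⟨initialMotion φ₀ φ₁ (a.ρ₁⁻¹ • (a.k₁ • Y.Ax a 0 + (a.l * a.k₁) • Y.B a 0)),
    initialMotion ψ₀ ψ₁ (a.ρ₂⁻¹ • (a.k₂ • Y.ψ.uxx 0 - a.k₁ • Y.A a 0)),
    initialMotion w₀ w₁ (a.ρ₁⁻¹ • (a.k₁ • Y.Bx a 0 - (a.l * a.k₁) • Y.A a 0))⟩

end Strong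

namespace IsSolution

variable {S : DerivSystem H} {a : Coeffs} {g k : ℝ → ℝ} {X : Triple H}

omit [CompleteSpace H] in
/-- The equations hold at time `0` as well. -/
theorem utt_zero (hX : IsSolution S a g 0 X) (hg : IsRelaxation g k) :
    X.φ.utt 0 = a.ρ₁⁻¹ • (a.k₁ • X.Ax a 0 + (a.l * a.k₁) • X.B a 0) ∧
    X.ψ.utt 0 = a.ρ₂⁻¹ • (a.k₂ • X.ψ.uxx 0 - a.k₁ • X.A a 0) ∧
    X.w.utt 0 = a.ρ₁⁻¹ • (a.k₁ • X.Bx a 0 - (a.l * a.k₁) • X.A a 0) := by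
  have key : ∀ {f₁ f₂ : ℝ → H}, Continuous f₁ → Continuous f₂ → (∀ t, 0 < t → f₁ t = f₂ t) →
      f₁ 0 = f₂ 0 := by
    intro f₁ f₂ h1 h2 h
    have hc : closure (Ioi (0 : ℝ)) ⊆ {t | f₁ t = f₂ t} :=
      (isClosed_eq h1 h2).closure_subset_iff.2 fun t ht => h t ht
    rw [closure_Ioi] at hc
    exact hc (mem_Ici.2 le_rfl)
  have r1 := a.ρ₁_pos.ne'
  have r2 := a.ρ₂_pos.ne'
  have c1 := hX.φ.cont_uxx
  have c2 := hX.ψ.cont_uxx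
  have c3 := hX.w.cont_uxx
  have c4 := hX.φ.cont_utt
  have c5 := hX.ψ.cont_utt
  have c6 := hX.w.cont_utt
  have c7 := hX.φ.cont_ux
  have c8 := hX.ψ.cont_ux
  have c9 := hX.w.cont_ux
  have cA : Continuous (X.A a) :=
    continuous_iff_continuousAt.2 fun t => (hX.hasDerivAt_A t).continuousAt
  have cB : Continuous (X.B a) :=
    continuous_iff_continuousAt.2 fun t => (hX.hasDerivAt_B t).continuousAt
  have cAx : Continuous (X.Ax a) := by unfold Triple.Ax; fun_prop
  have cBx : Continuous (X.Bx a) := by unfold Triple.Bx; fun_prop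
  have cM := hg.continuous_conv c2
  have cMx : Continuous (X.Mx a g) := by unfold Triple.Mx; fun_prop
  have e1 := key (f₁ := fun t => a.ρ₁ • X.φ.utt t) (by fun_prop) (by fun_prop) hX.eq_φ
  have e2 := key (f₁ := fun t => a.ρ₂ • X.ψ.utt t)
    (f₂ := fun t => X.Mx a g t - a.k₁ • X.A a t) (by fun_prop) (by fun_prop)
    (fun t ht => by simpa using hX.eq_ψ t ht)
  have e3 := key (f₁ := fun t => a.ρ₁ • X.w.utt t) (by fun_prop) (by fun_prop) hX.eq_w
  simp only [Triple.Mx, conv, intervalIntegral.integral_same, sub_zero] at e2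
  rw [← e1, ← e2, ← e3, inv_smul_smul₀ r1, inv_smul_smul₀ r2, inv_smul_smul₀ r1]
  exact ⟨rfl, rfl, rfl⟩

end IsSolution

/-- The quantities that enter the decay estimate depend on the initial data only. -/
theorem IsStrongSolution.initial_eq {L : ℝ} {a : Coeffs} {g : ℝ → ℝ}
    {φ₀ φ₁ ψ₀ ψ₁ w₀ w₁ : L2 L} {φ ψ w : ℝ → L2 L}
    (h : IsStrongSolution a.ρ₁ a.ρ₂ a.k₁ a.k₂ a.k₁ a.l g φ₀ φ₁ ψ₀ ψ₁ w₀ w₁ φ ψ w) (hL : 0 < L)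
    (hA1 : AssumptionA1 a.k₂ g) (G : ℝ → ℝ) :
    (extendTriple φ ψ w).E a G 0 = (initialTriple a φ₀ φ₁ ψ₀ ψ₁ w₀ w₁).E a G 0 ∧
    (extendTriple φ ψ w).Q₂ a 0 = (initialTriple a φ₀ φ₁ ψ₀ ψ₁ w₀ w₁).Q₂ a 0 ∧
    (extendTriple φ ψ w).ψ.uxx 0 = dx (dx ψ₀) := by
  obtain ⟨a1, a2, a3, a4, a5⟩ := h.reg_φ.extend_zero fun s hs => (h.reg_φ.mem_one s hs).1
  obtain ⟨b1, b2, b3, b4, b5⟩ := h.reg_ψ.extend_zero fun s hs => (h.reg_ψ.mem_one s hs).1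
  obtain ⟨c1, c2, c3, c4, c5⟩ := h.reg_w.extend_zero fun s hs => (h.reg_w.mem_one s hs).1
  rw [h.init_φ] at a1 a2 a3
  rw [h.init_φt] at a4 a5
  rw [h.init_ψ] at b1 b2 b3
  rw [h.init_ψt] at b4 b5
  rw [h.init_w] at c1 c2 c3
  rw [h.init_wt] at c4 c5
  obtain ⟨d1, d2, d3⟩ := (h.isSolution hL).utt_zero hA1.isRelaxation
  simp only [Triple.Ax, Triple.B, Triple.A, Triple.Bx, extendTriple, a1, a2, a3, b1, b2, b3,
    c1, c2, c3] at d1 d2 d3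
  refine ⟨?_, ?_, b3⟩
  · simp only [Triple.E, quad, Triple.A, Triple.B, initialTriple, initialMotion, extendTriple,
      intervalIntegral.integral_same, a1, a2, a4, b1, b2, b4, c1, c2, c4]
  · simp only [Triple.Q₂, Triple.At, Triple.Bt, Triple.Ax, Triple.Bx, Triple.A, Triple.B,
      initialTriple, initialMotion, extendTriple, a4, a5, b4, b5, c4, c5, d1, d2, d3]

/-- The smallness condition holds for all small `l`. -/
theorem exists_isSmall {ρ₁ ρ₂ k₁ k₂ c κ : ℝ} (h₁ : 0 < ρ₁) (h₂ : 0 < ρ₂) (hk₁ : 0 < k₁)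
    (hk₂ : 0 < k₂) (hc : 0 < c) (hκ : 0 < κ) :
    ∃ l₀ > 0, ∀ l (hl : 0 < l), l < l₀ →
      Coeffs.IsSmall ⟨ρ₁, ρ₂, k₁, k₂, l, h₁, h₂, hk₁, hk₂, hl⟩ c κ := by
  set N := k₁ * c ^ 2 / κ + 28 with hN
  set D := 4 * N ^ 2 * k₂ ^ 2 / k₁ + 24 * k₁ * c ^ 2 with hD
  have hDpos : 0 < D := by positivity
  refine ⟨min 1 (min (1 / (9 * c)) (κ / (4 * D))), by positivity, fun l hl hlt => ?_⟩
  obtain ⟨l1, l2⟩ := lt_min_iff.1 hlt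
  obtain ⟨l2, l3⟩ := lt_min_iff.1 l2
  refine ⟨l1.le, ?_, ?_⟩
  · rw [lt_div_iff₀ (by positivity)] at l2
    have : 0 < l * c := by positivity
    change 70 * c ^ 2 * l ^ 2 ≤ 1
    nlinarith
  · rw [lt_div_iff₀ (by positivity)] at l3
    change l * D ≤ κ / 4
    linarith

end Bresse

end

theorem mainTheorem2 (L ρ₁ ρ₂ k₁ k₂ k₃ : ℝ) (hL : 0 < L) (hρ₁ : 0 < ρ₁) (hρ₂ : 0 < ρ₂)
    (hk₁ : 0 < k₁) (hk₂ : 0 < k₂) (hk₃ : 0 < k₃)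
    (hspeed : ρ₁ / k₁ ≠ ρ₂ / k₂) (hk₁₃ : k₁ = k₃)
    (g : ℝ → ℝ) (hA1 : Bresse.AssumptionA1 k₂ g) :
    ∃ l₀ : ℝ, 0 < l₀ ∧ ∀ l : ℝ, 0 < l → l < l₀ →
      ∀ (ξ : ℝ → ℝ) (p : ℝ), Bresse.AssumptionA2 g ξ p →
      ∀ φ₀ φ₁ ψ₀ ψ₁ w₀ w₁ : Bresse.L2 L,
        Bresse.MemH2H10 φ₀ → Bresse.MemH10 φ₁ →
        Bresse.MemH2sH1s ψ₀ → Bresse.MemH1s ψ₁ →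
        Bresse.MemH2sH1s w₀ → Bresse.MemH1s w₁ →
        ∀ t₀ : ℝ, 0 < t₀ →
          ∃ C : ℝ, 0 < C ∧
            ∀ φ ψ w : ℝ → Bresse.L2 L,
              Bresse.IsStrongSolution ρ₁ ρ₂ k₁ k₂ k₃ l g φ₀ φ₁ ψ₀ ψ₁ w₀ w₁ φ ψ w →
              ∀ t : ℝ, t₀ < t →
                Bresse.energy ρ₁ ρ₂ k₁ k₂ k₃ l g φ ψ w t ≤
                  C * (1 / ∫ s in t₀..t, ξ s ^ (2 * p - 1)) ^ (1 / (2 * p - 1)) := by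
  subst hk₁₃
  have hg := hA1.isRelaxation
  set κ := k₂ - ∫ s in Set.Ioi (0 : ℝ), g s with hκ
  have hκ0 : 0 < κ := hA1.integral_lt
  obtain ⟨l₀, hl₀, hsmall⟩ := Bresse.exists_isSmall hρ₁ hρ₂ hk₁ hk₂ hL hκ0
  refine ⟨l₀, hl₀, fun l hl hll ξ p hA2 φ₀ φ₁ ψ₀ ψ₁ w₀ w₁ _ _ _ _ _ _ t₀ ht₀ => ?_⟩
  set a : Bresse.Coeffs := ⟨ρ₁, ρ₂, k₁, k₂, l, hρ₁, hρ₂, hk₁, hk₂, hl⟩ with ha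
  set G : ℝ → ℝ := fun t => g (max t 0) with hG
  set X₀ := Bresse.initialTriple a φ₀ φ₁ ψ₀ ψ₁ w₀ w₁ with hX₀
  -- a bound for the initial values that is fixed before the solution is given
  set K := max (X₀.E a G 0) (max (X₀.Q₂ a 0) ‖Bresse.dx (Bresse.dx ψ₀)‖) with hK
  obtain ⟨C, hC, hdecay⟩ := Bresse.IsSolution.exists_decay (S := Bresse.sobolevSystem L hL)
    (a := a) hg hA2.isRate hκ0 (by rw [Bresse.integral_Ioi_comp_max]; simp [hκ, ha])
    (hsmall l hl hll) ht₀ K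
  refine ⟨C, hC, fun φ ψ w h t ht => ?_⟩
  replace h : Bresse.IsStrongSolution a.ρ₁ a.ρ₂ a.k₁ a.k₂ a.k₁ a.l g φ₀ φ₁ ψ₀ ψ₁ w₀ w₁ φ ψ w := h
  obtain ⟨i1, i2, i3⟩ := h.initial_eq hL hA1 G
  have key := hdecay _ (h.isSolution hL) (i1.trans_le (le_max_left _ _))
    (i2.trans_le ((le_max_left _ _).trans (le_max_right _ _)))
    ((congrArg norm i3).trans_le ((le_max_right _ _).trans (le_max_right _ _))) t ht
  have hξ : ∫ s in t₀..t, ξ s ^ (2 * p - 1) = ∫ s in t₀..t, ξ (max s 0) ^ (2 * p - 1) := by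
    refine intervalIntegral.integral_congr fun s hs => ?_
    rw [Set.uIcc_of_le ht.le] at hs
    simp only [max_eq_left (ht₀.le.trans hs.1)]
  rw [hξ]
  exact (h.energy_eq (ht₀.trans ht).le).trans_le key
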